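/- There is a single deterministic algorithm (a program for a real RAM: memory cells for natural numbers and for real numbers; unit-cost exact $+,-,\times,\div$ and comparisons on reals, unit-cost $+,-$ and comparisons on natural numbers, indirect addressing, no rounding, only rational constants) with the following property. Given $d\ge 1$, $m\ge 2$, $\epsilon\in(0,1]$ and vectors $v_1,\dots,v_m\in\mathbb{R}^d$, the algorithm runs in time $O\big(d\,m^2\,(\log m+1/\epsilon)^{O(1)}\big)$ and outputs an integer $k=O\big((\log m)/\epsilon^2\big)$ and the $k\times d$ matrix of a linear map $A:\mathbb{R}^d\to\mathbb{R}^k$ such that $$\mathbb{E}_{x}\Big[\sup_{i}|\langle v_i,x\rangle|\Big]\;\le\;\mathbb{E}_{y}\Big[\sup_{i}|\langle A v_i,y\rangle|\Big]\;\le\;(1+\epsilon)\,\mathbb{E}_{x}\Big[\sup_{i}|\langle v_i,x\rangle|\Big],$$ where $x$ and $y$ are standard Gaussian vectors in $\mathbb{R}^d$ and $\mathbb{R}^k$, respectively. The constants hidden in $O(\cdot)$ are absolute: they do not depend on $d$, $m$, $\epsilon$ or the vectors. -/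

import Mathlib

open MeasureTheory ProbabilityTheory

/-! ### The expected supremum of a finite Gaussian process -/

/-- The standard Gaussian measure on `ℝ^n`: the coordinates are independent `N(0,1)` variables. -/
noncomputable def gaussianVec (n : ℕ) : Measure (Fin n → ℝ) :=
  Measure.pi fun _ => gaussianReal 0 1

/-- `E[sup_i |⟨u_i, x⟩|]` for a standard Gaussian vector `x` of `ℝ^n`. -/
noncomputable def expSup {m n : ℕ} (u : Fin m → Fin n → ℝ) : ℝ :=
  ∫ x, ⨆ i, |u i ⬝ᵥ x| ∂(gaussianVec n)

/-- The random variable in `expSup` is integrable, so that `expSup` is a genuine expectation. -/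
theorem integrable_iSup_abs_dotProduct {m n : ℕ} (u : Fin m → Fin n → ℝ) :
    Integrable (fun x : Fin n → ℝ => ⨆ i, |u i ⬝ᵥ x|) (gaussianVec n) := by
  have hx : ∀ j : Fin n, Integrable (fun x : Fin n → ℝ => x j) (gaussianVec n) := fun j =>
    (measurePreserving_eval (fun _ : Fin n => gaussianReal 0 1) j).integrable_comp_of_integrable
      ((memLp_id_gaussianReal 1).integrable (by simp))
  have hd : ∀ i, Integrable (fun x : Fin n → ℝ => |u i ⬝ᵥ x|) (gaussianVec n) := fun i => by
    have h := (integrable_finsetSum Finset.univ fun j _ => (hx j).const_mul (u i j)).abs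
    exact h
  have hs := integrable_finsetSum Finset.univ fun i _ => hd i
  refine hs.mono' ?_ (Filter.Eventually.of_forall fun x => ?_)
  · exact (Measurable.iSup fun i => by unfold dotProduct; fun_prop).aestronglyMeasurable
  · have h0 : 0 ≤ ⨆ i, |u i ⬝ᵥ x| := Real.iSup_nonneg fun i => abs_nonneg _
    rw [Real.norm_of_nonneg h0]
    refine Real.iSup_le (fun i => ?_) (Finset.sum_nonneg fun i _ => abs_nonneg _)
    exact Finset.single_le_sum (f := fun i => |u i ⬝ᵥ x|) (fun i _ => abs_nonneg _)
      (Finset.mem_univ i)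

/-! ### Real random access machines

The memory consists of cells for natural numbers (counters and addresses) and of cells for real
numbers. Natural numbers can be added, subtracted and compared. Real numbers can be added,
subtracted, multiplied, divided and compared, exactly. There is no rounding or any other way to
turn a real number into a natural number, no root and no transcendental function, and the
only real constants are rational. Every memory access, arithmetic operation, comparison and
assignment takes one unit of time. -/

namespace RealRAM

/-- A memory configuration. -/
structure State where
  /-- the cells that hold natural numbers -/
  nat : ℕ → ℕ
  /-- the cells that hold real numbers -/
  real : ℕ → ℝ

/-- Expressions with natural values; `load a` reads the natural cell at the address `a`. -/
inductive NatExpr : Type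
  | const (n : ℕ)
  | load (a : NatExpr)
  | add (a b : NatExpr)
  | sub (a b : NatExpr)

/-- The value of an expression; the subtraction is truncated at `0`. -/
def NatExpr.eval (s : State) : NatExpr → ℕ
  | const n => n
  | load a => s.nat (a.eval s)
  | add a b => a.eval s + b.eval s
  | sub a b => a.eval s - b.eval s

/-- The time for evaluating an expression: the number of its nodes. -/
def NatExpr.cost : NatExpr → ℕ
  | const _ => 1
  | load a => a.cost + 1
  | add a b => a.cost + b.cost + 1
  | sub a b => a.cost + b.cost + 1

/-- Expressions with real values; `load a` reads the real cell at the address `a`. -/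
inductive RealExpr : Type
  | const (q : ℚ)
  | ofNat (a : NatExpr)
  | load (a : NatExpr)
  | add (x y : RealExpr)
  | sub (x y : RealExpr)
  | mul (x y : RealExpr)
  | div (x y : RealExpr)

/-- The value of an expression; a division by `0` returns `0`. -/
noncomputable def RealExpr.eval (s : State) : RealExpr → ℝ
  | const q => (q : ℝ)
  | ofNat a => (a.eval s : ℝ)
  | load a => s.real (a.eval s)
  | add x y => x.eval s + y.eval s
  | sub x y => x.eval s - y.eval s
  | mul x y => x.eval s * y.eval s
  | div x y => x.eval s / y.eval s

/-- The time for evaluating an expression: the number of its nodes. -/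
def RealExpr.cost : RealExpr → ℕ
  | const _ => 1
  | ofNat a => a.cost + 1
  | load a => a.cost + 1
  | add x y => x.cost + y.cost + 1
  | sub x y => x.cost + y.cost + 1
  | mul x y => x.cost + y.cost + 1
  | div x y => x.cost + y.cost + 1

/-- Conditions for branching. -/
inductive Test : Type
  | natLt (a b : NatExpr)
  | realLt (x y : RealExpr)
  | neg (b : Test)
  | conj (b c : Test)

/-- The truth of a condition. -/
def Test.Holds (s : State) : Test → Prop
  | natLt a b => a.eval s < b.eval s
  | realLt x y => x.eval s < y.eval s
  | neg b => ¬ b.Holds s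
  | conj b c => b.Holds s ∧ c.Holds s

/-- The time for evaluating a condition: the number of its nodes. -/
def Test.cost : Test → ℕ
  | natLt a b => a.cost + b.cost + 1
  | realLt x y => x.cost + y.cost + 1
  | neg b => b.cost + 1
  | conj b c => b.cost + c.cost + 1

/-- Programs: assignments to memory cells (whose address is the value of an expression),
composition, branching, and `while` loops. -/
inductive Program : Type
  | skip
  | setNat (addr val : NatExpr)
  | setReal (addr : NatExpr) (val : RealExpr)
  | seq (p q : Program)
  | branch (b : Test) (p q : Program)
  | loop (b : Test) (p : Program)

/-- `Exec p s s' t`: started in the memory configuration `s`, the program `p` halts after exactly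
`t` units of time, in the configuration `s'`. -/
inductive Exec : Program → State → State → ℕ → Prop
  | skip (s : State) : Exec .skip s s 1
  | setNat (addr val : NatExpr) (s : State) :
      Exec (.setNat addr val) s
        ⟨Function.update s.nat (addr.eval s) (val.eval s), s.real⟩ (addr.cost + val.cost + 1)
  | setReal (addr : NatExpr) (val : RealExpr) (s : State) :
      Exec (.setReal addr val) s
        ⟨s.nat, Function.update s.real (addr.eval s) (val.eval s)⟩ (addr.cost + val.cost + 1)
  | seq {p q : Program} {s₁ s₂ s₃ : State} {t₁ t₂ : ℕ} :
      Exec p s₁ s₂ t₁ → Exec q s₂ s₃ t₂ → Exec (.seq p q) s₁ s₃ (t₁ + t₂)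
  | branch_true {b : Test} {p q : Program} {s s' : State} {t : ℕ} :
      b.Holds s → Exec p s s' t → Exec (.branch b p q) s s' (b.cost + t)
  | branch_false {b : Test} {p q : Program} {s s' : State} {t : ℕ} :
      ¬ b.Holds s → Exec q s s' t → Exec (.branch b p q) s s' (b.cost + t)
  | loop_true {b : Test} {p : Program} {s₁ s₂ s₃ : State} {t₁ t₂ : ℕ} :
      b.Holds s₁ → Exec p s₁ s₂ t₁ → Exec (.loop b p) s₂ s₃ t₂ →
      Exec (.loop b p) s₁ s₃ (b.cost + t₁ + t₂)
  | loop_false {b : Test} {p : Program} {s : State} :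
      ¬ b.Holds s → Exec (.loop b p) s s b.cost

/-- Programs are deterministic: the final configuration and the running time are determined by
the initial configuration. -/
theorem Exec.deterministic {p : Program} {s s₁ s₂ : State} {t₁ t₂ : ℕ}
    (h₁ : Exec p s s₁ t₁) (h₂ : Exec p s s₂ t₂) : s₁ = s₂ ∧ t₁ = t₂ := by
  induction h₁ generalizing s₂ t₂ with
  | skip s => cases h₂; exact ⟨rfl, rfl⟩
  | setNat addr val s => cases h₂; exact ⟨rfl, rfl⟩
  | setReal addr val s => cases h₂; exact ⟨rfl, rfl⟩
  | seq _ _ ih₁ ih₂ =>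
    cases h₂ with
    | seq k₁ k₂ =>
      obtain ⟨rfl, rfl⟩ := ih₁ k₁
      obtain ⟨rfl, rfl⟩ := ih₂ k₂
      exact ⟨rfl, rfl⟩
  | branch_true hb _ ih =>
    cases h₂ with
    | branch_true _ k => obtain ⟨rfl, rfl⟩ := ih k; exact ⟨rfl, rfl⟩
    | branch_false hn _ => exact absurd hb hn
  | branch_false hb _ ih =>
    cases h₂ with
    | branch_true hn _ => exact absurd hn hb
    | branch_false _ k => obtain ⟨rfl, rfl⟩ := ih k; exact ⟨rfl, rfl⟩
  | loop_true hb _ _ ih₁ ih₂ =>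
    cases h₂ with
    | loop_true _ k₁ k₂ =>
      obtain ⟨rfl, rfl⟩ := ih₁ k₁
      obtain ⟨rfl, rfl⟩ := ih₂ k₂
      exact ⟨rfl, rfl⟩
    | loop_false hn => exact absurd hb hn
  | loop_false hb =>
    cases h₂ with
    | loop_true hn _ _ => exact absurd hn hb
    | loop_false _ => exact ⟨rfl, rfl⟩

/-- The initial configuration for the input `ε`, `v_1, …, v_m ∈ ℝ^d`. The natural cells `0` and `1`
hold `d` and `m`. The real cell `0` holds `ε`, and the cells `1, …, m * d` hold the coordinates of
the vectors, one vector after the other. All other cells hold `0`. -/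
noncomputable def input {d m : ℕ} (ε : ℝ) (v : Fin m → Fin d → ℝ) : State where
  nat
    | 0 => d
    | 1 => m
    | _ => 0
  real
    | 0 => ε
    | a + 1 =>
      if h : a < m * d then
        v (finProdFinEquiv.symm ⟨a, h⟩).1 (finProdFinEquiv.symm ⟨a, h⟩).2
      else 0

/-- The place of the coordinates of the vectors in the initial configuration. -/
theorem input_real {d m : ℕ} (ε : ℝ) (v : Fin m → Fin d → ℝ) (i : Fin m) (j : Fin d) :
    (input ε v).real (j + d * i + 1) = v i j := by
  have h : (j : ℕ) + d * i < m * d := (finProdFinEquiv (i, j)).isLt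
  have e : (⟨j + d * i, h⟩ : Fin (m * d)) = finProdFinEquiv (i, j) := rfl
  simp only [input, h, dif_pos, e, Equiv.symm_apply_apply]

/-- The number of rows of the output matrix is the value of the natural cell `0`. -/
def State.outDim (s : State) : ℕ := s.nat 0

/-- The output matrix, of a linear map `ℝ^d → ℝ^k` with `k = s.outDim`: its entries lie, row by row,
in consecutive real cells that start at the address given by the natural cell `1`. -/
def State.outMatrix (s : State) (d : ℕ) : Matrix (Fin s.outDim) (Fin d) ℝ :=
  Matrix.of fun r j => s.real (s.nat 1 + d * r + j)

end RealRAM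

/-! ### Gaussian integration by parts -/

/-! Only the lengths of the vectors `v_i ± v_j` matter. By a Sudakov–Fernique comparison, the
expected supremum of `|⟨u_i, x⟩|` can only grow when the lengths of all `u_i ± u_j` grow
(`expSup_le_expSup`). A matrix that stretches each of these `2 m²` vectors by a factor in `[1, 1 +
δ]` is therefore enough (`expSup_mulVec_bounds`). The comparison is proved for log-sum-exp: one
process is rotated into an independent copy of the other, and Gaussian integration by parts turns
the derivative into a nonnegative quadratic form in the softmax weights
(`integral_logSumExp_le_of_orthogonal`). Scaling by `β → ∞` replaces the soft maximum by the
supremum.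

As in the Johnson–Lindenstrauss lemma, a scaled `k × d` sign matrix will do. It is found entry by
entry with the method of conditional expectations. The machine has no exponential, so the estimator
must be rational. For a vector of squared length `N` whose image has squared length `Z`, the role of
`exp(γ Z / (8 N))` is played by `(1 + μ Z / N) ^ k` with `μ = γ / (8 k)`, and an inverse power
handles the lower tail. During the construction, `barrier` stands for `N + μ Z` with the unknown
part of `Z` replaced by a biased expectation: squares still to come count with the factor `1 ± γ`,
and the square of the current partial inner product has the weight `1 ± γ S / N`, which drifts
towards `1` as the row fills up. This drift pays for the second-order fluctuation of the `k`-th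
power, so the mean of `potential` over the two signs is at most its present value
(`potential_step`).

Taking the sign with the smaller total keeps the sum of the potentials at most twice the number of
vectors. Since `k` is of order `(log m) / γ²`, a `k`-th root at the end costs only a factor `1 +
O(γ²)`, and `Z` lies within `(1 ± 2 γ) k N` (`bounds_of_potential_le`).

Here `γ = 1 / (8 n)` with `n = ⌈1 / ε⌉`, and `k = l²` is a perfect square so that the normalization
`1 / √k` is rational. Each of the `k d` entries needs the potentials of `2 m²` vectors for two
signs, each with `O(k)` multiplications: in all `O(d m² k²)` steps. The program is verified with the
calculus of `Wp`; the decisive invariant is `Chosen`. -/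

theorem integrable_of_abs_le {α : Type*} [MeasurableSpace α] {μ : Measure α} [IsFiniteMeasure μ]
    {f : α → ℝ} (hf : Measurable f) (C : ℝ) (h : ∀ x, |f x| ≤ C) : Integrable f μ :=
  (integrable_const C).mono' hf.aestronglyMeasurable (Filter.Eventually.of_forall h)

theorem integrable_gaussianPDFReal_mul {g : ℝ → ℝ} (hg : Integrable g (gaussianReal 0 1)) :
    Integrable (fun x => gaussianPDFReal 0 1 x * g x) := by
  rw [gaussianReal_of_var_ne_zero 0 one_ne_zero,
    integrable_withDensity_iff_integrable_smul' (measurable_gaussianPDF 0 1)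
      (Filter.Eventually.of_forall fun x => gaussianPDF_lt_top)] at hg
  simpa [toReal_gaussianPDF] using hg

theorem hasDerivAt_gaussianPDFReal (x : ℝ) :
    HasDerivAt (gaussianPDFReal 0 1) (-(gaussianPDFReal 0 1 x * x)) x := by
  rw [gaussianPDFReal_def]
  have h : HasDerivAt (fun y : ℝ => -(y - 0) ^ 2 / (2 * ((1 : NNReal) : ℝ))) (-x) x := by
    have := (((hasDerivAt_id x).sub_const 0).pow 2).neg.div_const (2 * ((1 : NNReal) : ℝ))
    refine this.congr_deriv ?_
    simp
    ring
  refine (h.exp.const_mul _).congr_deriv ?_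
  ring

/-- Stein's identity: the density satisfies `φ' = -x φ`, so this is integration by parts on the
line. Boundedness of `h` and `h'` gives the integrability that makes the boundary terms vanish. -/
theorem integral_id_mul_gaussianReal {h h' : ℝ → ℝ} {C C' : ℝ} (hC : ∀ x, |h x| ≤ C)
    (hC' : ∀ x, |h' x| ≤ C') (hm : Measurable h') (hd : ∀ x, HasDerivAt h (h' x) x) :
    ∫ x, x * h x ∂(gaussianReal 0 1) = ∫ x, h' x ∂(gaussianReal 0 1) := by
  have hmh : Measurable h :=
    (continuous_iff_continuousAt.2 fun x => (hd x).continuousAt).measurable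
  have hid : Integrable (fun x : ℝ => x) (gaussianReal 0 1) :=
    (memLp_id_gaussianReal 1).integrable (by simp)
  have i1 : Integrable (fun x => x * h x) (gaussianReal 0 1) := by
    refine (hid.mul_bdd (c := C) hmh.aestronglyMeasurable ?_)
    exact Filter.Eventually.of_forall hC
  have i2 : Integrable h' (gaussianReal 0 1) := integrable_of_abs_le hm C' hC'
  have i3 : Integrable h (gaussianReal 0 1) := integrable_of_abs_le hmh C hC
  rw [integral_gaussianReal_eq_integral_smul one_ne_zero,
    integral_gaussianReal_eq_integral_smul one_ne_zero]
  have key := integral_mul_deriv_eq_deriv_mul_of_integrable (A := ℝ) (u := h)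
    (v := gaussianPDFReal 0 1) (u' := h') (v' := fun x => -(gaussianPDFReal 0 1 x * x))
    (fun x _ => hd x) (fun x _ => hasDerivAt_gaussianPDFReal x)
    ((integrable_gaussianPDFReal_mul i1).neg.congr (Filter.Eventually.of_forall fun x => by
      simp only [Pi.neg_apply, Pi.mul_apply]; ring))
    ((integrable_gaussianPDFReal_mul i2).congr (Filter.Eventually.of_forall fun x => by
      simp only [Pi.mul_apply]; ring))
    ((integrable_gaussianPDFReal_mul i3).congr (Filter.Eventually.of_forall fun x => by
      simp only [Pi.mul_apply]; ring))
  have e1 : ∫ x, gaussianPDFReal 0 1 x • (x * h x)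
      = -∫ x, h x * -(gaussianPDFReal 0 1 x * x) := by
    rw [← integral_neg]; congr 1; ext x; simp only [smul_eq_mul]; ring
  rw [e1, key, neg_neg]
  congr 1; ext x; simp only [smul_eq_mul]; ring

instance (n : ℕ) : IsProbabilityMeasure (gaussianVec n) := by
  unfold gaussianVec; infer_instance

theorem integrable_coord_gaussianVec {n : ℕ} (j : Fin n) :
    Integrable (fun x : Fin n → ℝ => x j) (gaussianVec n) :=
  (measurePreserving_eval (fun _ : Fin n => gaussianReal 0 1) j).integrable_comp_of_integrable
    ((memLp_id_gaussianReal 1).integrable (by simp))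

theorem integrable_dotProduct_gaussianVec {n : ℕ} (u : Fin n → ℝ) :
    Integrable (fun x : Fin n → ℝ => u ⬝ᵥ x) (gaussianVec n) := by
  unfold dotProduct
  exact integrable_finsetSum Finset.univ fun j _ =>
    (integrable_coord_gaussianVec j).const_mul (u j)

/-- Fubini with the coordinate `j` innermost, so that one-dimensional identities apply with the
other coordinates frozen. -/
theorem integral_gaussianVec_succ {n : ℕ} (j : Fin (n + 1)) {F : (Fin (n + 1) → ℝ) → ℝ}
    (hF : Integrable F (gaussianVec (n + 1))) :
    ∫ x, F x ∂(gaussianVec (n + 1))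
      = ∫ y, ∫ t, F (j.insertNth t y) ∂(gaussianReal 0 1) ∂(gaussianVec n) := by
  have mp := measurePreserving_piFinSuccAbove (fun _ : Fin (n + 1) => gaussianReal 0 1) j
  have mp' := mp.symm
  have e : ∫ x, F x ∂(gaussianVec (n + 1))
      = ∫ z, F (j.insertNth z.1 z.2) ∂((gaussianReal 0 1).prod (gaussianVec n)) :=
    (mp'.integral_comp' (g := F)).symm
  have hF' : Integrable (fun z : ℝ × (Fin n → ℝ) => F (j.insertNth z.1 z.2))
      ((gaussianReal 0 1).prod (gaussianVec n)) :=
    mp'.integrable_comp_of_integrable hF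
  rw [e, integral_prod_symm _ hF']

theorem integral_coord_mul_gaussianVec {n : ℕ} (j : Fin n) {h h' : (Fin n → ℝ) → ℝ} {C C' : ℝ}
    (hC : ∀ x, |h x| ≤ C) (hC' : ∀ x, |h' x| ≤ C') (hm : Measurable h) (hm' : Measurable h')
    (hd : ∀ x, HasDerivAt (fun t => h (Function.update x j t)) (h' x) (x j)) :
    ∫ x, x j * h x ∂(gaussianVec n) = ∫ x, h' x ∂(gaussianVec n) := by
  obtain _ | n := n
  · exact j.elim0
  have i1 : Integrable (fun x => x j * h x) (gaussianVec (n + 1)) :=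
    (integrable_coord_gaussianVec j).mul_bdd (c := C) hm.aestronglyMeasurable
      (Filter.Eventually.of_forall hC)
  rw [integral_gaussianVec_succ j i1, integral_gaussianVec_succ j (integrable_of_abs_le hm' C' hC')]
  congr 1
  ext y
  simp only [Fin.insertNth_apply_same]
  refine integral_id_mul_gaussianReal (fun t => hC _) (fun t => hC' _) ?_ fun t => ?_
  · refine hm'.comp ?_
    exact (measurable_pi_iff.2 fun i => by
      refine j.succAboveCases ?_ (fun l => ?_) i <;> simp [measurable_id'])
  · have := hd (j.insertNth t y)
    simpa [Fin.update_insertNth] using this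

/-! ### The soft maximum -/

noncomputable def logSumExp {ι : Type*} [Fintype ι] (z : ι → ℝ) : ℝ :=
  Real.log (∑ i, Real.exp (z i))

noncomputable def softmax {ι : Type*} [Fintype ι] (z : ι → ℝ) (i : ι) : ℝ :=
  Real.exp (z i) / ∑ j, Real.exp (z j)

section
variable {ι : Type*} [Fintype ι]

theorem sum_exp_pos [Nonempty ι] (z : ι → ℝ) : 0 < ∑ i, Real.exp (z i) :=
  Finset.sum_pos (fun _ _ => Real.exp_pos _) Finset.univ_nonempty

theorem softmax_nonneg (z : ι → ℝ) (i : ι) : 0 ≤ softmax z i :=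
  div_nonneg (Real.exp_pos _).le (Finset.sum_nonneg fun _ _ => (Real.exp_pos _).le)

theorem sum_softmax [Nonempty ι] (z : ι → ℝ) : ∑ i, softmax z i = 1 := by
  unfold softmax
  rw [← Finset.sum_div, div_self (sum_exp_pos z).ne']

theorem softmax_le_one [Nonempty ι] (z : ι → ℝ) (i : ι) : softmax z i ≤ 1 := by
  rw [← sum_softmax z]
  exact Finset.single_le_sum (fun j _ => softmax_nonneg z j) (Finset.mem_univ i)

theorem hasDerivAt_logSumExp [Nonempty ι] {z : ℝ → ι → ℝ} {z' : ι → ℝ} {t : ℝ}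
    (h : ∀ i, HasDerivAt (fun s => z s i) (z' i) t) :
    HasDerivAt (fun s => logSumExp (z s)) (∑ i, softmax (z t) i * z' i) t := by
  have h1 : HasDerivAt (fun s => ∑ i, Real.exp (z s i)) (∑ i, Real.exp (z t i) * z' i) t :=
    HasDerivAt.fun_sum fun i _ => (h i).exp
  refine (h1.log (sum_exp_pos (z t)).ne').congr_deriv ?_
  rw [Finset.sum_div]
  exact Finset.sum_congr rfl fun i _ => by unfold softmax; ring

/-- The derivative has the form weight times (own slope minus mean slope); this centring produces
the variance in the comparison argument. -/
theorem hasDerivAt_softmax [Nonempty ι] {z : ℝ → ι → ℝ} {z' : ι → ℝ} {t : ℝ}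
    (h : ∀ i, HasDerivAt (fun s => z s i) (z' i) t) (i : ι) :
    HasDerivAt (fun s => softmax (z s) i)
      (softmax (z t) i * (z' i - ∑ j, softmax (z t) j * z' j)) t := by
  have h1 : HasDerivAt (fun s => ∑ i, Real.exp (z s i)) (∑ i, Real.exp (z t i) * z' i) t :=
    HasDerivAt.fun_sum fun i _ => (h i).exp
  have h0 := (sum_exp_pos (z t)).ne'
  refine ((h i).exp.div h1 h0).congr_deriv ?_
  have e : ∑ j, softmax (z t) j * z' j
      = (∑ i, Real.exp (z t i) * z' i) / ∑ j, Real.exp (z t j) := by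
    rw [Finset.sum_div]
    exact Finset.sum_congr rfl fun i _ => by unfold softmax; ring
  rw [e]
  unfold softmax
  field_simp

theorem le_logSumExp (z : ι → ℝ) (i : ι) : z i ≤ logSumExp z := by
  have h : Real.exp (z i) ≤ ∑ j, Real.exp (z j) :=
    Finset.single_le_sum (f := fun j => Real.exp (z j)) (fun j _ => (Real.exp_pos _).le)
      (Finset.mem_univ i)
  rw [logSumExp, Real.le_log_iff_exp_le ((Real.exp_pos _).trans_le h)]
  exact h

/-- Together with `le_logSumExp`, the soft maximum exceeds the maximum by at most `log` of the
number of terms, independently of scale. -/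
theorem logSumExp_le [Nonempty ι] {z : ι → ℝ} {b : ℝ} (h : ∀ i, z i ≤ b) :
    logSumExp z ≤ b + Real.log (Fintype.card ι) := by
  have hc : (0 : ℝ) < Fintype.card ι := by exact_mod_cast Fintype.card_pos
  rw [logSumExp, Real.log_le_iff_le_exp (sum_exp_pos z), Real.exp_add, Real.exp_log hc]
  refine (Finset.sum_le_card_nsmul _ _ _ fun i _ => Real.exp_le_exp.2 (h i)).trans_eq ?_
  simp [mul_comm]

theorem measurable_softmax (i : ι) : Measurable fun z : ι → ℝ => softmax z i := by
  unfold softmax; fun_prop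

theorem measurable_logSumExp : Measurable (logSumExp : (ι → ℝ) → ℝ) := by
  unfold logSumExp; fun_prop

end

/-! ### The Sudakov–Fernique comparison inequality -/

section
variable {ι : Type*} [Fintype ι] {n : ℕ}

theorem abs_logSumExp_le [Nonempty ι] (z : ι → ℝ) :
    |logSumExp z| ≤ ∑ i, |z i| + Real.log (Fintype.card ι) := by
  have hle : ∀ i, |z i| ≤ ∑ j, |z j| := fun i =>
    Finset.single_le_sum (f := fun j => |z j|) (fun j _ => abs_nonneg _) (Finset.mem_univ i)
  have hlog : 0 ≤ Real.log (Fintype.card ι) :=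
    Real.log_nonneg (by exact_mod_cast Fintype.card_pos)
  refine abs_le.2 ⟨?_, logSumExp_le fun i => (le_abs_self _).trans (hle i)⟩
  obtain ⟨i⟩ := ‹Nonempty ι›
  have h1 := le_logSumExp z i
  have h2 := neg_abs_le (z i)
  have h3 := hle i
  linarith

theorem integrable_logSumExp_dotProduct [Nonempty ι] (u : ι → Fin n → ℝ) :
    Integrable (fun x => logSumExp fun i => u i ⬝ᵥ x) (gaussianVec n) := by
  have h : Integrable (fun x => ∑ i, |u i ⬝ᵥ x| + Real.log (Fintype.card ι)) (gaussianVec n) :=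
    (integrable_finsetSum Finset.univ fun i _ =>
      (integrable_dotProduct_gaussianVec (u i)).abs).add (integrable_const _)
  refine h.mono' ?_ (Filter.Eventually.of_forall fun x => abs_logSumExp_le _)
  exact (measurable_logSumExp.comp (measurable_pi_iff.2 fun i => by
    unfold dotProduct; fun_prop)).aestronglyMeasurable

theorem measurable_softmax_dotProduct (u : ι → Fin n → ℝ) (i : ι) :
    Measurable fun x : Fin n → ℝ => softmax (fun l => u l ⬝ᵥ x) i :=
  (measurable_softmax i).comp (g := fun z : ι → ℝ => softmax z i)
    (f := fun x l => u l ⬝ᵥ x) (measurable_pi_iff.2 fun i => by unfold dotProduct; fun_prop)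

theorem hasDerivAt_dotProduct_update (u x : Fin n → ℝ) (j : Fin n) :
    HasDerivAt (fun t => u ⬝ᵥ Function.update x j t) (u j) (x j) := by
  unfold dotProduct
  have h : ∀ l ∈ Finset.univ, HasDerivAt (fun t => u l * Function.update x j t l)
      (if l = j then u j else 0) (x j) := by
    intro l _
    by_cases hl : l = j
    · subst hl
      simpa using (hasDerivAt_id (x l)).const_mul (u l)
    · simpa [hl] using hasDerivAt_const (x j) (u l * x l)
  simpa using HasDerivAt.fun_sum h

/-- Stein's identity in each coordinate, with the softmax weight as the bounded test function,
summed against `w`. The Gaussian factor is traded for inner products with the `u l`. -/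
theorem integral_softmax_mul_dotProduct [Nonempty ι] (u : ι → Fin n → ℝ) (w : Fin n → ℝ) (i : ι) :
    ∫ x, softmax (fun l => u l ⬝ᵥ x) i * (w ⬝ᵥ x) ∂(gaussianVec n)
      = ∫ x, softmax (fun l => u l ⬝ᵥ x) i *
          (w ⬝ᵥ u i - ∑ l, softmax (fun l => u l ⬝ᵥ x) l * (w ⬝ᵥ u l)) ∂(gaussianVec n) := by
  set p : (Fin n → ℝ) → ι → ℝ := fun x => softmax fun l => u l ⬝ᵥ x with hp
  have hpm : ∀ l, Measurable fun x => p x l := fun l =>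
    measurable_softmax_dotProduct u l
  have hp1 : ∀ x l, |p x l| ≤ 1 := fun x l => by
    rw [abs_of_nonneg (softmax_nonneg _ _)]; exact softmax_le_one _ _
  have hm' : ∀ j, Measurable fun x => p x i * (u i j - ∑ l, p x l * u l j) := fun j =>
    (hpm i).mul (measurable_const.sub
      (Finset.measurable_sum _ fun l _ => (hpm l).mul_const _))
  have hb' : ∀ j x, |p x i * (u i j - ∑ l, p x l * u l j)| ≤ |u i j| + ∑ l, |u l j| := by
    intro j x
    have h1 : |∑ l, p x l * u l j| ≤ ∑ l, |u l j| := by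
      refine (Finset.abs_sum_le_sum_abs _ _).trans (Finset.sum_le_sum fun l _ => ?_)
      rw [abs_mul]
      exact mul_le_of_le_one_left (abs_nonneg _) (hp1 x l)
    rw [abs_mul]
    refine (mul_le_of_le_one_left (abs_nonneg _) (hp1 x i)).trans ((abs_sub _ _).trans ?_)
    linarith
  have key : ∀ j, ∫ x, x j * p x i ∂(gaussianVec n)
      = ∫ x, p x i * (u i j - ∑ l, p x l * u l j) ∂(gaussianVec n) := fun j =>
    integral_coord_mul_gaussianVec j (fun x => hp1 x i) (hb' j) (hpm i) (hm' j) fun x => by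
      have := hasDerivAt_softmax (z := fun t l => u l ⬝ᵥ Function.update x j t)
        (fun l => hasDerivAt_dotProduct_update (u l) x j) i
      simpa [hp] using this
  have i1 : ∀ j, Integrable (fun x => x j * p x i) (gaussianVec n) := fun j =>
    (integrable_coord_gaussianVec j).mul_bdd (c := 1) (hpm i).aestronglyMeasurable
      (Filter.Eventually.of_forall fun x => hp1 x i)
  calc ∫ x, p x i * (w ⬝ᵥ x) ∂(gaussianVec n)
      = ∫ x, ∑ j, w j * (x j * p x i) ∂(gaussianVec n) := by
        congr 1; ext x; rw [dotProduct, Finset.mul_sum]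
        exact Finset.sum_congr rfl fun j _ => by ring
    _ = ∑ j, w j * ∫ x, p x i * (u i j - ∑ l, p x l * u l j) ∂(gaussianVec n) := by
        rw [integral_finsetSum _ fun j _ => (i1 j).const_mul _]
        exact Finset.sum_congr rfl fun j _ => by rw [integral_const_mul, key]
    _ = ∫ x, ∑ j, w j * (p x i * (u i j - ∑ l, p x l * u l j)) ∂(gaussianVec n) := by
        rw [integral_finsetSum _ fun j _ =>
          (integrable_of_abs_le (hm' j) _ (hb' j)).const_mul _]
        exact Finset.sum_congr rfl fun j _ => by rw [integral_const_mul]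
    _ = _ := by
        congr 1; ext x
        change _ = p x i * (w ⬝ᵥ u i - ∑ l, p x l * (w ⬝ᵥ u l))
        generalize p x = q
        have e : ∑ l, q l * (w ⬝ᵥ u l) = ∑ j, w j * ∑ l, q l * u l j := by
          simp only [dotProduct, Finset.mul_sum]
          rw [Finset.sum_comm]
          exact Finset.sum_congr rfl fun j _ => Finset.sum_congr rfl fun l _ => by ring
        rw [e, dotProduct, ← Finset.sum_sub_distrib, Finset.mul_sum]
        exact Finset.sum_congr rfl fun j _ => by ring

/-- Because the weights sum to `1`, twice the expression equals `∑ p i * p l * (R i i + R l l - R i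
l - R l i)`. -/
theorem softmax_variance_nonneg {p : ι → ℝ} (hp : ∀ i, 0 ≤ p i) (hp1 : ∑ i, p i = 1)
    {R : ι → ι → ℝ} (hR : ∀ i l, 0 ≤ R i i + R l l - R i l - R l i) :
    0 ≤ ∑ i, p i * (R i i - ∑ l, p l * R i l) := by
  have h : 0 ≤ ∑ i, ∑ l, p i * p l * (R i i + R l l - R i l - R l i) :=
    Finset.sum_nonneg fun i _ => Finset.sum_nonneg fun l _ =>
      mul_nonneg (mul_nonneg (hp i) (hp l)) (hR i l)
  have e1 : ∑ i, ∑ l, p i * p l * R i i = ∑ i, p i * R i i := by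
    refine Finset.sum_congr rfl fun i _ => ?_
    calc ∑ l, p i * p l * R i i = (∑ l, p l) * (p i * R i i) := by
          rw [Finset.sum_mul]; exact Finset.sum_congr rfl fun l _ => by ring
      _ = _ := by rw [hp1, one_mul]
  have e2 : ∑ i, ∑ l, p i * p l * R l l = ∑ i, p i * R i i := by
    rw [Finset.sum_comm, ← e1]
    exact Finset.sum_congr rfl fun i _ => Finset.sum_congr rfl fun l _ => by ring
  have e3 : ∑ i, ∑ l, p i * p l * R l i = ∑ i, ∑ l, p i * p l * R i l := by
    rw [Finset.sum_comm]
    exact Finset.sum_congr rfl fun i _ => Finset.sum_congr rfl fun l _ => by ring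
  have e4 : ∑ i, p i * ∑ l, p l * R i l = ∑ i, ∑ l, p i * p l * R i l :=
    Finset.sum_congr rfl fun i _ => by
      rw [Finset.mul_sum]; exact Finset.sum_congr rfl fun l _ => by ring
  simp only [mul_add, mul_sub, Finset.sum_add_distrib, Finset.sum_sub_distrib] at h ⊢
  linarith

/-- The path `cos θ • a + sin θ • b` joins the two processes. Orthogonality makes them independent,
so the inner products of the path with its derivative contain only the difference of the two Gram
matrices; the assumption on increments then makes the derivative nonnegative. -/
theorem integral_logSumExp_le_of_orthogonal [Nonempty ι] (a b : ι → Fin n → ℝ)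
    (hab : ∀ i l, a i ⬝ᵥ b l = 0)
    (h : ∀ i l, (a i - a l) ⬝ᵥ (a i - a l) ≤ (b i - b l) ⬝ᵥ (b i - b l)) :
    ∫ x, (logSumExp fun i => a i ⬝ᵥ x) ∂(gaussianVec n)
      ≤ ∫ x, (logSumExp fun i => b i ⬝ᵥ x) ∂(gaussianVec n) := by
  set c : ℝ → ι → Fin n → ℝ := fun θ i => Real.cos θ • a i + Real.sin θ • b i with hc
  set c' : ℝ → ι → Fin n → ℝ := fun θ i => -Real.sin θ • a i + Real.cos θ • b i with hc'
  have hz : ∀ θ i x, HasDerivAt (fun s => c s i ⬝ᵥ x) (c' θ i ⬝ᵥ x) θ := by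
    intro θ i x
    simp only [hc, hc', add_dotProduct, smul_dotProduct, smul_eq_mul]
    exact ((Real.hasDerivAt_cos θ).mul_const _).add ((Real.hasDerivAt_sin θ).mul_const _)
  have hint : ∀ i θ, Integrable (fun x => softmax (fun l => c θ l ⬝ᵥ x) i * (c' θ i ⬝ᵥ x))
      (gaussianVec n) := by
    intro i θ
    refine (integrable_dotProduct_gaussianVec (c' θ i)).bdd_mul (c := 1) ?_
      (Filter.Eventually.of_forall fun x => ?_)
    · exact (measurable_softmax_dotProduct _ i).aestronglyMeasurable
    · rw [Real.norm_of_nonneg (softmax_nonneg _ _)]; exact softmax_le_one _ _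
  have hderiv : ∀ θ, HasDerivAt (fun s => ∫ x, (logSumExp fun i => c s i ⬝ᵥ x) ∂(gaussianVec n))
      (∫ x, ∑ i, softmax (fun l => c θ l ⬝ᵥ x) i * (c' θ i ⬝ᵥ x) ∂(gaussianVec n)) θ := by
    intro θ
    refine (hasDerivAt_integral_of_dominated_loc_of_deriv_le (s := Set.univ)
      -- Softmax weights, sines and cosines are at most `1` in absolute value, so this dominates the
      -- derivative for all angles at once.
      (bound := fun x => ∑ i, (|a i ⬝ᵥ x| + |b i ⬝ᵥ x|))
      (F' := fun θ x => ∑ i, softmax (fun l => c θ l ⬝ᵥ x) i * (c' θ i ⬝ᵥ x))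
      Filter.univ_mem ?_ ?_ ?_ ?_ ?_ ?_).2
    · exact Filter.Eventually.of_forall fun s =>
        (integrable_logSumExp_dotProduct (c s)).aestronglyMeasurable
    · exact integrable_logSumExp_dotProduct (c θ)
    · exact (integrable_finsetSum _ fun i _ => hint i θ).aestronglyMeasurable
    · refine Filter.Eventually.of_forall fun x s _ => ?_
      refine (norm_sum_le _ _).trans (Finset.sum_le_sum fun i _ => ?_)
      rw [norm_mul, Real.norm_of_nonneg (softmax_nonneg _ _)]
      refine (mul_le_of_le_one_left (norm_nonneg _) (softmax_le_one _ _)).trans ?_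
      simp only [hc', add_dotProduct, smul_dotProduct, smul_eq_mul, Real.norm_eq_abs]
      refine (abs_add_le _ _).trans (add_le_add ?_ ?_)
      · rw [abs_mul, abs_neg]
        exact mul_le_of_le_one_left (abs_nonneg _) (Real.abs_sin_le_one s)
      · rw [abs_mul]
        exact mul_le_of_le_one_left (abs_nonneg _) (Real.abs_cos_le_one s)
    · exact integrable_finsetSum _ fun i _ => (integrable_dotProduct_gaussianVec _).abs.add
        (integrable_dotProduct_gaussianVec _).abs
    · exact Filter.Eventually.of_forall fun x s _ => hasDerivAt_logSumExp fun i => hz s i x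
  have hnonneg : ∀ θ ∈ Set.Icc 0 (Real.pi / 2),
      0 ≤ ∫ x, ∑ i, softmax (fun l => c θ l ⬝ᵥ x) i * (c' θ i ⬝ᵥ x) ∂(gaussianVec n) := by
    intro θ hθ
    have hs : 0 ≤ Real.sin θ := Real.sin_nonneg_of_nonneg_of_le_pi hθ.1 (by
      linarith [hθ.2, Real.pi_pos])
    have hco : 0 ≤ Real.cos θ := Real.cos_nonneg_of_neg_pi_div_two_le_of_le (by
      linarith [hθ.1, Real.pi_pos]) hθ.2
    have hba : ∀ i l, b i ⬝ᵥ a l = 0 := fun i l => by rw [dotProduct_comm]; exact hab l i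
    have hR : ∀ i l, c' θ i ⬝ᵥ c θ l
        = Real.sin θ * Real.cos θ * (b i ⬝ᵥ b l - a i ⬝ᵥ a l) := by
      intro i l
      simp only [hc, hc', add_dotProduct, dotProduct_add, smul_dotProduct, dotProduct_smul,
        smul_eq_mul, hab, hba]
      ring
    have hi : ∀ i, Integrable (fun x => softmax (fun l => c θ l ⬝ᵥ x) i *
        (c' θ i ⬝ᵥ c θ i - ∑ l, softmax (fun l => c θ l ⬝ᵥ x) l * (c' θ i ⬝ᵥ c θ l)))
        (gaussianVec n) := by
      intro i
      have hpm : ∀ l, Measurable fun x => softmax (fun l => c θ l ⬝ᵥ x) l := fun l =>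
        measurable_softmax_dotProduct _ l
      have hp1 : ∀ x l, |softmax (fun l => c θ l ⬝ᵥ x) l| ≤ 1 := fun x l => by
        rw [abs_of_nonneg (softmax_nonneg _ _)]; exact softmax_le_one _ _
      refine integrable_of_abs_le ((hpm i).mul (measurable_const.sub
        (Finset.measurable_sum _ fun l _ => (hpm l).mul_const _)))
        (|c' θ i ⬝ᵥ c θ i| + ∑ l, |c' θ i ⬝ᵥ c θ l|) fun x => ?_
      have h1 : |∑ l, softmax (fun l => c θ l ⬝ᵥ x) l * (c' θ i ⬝ᵥ c θ l)|
          ≤ ∑ l, |c' θ i ⬝ᵥ c θ l| := by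
        refine (Finset.abs_sum_le_sum_abs _ _).trans (Finset.sum_le_sum fun l _ => ?_)
        rw [abs_mul]
        exact mul_le_of_le_one_left (abs_nonneg _) (hp1 x l)
      rw [abs_mul]
      refine (mul_le_of_le_one_left (abs_nonneg _) (hp1 x i)).trans ((abs_sub _ _).trans ?_)
      linarith
    rw [integral_finsetSum _ fun i _ => hint i θ]
    -- After this integration by parts the integrand is, pointwise, the quadratic form of
    -- `softmax_variance_nonneg`.
    simp only [integral_softmax_mul_dotProduct]
    rw [← integral_finsetSum _ fun i _ => hi i]
    refine integral_nonneg fun x => ?_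
    refine softmax_variance_nonneg (R := fun i l => c' θ i ⬝ᵥ c θ l)
      (fun i => softmax_nonneg _ i) (sum_softmax _) fun i l => ?_
    simp only [hR]
    have e := h i l
    simp only [sub_dotProduct, dotProduct_sub] at e
    rw [dotProduct_comm (a l) (a i), dotProduct_comm (b l) (b i)] at *
    nlinarith [mul_nonneg (mul_nonneg hs hco) (sub_nonneg.2 e)]
  have hmono : MonotoneOn (fun s => ∫ x, (logSumExp fun i => c s i ⬝ᵥ x) ∂(gaussianVec n))
      (Set.Icc 0 (Real.pi / 2)) := by
    refine monotoneOn_of_deriv_nonneg (convex_Icc _ _)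
      (fun θ _ => (hderiv θ).continuousAt.continuousWithinAt)
      (fun θ _ => (hderiv θ).differentiableAt.differentiableWithinAt) fun θ hθ => ?_
    rw [(hderiv θ).deriv]
    exact hnonneg θ (interior_subset hθ)
  have hpi : 0 ≤ Real.pi / 2 := by positivity
  have := hmono (Set.left_mem_Icc.2 hpi) (Set.right_mem_Icc.2 hpi) hpi
  simpa [hc] using this

end

/-! ### Independent copies and the general comparison -/

/-- Marginals of a product measure: the preimage of a box is a box whose factors outside the range
of `e` are the whole line. -/
theorem measurePreserving_comp_gaussianVec {k n : ℕ} {e : Fin k → Fin n}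
    (he : Function.Injective e) :
    MeasurePreserving (fun x : Fin n → ℝ => x ∘ e) (gaussianVec n) (gaussianVec k) := by
  have hm : Measurable (fun x : Fin n → ℝ => x ∘ e) :=
    measurable_pi_iff.2 fun i => measurable_pi_apply (e i)
  refine ⟨hm, ?_⟩
  symm
  unfold gaussianVec
  refine Measure.pi_eq fun s hs => ?_
  rw [Measure.map_apply hm (MeasurableSet.univ_pi hs)]
  have hpre : (fun x : Fin n → ℝ => x ∘ e) ⁻¹' (Set.univ.pi s)
      = Set.univ.pi fun j => {y : ℝ | ∀ i, e i = j → y ∈ s i} := by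
    ext x
    simp only [Set.mem_preimage, Set.mem_pi, Set.mem_univ, forall_true_left, Function.comp,
      Set.mem_ofPred_eq]
    exact ⟨fun h j i hij => hij ▸ h i, fun h i => h (e i) i rfl⟩
  rw [hpre, Measure.pi_pi]
  symm
  refine Fintype.prod_of_injective e he _ _ (fun j hj => ?_) fun i => ?_
  · have : {y : ℝ | ∀ i, e i = j → y ∈ s i} = Set.univ :=
      Set.eq_univ_of_forall fun y i hi => absurd ⟨i, hi⟩ hj
    rw [this, measure_univ]
  · congr 1
    ext y
    exact ⟨fun h i' hi' => he hi' ▸ h, fun h => h i rfl⟩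

theorem append_zero_dotProduct {d k : ℕ} (u : Fin d → ℝ) (x : Fin (d + k) → ℝ) :
    Fin.append u (0 : Fin k → ℝ) ⬝ᵥ x = u ⬝ᵥ (x ∘ Fin.castAdd k) := by
  simp [dotProduct, Fin.sum_univ_add]

theorem zero_append_dotProduct {d k : ℕ} (u : Fin k → ℝ) (x : Fin (d + k) → ℝ) :
    Fin.append (0 : Fin d → ℝ) u ⬝ᵥ x = u ⬝ᵥ (x ∘ Fin.natAdd d) := by
  simp [dotProduct, Fin.sum_univ_add]

section
variable {ι : Type*} [Fintype ι] {d k : ℕ}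

/-- Padding with zeros moves the two families into complementary coordinate blocks of `ℝ^(d + k)`.
They become orthogonal there, while the integrals and the increments stay the same. -/
theorem integral_logSumExp_le [Nonempty ι] (a : ι → Fin d → ℝ) (b : ι → Fin k → ℝ)
    (h : ∀ i l, (a i - a l) ⬝ᵥ (a i - a l) ≤ (b i - b l) ⬝ᵥ (b i - b l)) :
    ∫ x, (logSumExp fun i => a i ⬝ᵥ x) ∂(gaussianVec d)
      ≤ ∫ x, (logSumExp fun i => b i ⬝ᵥ x) ∂(gaussianVec k) := by
  have hdiff1 : ∀ i l, Fin.append (a i) (0 : Fin k → ℝ) - Fin.append (a l) 0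
      = Fin.append (a i - a l) 0 := fun i l => by
    ext j; refine Fin.addCases (fun j => ?_) (fun j => ?_) j <;> simp
  have hdiff2 : ∀ i l, Fin.append (0 : Fin d → ℝ) (b i) - Fin.append 0 (b l)
      = Fin.append 0 (b i - b l) := fun i l => by
    ext j; refine Fin.addCases (fun j => ?_) (fun j => ?_) j <;> simp
  have key := integral_logSumExp_le_of_orthogonal
    (fun i => Fin.append (a i) (0 : Fin k → ℝ)) (fun i => Fin.append (0 : Fin d → ℝ) (b i))
    (fun i l => by simp [dotProduct, Fin.sum_univ_add]) fun i l => by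
      rw [hdiff1, hdiff2]
      have := h i l
      simpa [dotProduct, Fin.sum_univ_add] using this
  simp only [append_zero_dotProduct, zero_append_dotProduct] at key
  have e1 := measurePreserving_comp_gaussianVec (Fin.castAdd_injective d k)
  have e2 := measurePreserving_comp_gaussianVec (Fin.natAdd_injective k d)
  have f1 := integral_map (μ := gaussianVec (d + k)) e1.measurable.aemeasurable
    (f := fun x => logSumExp fun i => a i ⬝ᵥ x)
    (by rw [e1.map_eq]; exact (integrable_logSumExp_dotProduct a).aestronglyMeasurable)
  have f2 := integral_map (μ := gaussianVec (d + k)) e2.measurable.aemeasurable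
    (f := fun x => logSumExp fun i => b i ⬝ᵥ x)
    (by rw [e2.map_eq]; exact (integrable_logSumExp_dotProduct b).aestronglyMeasurable)
  rw [e1.map_eq] at f1
  rw [e2.map_eq] at f2
  rw [f1, f2]
  exact key

end

/-! ### From soft maxima to expected suprema -/

/-- The vectors `± β u_i`. -/
def signedFamily {m n : ℕ} (β : ℝ) (u : Fin m → Fin n → ℝ) : Bool × Fin m → Fin n → ℝ :=
  fun p => (if p.1 then β else -β) • u p.2

theorem logSumExp_signedFamily_le {m n : ℕ} (hm : 0 < m) {β : ℝ} (hβ : 0 ≤ β)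
    (u : Fin m → Fin n → ℝ) (x : Fin n → ℝ) :
    (logSumExp fun p => signedFamily β u p ⬝ᵥ x)
      ≤ β * (⨆ i, |u i ⬝ᵥ x|) + Real.log (2 * m) := by
  have : Nonempty (Fin m) := ⟨⟨0, hm⟩⟩
  have hb : BddAbove (Set.range fun i => |u i ⬝ᵥ x|) := Set.finite_range _ |>.bddAbove
  refine (logSumExp_le (b := β * ⨆ i, |u i ⬝ᵥ x|) fun p => ?_).trans_eq (by simp)
  have h1 : β * |u p.2 ⬝ᵥ x| ≤ β * ⨆ i, |u i ⬝ᵥ x| :=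
    mul_le_mul_of_nonneg_left (le_ciSup hb p.2) hβ
  refine le_trans ?_ h1
  rw [signedFamily, smul_dotProduct, smul_eq_mul]
  split_ifs
  · exact mul_le_mul_of_nonneg_left (le_abs_self _) hβ
  · rw [neg_mul_comm]
    exact mul_le_mul_of_nonneg_left (neg_le_abs _) hβ

theorem le_logSumExp_signedFamily {m n : ℕ} (hm : 0 < m) {β : ℝ} (hβ : 0 ≤ β)
    (u : Fin m → Fin n → ℝ) (x : Fin n → ℝ) :
    β * (⨆ i, |u i ⬝ᵥ x|) ≤ logSumExp fun p => signedFamily β u p ⬝ᵥ x := by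
  have : Nonempty (Fin m) := ⟨⟨0, hm⟩⟩
  rw [Real.mul_iSup_of_nonneg hβ]
  refine ciSup_le fun i => ?_
  rcases abs_cases (u i ⬝ᵥ x) with ⟨h, _⟩ | ⟨h, _⟩
  · rw [h]
    refine le_trans (le_of_eq ?_) (le_logSumExp _ (true, i))
    simp [signedFamily]
  · rw [h]
    refine le_trans (le_of_eq ?_) (le_logSumExp _ (false, i))
    simp [signedFamily]

/-- Increments of the family `± β u_i` are `± β (u_i ± u_j)`, so sums and differences are all that
is needed. The soft maximum has an error of at most `log (2 m)`, which is negligible against `β` as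
`β` grows. -/
theorem expSup_le_expSup {m d k : ℕ} (hm : 0 < m) (u : Fin m → Fin d → ℝ) (w : Fin m → Fin k → ℝ)
    (hadd : ∀ i j, (u i + u j) ⬝ᵥ (u i + u j) ≤ (w i + w j) ⬝ᵥ (w i + w j))
    (hsub : ∀ i j, (u i - u j) ⬝ᵥ (u i - u j) ≤ (w i - w j) ⬝ᵥ (w i - w j)) :
    expSup u ≤ expSup w := by
  have : Nonempty (Fin m) := ⟨⟨0, hm⟩⟩
  have key : ∀ β : ℝ, 0 < β → β * expSup u ≤ β * expSup w + Real.log (2 * m) := by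
    intro β hβ
    have h1 : β * expSup u
        ≤ ∫ x, (logSumExp fun p => signedFamily β u p ⬝ᵥ x) ∂(gaussianVec d) := by
      unfold expSup
      rw [← integral_const_mul]
      exact integral_mono ((integrable_iSup_abs_dotProduct u).const_mul β)
        (integrable_logSumExp_dotProduct _) fun x => le_logSumExp_signedFamily hm hβ.le u x
    have h2 : ∫ x, (logSumExp fun p => signedFamily β w p ⬝ᵥ x) ∂(gaussianVec k)
        ≤ β * expSup w + Real.log (2 * m) := by
      unfold expSup
      have e : β * (∫ x, ⨆ i, |w i ⬝ᵥ x| ∂(gaussianVec k)) + Real.log (2 * m)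
          = ∫ x, (β * (⨆ i, |w i ⬝ᵥ x|) + Real.log (2 * m)) ∂(gaussianVec k) := by
        rw [integral_add ((integrable_iSup_abs_dotProduct w).const_mul β) (integrable_const _),
          integral_const_mul]
        simp
      rw [e]
      exact integral_mono (integrable_logSumExp_dotProduct _)
        (((integrable_iSup_abs_dotProduct w).const_mul β).add (integrable_const _))
        fun x => logSumExp_signedFamily_le hm hβ.le w x
    refine h1.trans (le_trans (integral_logSumExp_le _ _ ?_) h2)
    rintro ⟨s, i⟩ ⟨t, j⟩
    have ha := mul_le_mul_of_nonneg_left (hadd i j) (sq_nonneg β)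
    have hs := mul_le_mul_of_nonneg_left (hsub i j) (sq_nonneg β)
    simp only [add_dotProduct, dotProduct_add, sub_dotProduct, dotProduct_sub] at ha hs
    cases s <;> cases t <;>
      simp only [signedFamily, if_true, Bool.false_eq_true, if_false, sub_dotProduct,
        dotProduct_sub, smul_dotProduct, dotProduct_smul, smul_eq_mul] <;>
      nlinarith only [ha, hs]
  by_contra hlt
  push Not at hlt
  have hlog : 0 ≤ Real.log (2 * m) := Real.log_nonneg (by
    have : (1 : ℝ) ≤ m := by exact_mod_cast hm
    linarith)
  have hpos : 0 < expSup u - expSup w := sub_pos.2 hlt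
  -- This `β` makes `β` times the supposed gap equal to `log (2 m) + 1`, more than the error allows.
  have := key ((Real.log (2 * m) + 1) / (expSup u - expSup w)) (by positivity)
  have e : (Real.log (2 * m) + 1) / (expSup u - expSup w) * (expSup u - expSup w)
      = Real.log (2 * m) + 1 := div_mul_cancel₀ _ hpos.ne'
  rw [mul_sub] at e
  linarith

theorem expSup_smul {m n : ℕ} {c : ℝ} (hc : 0 ≤ c) (u : Fin m → Fin n → ℝ) :
    expSup (fun i => c • u i) = c * expSup u := by
  unfold expSup
  rw [← integral_const_mul]
  congr 1
  ext x
  rw [Real.mul_iSup_of_nonneg hc]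
  congr 1
  ext i
  rw [smul_dotProduct, smul_eq_mul, abs_mul, abs_of_nonneg hc]

theorem expSup_nonneg {m n : ℕ} (u : Fin m → Fin n → ℝ) : 0 ≤ expSup u :=
  integral_nonneg fun _ => Real.iSup_nonneg fun _ => abs_nonneg _

/-- A linear map that distorts the lengths of all sums and differences of the vectors by a factor
between `1` and `1 + δ` preserves the expected supremum up to a factor between `1` and `1 + δ`. -/
theorem expSup_mulVec_bounds {m d k : ℕ} (hm : 0 < m) {δ : ℝ} (hδ : 0 ≤ δ)
    (v : Fin m → Fin d → ℝ) (A : Matrix (Fin k) (Fin d) ℝ)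
    (h : ∀ u : Fin d → ℝ, (∃ i j, u = v i + v j ∨ u = v i - v j) →
      u ⬝ᵥ u ≤ A.mulVec u ⬝ᵥ A.mulVec u ∧ A.mulVec u ⬝ᵥ A.mulVec u ≤ (1 + δ) ^ 2 * (u ⬝ᵥ u)) :
    expSup v ≤ expSup (fun i => A.mulVec (v i)) ∧
      expSup (fun i => A.mulVec (v i)) ≤ (1 + δ) * expSup v := by
  constructor
  · refine expSup_le_expSup hm _ _ (fun i j => ?_) fun i j => ?_
    · rw [← Matrix.mulVec_add]; exact (h _ ⟨i, j, Or.inl rfl⟩).1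
    · rw [← Matrix.mulVec_sub]; exact (h _ ⟨i, j, Or.inr rfl⟩).1
  -- The upper bound is the same comparison, with the image family below and the dilated family `(1
  -- + δ) v_i` above.
  · rw [← expSup_smul (by linarith : (0 : ℝ) ≤ 1 + δ)]
    refine expSup_le_expSup hm _ _ (fun i j => ?_) fun i j => ?_
    · rw [← Matrix.mulVec_add, ← smul_add]
      refine (h _ ⟨i, j, Or.inl rfl⟩).2.trans_eq ?_
      simp only [smul_dotProduct, dotProduct_smul, smul_eq_mul]; ring
    · rw [← Matrix.mulVec_sub, ← smul_sub]
      refine (h _ ⟨i, j, Or.inr rfl⟩).2.trans_eq ?_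
      simp only [smul_dotProduct, dotProduct_smul, smul_eq_mul]; ring

/-! ### A rational potential for sign matrices -/

/-- An algebraic substitute for the bound of `cosh` by a Gaussian. For `y ≥ 0`, let `s` and `t` be
the sum and the difference of the two `i`-th powers. Inductively `t ≤ i * y * s`, so the step to `i
+ 1` multiplies `s` by at most `1 + i * y ^ 2 ≤ 1 + q * y ^ 2`. -/
theorem even_part_pow_le (q : ℕ) (y : ℝ) :
    (1 + y) ^ q + (1 - y) ^ q ≤ 2 * (1 + q * y ^ 2) ^ q := by
  wlog hy : 0 ≤ y generalizing y
  · have := this (-y) (by linarith)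
    rw [neg_sq, sub_neg_eq_add, ← sub_eq_add_neg] at this
    linarith
  suffices h : ∀ i ≤ q, (1 + y) ^ i + (1 - y) ^ i ≤ 2 * (1 + q * y ^ 2) ^ i ∧
      0 ≤ (1 + y) ^ i + (1 - y) ^ i ∧ 0 ≤ (1 + y) ^ i - (1 - y) ^ i ∧
      (1 + y) ^ i - (1 - y) ^ i ≤ i * y * ((1 + y) ^ i + (1 - y) ^ i) from (h q le_rfl).1
  intro i
  induction i with
  | zero => intro _; norm_num
  | succ i ih =>
    intro hi
    obtain ⟨h1, hs, h2, h3⟩ := ih (Nat.le_of_succ_le hi)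
    have hiq : (i : ℝ) ≤ q := by exact_mod_cast Nat.le_of_succ_le hi
    have e1 : (1 + y) ^ (i + 1) + (1 - y) ^ (i + 1)
        = ((1 + y) ^ i + (1 - y) ^ i) + y * ((1 + y) ^ i - (1 - y) ^ i) := by ring
    have e2 : (1 + y) ^ (i + 1) - (1 - y) ^ (i + 1)
        = ((1 + y) ^ i - (1 - y) ^ i) + y * ((1 + y) ^ i + (1 - y) ^ i) := by ring
    rw [e1, e2]
    generalize (1 + y) ^ i + (1 - y) ^ i = s at *
    generalize (1 + y) ^ i - (1 - y) ^ i = t at *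
    have hyt : 0 ≤ y * t := mul_nonneg hy h2
    refine ⟨?_, add_nonneg hs hyt, add_nonneg h2 (mul_nonneg hy hs), ?_⟩
    · have a1 : y * t ≤ q * y ^ 2 * s := by
        calc y * t ≤ y * (i * y * s) := mul_le_mul_of_nonneg_left h3 hy
          _ = i * (y ^ 2 * s) := by ring
          _ ≤ q * (y ^ 2 * s) := mul_le_mul_of_nonneg_right hiq (by positivity)
          _ = _ := by ring
      have a2 : s * (1 + q * y ^ 2) ≤ 2 * (1 + q * y ^ 2) ^ i * (1 + q * y ^ 2) :=
        mul_le_mul_of_nonneg_right h1 (by positivity)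
      rw [pow_succ]
      linarith
    · push_cast
      have : 0 ≤ ((i : ℝ) + 1) * y * (y * t) := by positivity
      linarith

theorem add_pow_add_sub_pow_le (q : ℕ) {A : ℝ} (hA : 0 < A) (w : ℝ) :
    (A + w) ^ q + (A - w) ^ q ≤ 2 * ((A ^ 2 + q * w ^ 2) / A) ^ q := by
  have h := mul_le_mul_of_nonneg_left (even_part_pow_le q (w / A)) (pow_nonneg hA.le q)
  have e1 : A * (1 + w / A) = A + w := by field_simp
  have e2 : A * (1 - w / A) = A - w := by field_simp
  have e3 : A * (1 + q * (w / A) ^ 2) = (A ^ 2 + q * w ^ 2) / A := by field_simp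
  rw [mul_add, mul_left_comm, ← mul_pow, ← mul_pow, ← mul_pow, e1, e2, e3] at h
  exact h

theorem pow_add_pow_le_two_mul_pow (q : ℕ) {A w Q : ℝ} (hA : 0 < A)
    (h : A ^ 2 + q * w ^ 2 ≤ Q * A) : (A + w) ^ q + (A - w) ^ q ≤ 2 * Q ^ q := by
  refine (add_pow_add_sub_pow_le q hA w).trans ?_
  gcongr
  rwa [div_le_iff₀ hA]

/-- Over the common denominator `((A + w) * (A - w)) ^ q` the numerator is the sum already bounded
for positive powers. -/
theorem inv_pow_add_inv_pow_le (q : ℕ) {A w Q : ℝ} (hQ : 0 < Q) (h1 : 0 < A + w) (h2 : 0 < A - w)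
    (h : Q * (A ^ 2 + q * w ^ 2) ≤ A * (A ^ 2 - w ^ 2)) :
    (1 / (A + w)) ^ q + (1 / (A - w)) ^ q ≤ 2 * (1 / Q) ^ q := by
  have hA : 0 < A := by linarith
  have hP : 0 < (A + w) * (A - w) := mul_pos h1 h2
  have e : (1 / (A + w)) ^ q + (1 / (A - w)) ^ q
      = ((A + w) ^ q + (A - w) ^ q) / ((A + w) * (A - w)) ^ q := by
    rw [mul_pow, div_pow, div_pow, one_pow]
    field_simp
    ring
  rw [e, div_le_iff₀ (pow_pos hP q), mul_assoc, ← mul_pow]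
  refine pow_add_pow_le_two_mul_pow q hA ?_
  rw [one_div, inv_mul_eq_div, div_mul_eq_mul_div, le_div_iff₀ hQ]
  nlinarith

/-! ### Barriers and the effect of one sign -/

/-- The barrier of a vector with squared length `N`: `Z` is the contribution of the finished rows,
`a` the partial inner product with the current row, `S` the squared length of the coordinates that
are still to come in this row, and `R` the number of rows that are still to come. -/
noncomputable def barrier (κ μ N Z a S R : ℝ) : ℝ :=
  N + μ * (Z + (1 + κ * S / N) * a ^ 2 + (1 + κ) * (S + R * N))

/-- The potential of a vector. -/
noncomputable def potential (k : ℕ) (γ μ N Z a S R : ℝ) : ℝ :=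
  (barrier γ μ N Z a S R / (N * (1 + μ * k * (1 + γ)))) ^ k +
    (N * (1 + μ * k * (1 + -γ)) / barrier (-γ) μ N Z a S R) ^ k

theorem barrier_pos {κ μ N Z a S R : ℝ} (hN : 0 < N) (hμ : 0 ≤ μ) (hκ : -1 ≤ κ) (hZ : 0 ≤ Z)
    (hS : 0 ≤ S) (hSN : S ≤ N) (hR : 0 ≤ R) : N ≤ barrier κ μ N Z a S R := by
  have h1 : 0 ≤ S / N := div_nonneg hS hN.le
  have h2 : S / N ≤ 1 := (div_le_one hN).2 hSN
  have h3 : 0 ≤ 1 + κ * S / N := by rw [mul_div_assoc]; nlinarith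
  have h4 : 0 ≤ (1 + κ) * (S + R * N) := mul_nonneg (by linarith) (by positivity)
  have h5 : 0 ≤ (1 + κ * S / N) * a ^ 2 := mul_nonneg h3 (sq_nonneg a)
  unfold barrier
  nlinarith [mul_nonneg hμ (add_nonneg (add_nonneg hZ h5) h4)]

/-- The mean of the barriers for the two choices of the next sign. -/
noncomputable def barrierMean (κ μ N Z a S R u : ℝ) : ℝ :=
  barrier κ μ N Z a (S - u ^ 2) R + μ * (1 + κ * (S - u ^ 2) / N) * u ^ 2

/-- Half the difference of the barriers for the two choices of the next sign. -/
noncomputable def barrierDev (κ μ N a S u : ℝ) : ℝ :=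
  2 * μ * (1 + κ * (S - u ^ 2) / N) * a * u

theorem barrier_add (κ μ N Z a S R u : ℝ) : barrier κ μ N Z (a + u) (S - u ^ 2) R
    = barrierMean κ μ N Z a S R u + barrierDev κ μ N a S u := by
  unfold barrierMean barrierDev barrier; ring

theorem barrier_sub (κ μ N Z a S R u : ℝ) : barrier κ μ N Z (a - u) (S - u ^ 2) R
    = barrierMean κ μ N Z a S R u - barrierDev κ μ N a S u := by
  unfold barrierMean barrierDev barrier; ring

/-- The drift of the barrier, with the sign of `κ`. Its first term is proportional to `a ^ 2 * u ^
2`, as is the squared deviation; the second term only helps. -/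
theorem barrier_sub_barrierMean (κ μ : ℝ) {N : ℝ} (hN : 0 < N) (Z a S R u : ℝ) :
    barrier κ μ N Z a S R - barrierMean κ μ N Z a S R u
      = μ * κ * (u ^ 2 / N) * a ^ 2 + μ * κ * u ^ 2 * (1 - (S - u ^ 2) / N) := by
  unfold barrierMean barrier
  field_simp
  ring

section
variable {k : ℕ} {γ μ N Z a S R u : ℝ}

theorem le_barrierMean {κ : ℝ} (hμ : 0 ≤ μ) (hκ : -1 ≤ κ) (hN : 0 < N) (hZ : 0 ≤ Z) (hR : 0 ≤ R)
    (hu : u ^ 2 ≤ S) (hS : S ≤ N) : N ≤ barrierMean κ μ N Z a S R u := by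
  have hpos : ∀ b, N ≤ barrier κ μ N Z b (S - u ^ 2) R := fun b =>
    barrier_pos hN hμ hκ hZ (by linarith) (by linarith [sq_nonneg u]) hR
  have h1 := hpos (a + u)
  have h2 := hpos (a - u)
  rw [barrier_add] at h1
  rw [barrier_sub] at h2
  linarith

/-- Both sides are multiples of `μ * a ^ 2 * u ^ 2`, and `b` bounds the weight `1 + κ * (S - u ^ 2)
/ N`. So the drift dominates `q` squared deviations once `4 * μ * q * b ^ 2 ≤ γ`. -/
theorem barrierDev_sq_le {κ q b : ℝ} (hκ : κ = γ ∨ κ = -γ) (hγ : 0 ≤ γ) (hμ : 0 ≤ μ)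
    (hN : 0 < N) (hu : u ^ 2 ≤ S) (hS : S ≤ N) (hq : 0 ≤ q)
    (hκb : 1 + max κ 0 ≤ b) (hγ1 : γ ≤ 1) (h : 4 * μ * q * b ^ 2 ≤ γ) :
    q * barrierDev κ μ N a S u ^ 2 ≤ μ * γ * (u ^ 2 / N) * a ^ 2 * N := by
  have e : μ * γ * (u ^ 2 / N) * a ^ 2 * N = μ * (a ^ 2 * u ^ 2) * γ := by
    field_simp
  set y := (S - u ^ 2) / N with hy
  have hy0 : 0 ≤ y := div_nonneg (by linarith) hN.le
  have hy1 : y ≤ 1 := (div_le_one hN).2 (by linarith [sq_nonneg u])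
  have e2 : q * barrierDev κ μ N a S u ^ 2
      = μ * (a ^ 2 * u ^ 2) * (4 * μ * q * (1 + κ * y) ^ 2) := by
    rw [barrierDev, mul_div_assoc, ← hy]; ring
  have h0 : 0 ≤ 1 + κ * y := by
    rcases hκ with rfl | rfl <;> nlinarith
  have h1 : 1 + κ * y ≤ b := by
    have := le_max_left κ 0
    have := le_max_right κ 0
    nlinarith
  rw [e, e2]
  have h2 : 4 * μ * q * (1 + κ * y) ^ 2 ≤ 4 * μ * q * b ^ 2 := by gcongr
  exact mul_le_mul_of_nonneg_left (h2.trans h) (by positivity)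

theorem barrier_pow_step (hγ : 0 ≤ γ) (hγ1 : γ ≤ 1 / 8) (hμ : 0 ≤ μ) (hkμ : μ * k = γ / 8)
    (hN : 0 < N) (hZ : 0 ≤ Z) (hR : 0 ≤ R) (hu : u ^ 2 ≤ S) (hS : S ≤ N) :
    barrier γ μ N Z (a + u) (S - u ^ 2) R ^ k + barrier γ μ N Z (a - u) (S - u ^ 2) R ^ k
      ≤ 2 * barrier γ μ N Z a S R ^ k := by
  rw [barrier_add, barrier_sub]
  have hA0 : N ≤ barrierMean γ μ N Z a S R u :=
    le_barrierMean hμ (by linarith) hN hZ hR hu hS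
  -- Here `1 + γ ≤ 9 / 8` and `4 * (γ / 8) * (9 / 8) ^ 2 ≤ γ`.
  have hw := barrierDev_sq_le (κ := γ) (q := k) (b := 9 / 8) (a := a) (Or.inl rfl) hγ hμ
    hN hu hS (Nat.cast_nonneg k) (by rw [max_eq_left hγ]; linarith) (by linarith) (by nlinarith)
  have hd := barrier_sub_barrierMean γ μ hN Z a S R u
  have hrest : 0 ≤ μ * γ * u ^ 2 * (1 - (S - u ^ 2) / N) :=
    mul_nonneg (by positivity) (sub_nonneg.2 ((div_le_one hN).2 (by linarith [sq_nonneg u])))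
  have hδ0 : 0 ≤ μ * γ * (u ^ 2 / N) * a ^ 2 := by positivity
  refine pow_add_pow_le_two_mul_pow k (hN.trans_le hA0) ?_
  generalize μ * γ * (u ^ 2 / N) * a ^ 2 = δ at *
  generalize barrierMean γ μ N Z a S R u = A at *
  have h1 : δ * N ≤ δ * A := mul_le_mul_of_nonneg_left hA0 hδ0
  have h2 : (A + δ) * A ≤ barrier γ μ N Z a S R * A :=
    mul_le_mul_of_nonneg_right (by linarith) (hN.le.trans hA0)
  linarith

theorem barrier_inv_pow_step (hγ : 0 ≤ γ) (hγ1 : γ ≤ 1 / 8) (hμ : 0 ≤ μ) (hkμ : μ * k = γ / 8)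
    (hμγ : 8 * μ ≤ γ) (hN : 0 < N) (hZ : 0 ≤ Z) (hR : 0 ≤ R) (hu : u ^ 2 ≤ S) (hS : S ≤ N) :
    (1 / barrier (-γ) μ N Z (a + u) (S - u ^ 2) R) ^ k +
        (1 / barrier (-γ) μ N Z (a - u) (S - u ^ 2) R) ^ k
      ≤ 2 * (1 / barrier (-γ) μ N Z a S R) ^ k := by
  have hpos : ∀ b, N ≤ barrier (-γ) μ N Z b (S - u ^ 2) R := fun b =>
    barrier_pos hN hμ (by linarith) hZ (by linarith) (by linarith [sq_nonneg u]) hR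
  have hpp := hpos (a + u)
  have hmm := hpos (a - u)
  rw [barrier_add] at hpp ⊢
  rw [barrier_sub] at hmm ⊢
  have hA0 : N ≤ barrierMean (-γ) μ N Z a S R u :=
    le_barrierMean hμ (by linarith) hN hZ hR hu hS
  -- One more than `k`: the product `A ^ 2 - w ^ 2` of the two barriers costs an additional `w ^ 2`.
  -- The assumption `8 * μ ≤ γ` leaves room for it.
  have hw := barrierDev_sq_le (κ := -γ) (q := k + 1) (b := 1) (a := a) (Or.inr rfl) hγ hμ
    hN hu hS (by positivity) (by rw [max_eq_right (by linarith)]; linarith) (by linarith)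
    (by nlinarith)
  have hd := barrier_sub_barrierMean (-γ) μ hN Z a S R u
  have hrest : 0 ≤ μ * γ * u ^ 2 * (1 - (S - u ^ 2) / N) :=
    mul_nonneg (by positivity) (sub_nonneg.2 ((div_le_one hN).2 (by linarith [sq_nonneg u])))
  have hδ0 : 0 ≤ μ * γ * (u ^ 2 / N) * a ^ 2 := by positivity
  refine inv_pow_add_inv_pow_le k (hN.trans_le (barrier_pos hN hμ (by linarith) hZ
    ((sq_nonneg u).trans hu) hS hR)) (hN.trans_le hpp) (hN.trans_le hmm) ?_
  have hd' : barrier (-γ) μ N Z a S R ≤ barrierMean (-γ) μ N Z a S R u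
      - μ * γ * (u ^ 2 / N) * a ^ 2 := by linarith
  clear hd hpp hmm hpos
  generalize μ * γ * (u ^ 2 / N) * a ^ 2 = δ at *
  generalize barrierMean (-γ) μ N Z a S R u = A at *
  generalize barrierDev (-γ) μ N a S u = w at *
  have h1 : δ * N ≤ δ * A := mul_le_mul_of_nonneg_left hA0 hδ0
  have hA1 : 0 ≤ A := hN.le.trans hA0
  have h2 : barrier (-γ) μ N Z a S R * (A ^ 2 + k * w ^ 2) ≤ (A - δ) * (A ^ 2 + k * w ^ 2) :=
    mul_le_mul_of_nonneg_right hd' (by positivity)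
  have h3 : 0 ≤ δ * (k * w ^ 2) := by positivity
  have h4 : A * ((k + 1) * w ^ 2) ≤ A * (δ * A) :=
    mul_le_mul_of_nonneg_left (hw.trans h1) hA1
  linarith

/-- The supermartingale property: the normalizing factors do not depend on the sign, so the two
power inequalities add up. -/
theorem potential_step (hk : 0 < k) (hγ : 0 ≤ γ) (hγ1 : γ ≤ 1 / 8) (hμ : μ = γ / (8 * k))
    (hN : 0 ≤ N) (hZ : 0 ≤ Z) (hR : 0 ≤ R) (hu : u ^ 2 ≤ S) (hS : S ≤ N) :
    potential k γ μ N Z (a + u) (S - u ^ 2) R + potential k γ μ N Z (a - u) (S - u ^ 2) R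
      ≤ 2 * potential k γ μ N Z a S R := by
  -- For a zero vector both quotients are `0` whatever the barrier, so the potential does not
  -- change.
  rcases hN.eq_or_lt with rfl | hN
  · simp [potential]; linarith
  have hk1 : (1 : ℝ) ≤ k := by exact_mod_cast hk
  have hμ0 : 0 ≤ μ := by rw [hμ]; positivity
  have hkμ : μ * k = γ / 8 := by rw [hμ]; field_simp
  have hμγ : 8 * μ ≤ γ := by nlinarith
  have h1 := barrier_pow_step (a := a) hγ hγ1 hμ0 hkμ hN hZ hR hu hS
  have h2 := barrier_inv_pow_step (a := a) hγ hγ1 hμ0 hkμ hμγ hN hZ hR hu hS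
  have hc1 : 0 ≤ (1 / (N * (1 + μ * k * (1 + γ)))) ^ k := by positivity
  have hc2 : 0 ≤ (N * (1 + μ * k * (1 + -γ))) ^ k := by
    have : 0 ≤ 1 + -γ := by linarith
    positivity
  unfold potential
  generalize N * (1 + μ * k * (1 + γ)) = c at *
  generalize N * (1 + μ * k * (1 + -γ)) = c' at *
  have t1 := mul_le_mul_of_nonneg_right h1 hc1
  have t2 := mul_le_mul_of_nonneg_left h2 hc2
  rw [add_mul, mul_assoc, ← mul_pow, ← mul_pow, ← mul_pow] at t1
  rw [mul_add, mul_left_comm, ← mul_pow, ← mul_pow, ← mul_pow] at t2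
  simp only [mul_one_div] at t1 t2
  linarith

end

/-! ### The potential at the start, between rows, and at the end -/

section
variable {k : ℕ} {γ μ N Z a S R : ℝ}

/-- Allows a single potential to be bounded by the total. The condition is on `S + R * N` and not on
`R`, because `R = -1` and `S = N` after the last row. -/
theorem potential_nonneg (hγ : 0 ≤ γ) (hγ1 : γ ≤ 1) (hμ : 0 ≤ μ) (hN : 0 ≤ N) (hZ : 0 ≤ Z)
    (hS : 0 ≤ S) (hSN : S ≤ N) (hR : 0 ≤ S + R * N) : 0 ≤ potential k γ μ N Z a S R := by
  have h1 : 0 ≤ S / N := div_nonneg hS hN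
  have h2 : S / N ≤ 1 := div_le_one_of_le₀ hSN hN
  have hb : ∀ κ, |κ| ≤ 1 → 0 ≤ barrier κ μ N Z a S R := fun κ hκ => by
    obtain ⟨ha, hb⟩ := abs_le.1 hκ
    have h3 : 0 ≤ 1 + κ * S / N := by rw [mul_div_assoc]; nlinarith
    have h4 : 0 ≤ (1 + κ) * (S + R * N) := mul_nonneg (by linarith) hR
    unfold barrier
    positivity
  have hγ' : |γ| ≤ 1 := by rwa [abs_of_nonneg hγ]
  have b1 := hb γ hγ'
  have b2 := hb (-γ) (by rwa [abs_neg])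
  have b3 : 0 ≤ 1 + -γ := by linarith
  unfold potential
  positivity

/-- At the end of a row, its inner product is merged with the contribution of the finished rows. -/
theorem potential_new_row (k : ℕ) (γ μ N Z a R : ℝ) :
    potential k γ μ N (Z + a ^ 2) 0 N (R - 1) = potential k γ μ N Z a 0 R := by
  have h : ∀ κ, barrier κ μ N (Z + a ^ 2) 0 N (R - 1) = barrier κ μ N Z a 0 R := fun κ => by
    unfold barrier; simp; ring_nf; simp
  unfold potential
  rw [h, h]

theorem potential_start : potential k γ μ N 0 0 N (k - 1) ≤ 2 := by
  have h : ∀ κ, barrier κ μ N 0 0 N (k - 1) = N * (1 + μ * k * (1 + κ)) := fun κ => by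
    unfold barrier; ring
  have h1 : ∀ x : ℝ, (x / x) ^ k ≤ 1 := fun x => by
    rcases eq_or_ne x 0 with rfl | hx
    · simp only [div_zero]; exact pow_le_one₀ le_rfl zero_le_one
    · simp [div_self hx]
  unfold potential
  rw [h, h]
  linarith [h1 (N * (1 + μ * k * (1 + γ))), h1 (N * (1 + μ * k * (1 + -γ)))]

/-- Bernoulli's inequality gives `(1 + 1 / j) ^ j ≥ 2`. This replaces the extraction of a `k`-th
root. -/
theorem two_pow_le_one_add_inv_pow {j : ℕ} (hj : 0 < j) (b : ℕ) (h : j * b ≤ k) :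
    (2 : ℝ) ^ b ≤ (1 + 1 / j) ^ k := by
  have hj0 : (0 : ℝ) < j := by exact_mod_cast hj
  have h1 : (2 : ℝ) ≤ (1 + 1 / j) ^ j := by
    refine le_trans (le_of_eq ?_) (one_add_mul_le_pow (a := 1 / (j : ℝ)) ?_ j)
    · field_simp; norm_num
    · have : (0 : ℝ) ≤ 1 / j := by positivity
      linarith
  calc (2 : ℝ) ^ b ≤ ((1 + 1 / j) ^ j) ^ b := by gcongr
    _ = (1 + 1 / j) ^ (j * b) := by rw [pow_mul]
    _ ≤ _ := pow_le_pow_right₀ (le_add_of_nonneg_right (by positivity)) h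

/-- With `a = 0`, `S = N` and `R = -1` both barriers equal `N + μ * Z`. Each quotient has a `k`-th
power at most `2 ^ b`, hence is at most `1 + 1 / j ≤ 1 + γ ^ 2 / 16`. Since `μ * k = γ / 8`, this
slack only enlarges the relative error from `γ` to `2 * γ`. -/
theorem bounds_of_potential_le {j b : ℕ} (hk : 0 < k) (hj : 0 < j) (hγ : 0 < γ) (hγ1 : γ ≤ 1 / 8)
    (hμ : μ = γ / (8 * k)) (hjγ : 16 ≤ j * γ ^ 2) (hjk : j * b ≤ k) (hN : 0 < N) (hZ : 0 ≤ Z)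
    (h : potential k γ μ N Z 0 N (-1) ≤ 2 ^ b) :
    (1 - 2 * γ) * (k * N) ≤ Z ∧ Z ≤ (1 + 2 * γ) * (k * N) := by
  have hk0 : (0 : ℝ) < k := by exact_mod_cast hk
  have hj0 : (0 : ℝ) < j := by exact_mod_cast hj
  have hμ0 : 0 < μ := by rw [hμ]; positivity
  have hkμ : μ * k = γ / 8 := by rw [hμ]; field_simp
  have hb : ∀ κ, barrier κ μ N Z 0 N (-1) = N + μ * Z := fun κ => by unfold barrier; ring
  have hB : 0 < N + μ * Z := by positivity
  have hpow := h.trans (two_pow_le_one_add_inv_pow hj b hjk)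
  have hg1 : 0 < 1 + -γ := by linarith
  unfold potential at hpow
  rw [hb, hb, hkμ] at hpow
  have ha0 : 0 ≤ (N + μ * Z) / (N * (1 + γ / 8 * (1 + γ))) := by positivity
  have hb0 : 0 ≤ N * (1 + γ / 8 * (1 + -γ)) / (N + μ * Z) := by positivity
  have hj1 : (0 : ℝ) ≤ 1 + 1 / j := by positivity
  have h1 : (N + μ * Z) / (N * (1 + γ / 8 * (1 + γ))) ≤ 1 + 1 / j :=
    (pow_le_pow_iff_left₀ ha0 hj1 hk.ne').1 (by linarith [pow_nonneg hb0 k])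
  have h2 : N * (1 + γ / 8 * (1 + -γ)) / (N + μ * Z) ≤ 1 + 1 / j :=
    (pow_le_pow_iff_left₀ hb0 hj1 hk.ne').1 (by linarith [pow_nonneg ha0 k])
  rw [div_le_iff₀ (by positivity)] at h1 h2
  have hj2 : 1 / (j : ℝ) ≤ γ ^ 2 / 16 := by
    rw [div_le_div_iff₀ hj0 (by norm_num)]; linarith
  have hZμ : Z * γ = 8 * (k * (μ * Z)) := by
    have : γ = 8 * (μ * k) := by linarith
    rw [this]; ring
  have hγ2 : γ ^ 2 ≤ γ / 8 := by nlinarith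
  have e1 : μ * Z ≤ N * (γ / 8 * (1 + 2 * γ)) := by
    have : (1 + 1 / (j : ℝ)) * (N * (1 + γ / 8 * (1 + γ)))
        ≤ (1 + γ ^ 2 / 16) * (N * (1 + γ / 8 * (1 + γ))) := by gcongr
    have h3 : (1 + γ ^ 2 / 16) * (1 + γ / 8 * (1 + γ)) ≤ 1 + γ / 8 * (1 + 2 * γ) := by nlinarith
    have := mul_le_mul_of_nonneg_left h3 hN.le
    linarith
  have e2 : N * (γ / 8 * (1 - 2 * γ)) ≤ μ * Z := by
    have h4 : (1 + 1 / (j : ℝ)) * (N + μ * Z) ≤ (1 + γ ^ 2 / 16) * (N + μ * Z) := by gcongr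
    have h3 : (1 + γ ^ 2 / 16) * (1 + γ / 8 * (1 - 2 * γ)) ≤ 1 + γ / 8 * (1 + -γ) := by nlinarith
    have := mul_le_mul_of_nonneg_left h3 hN.le
    have h5 : (1 + γ ^ 2 / 16) * (N * (1 + γ / 8 * (1 - 2 * γ)))
        ≤ (1 + γ ^ 2 / 16) * (N + μ * Z) := by linarith
    have h6 := le_of_mul_le_mul_left h5 (by positivity)
    linarith
  constructor
  · refine le_of_mul_le_mul_right ?_ hγ
    rw [hZμ]
    nlinarith
  · refine le_of_mul_le_mul_right ?_ hγ
    rw [hZμ]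
    nlinarith

end

/-- The correct scaling of a sign matrix with `l ^ 2` rows. -/
theorem scaled_bounds {n l : ℕ} (hn : 0 < n) (hl : 0 < l) {N Z : ℝ} (hN : 0 ≤ N)
    (h1 : (1 - 2 * (1 / (8 * n))) * (((l * l : ℕ) : ℝ) * N) ≤ Z)
    (h2 : Z ≤ (1 + 2 * (1 / (8 * n))) * (((l * l : ℕ) : ℝ) * N)) :
    N ≤ ((1 + 1 / (2 * n)) / l : ℝ) ^ 2 * Z ∧
      ((1 + 1 / (2 * n)) / l : ℝ) ^ 2 * Z ≤ (1 + 1 / n) ^ 2 * N := by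
  have hn1 : (1 : ℝ) ≤ n := by exact_mod_cast hn
  have hl0 : (0 : ℝ) < l := by exact_mod_cast hl
  -- In terms of `δ` the squared length is known up to `1 ± δ / 4`; the factor `1 + δ / 2` in the
  -- scaling lifts this interval above `1` and keeps it below `(1 + δ) ^ 2`.
  set δ : ℝ := 1 / n with hδ
  have hδ0 : 0 < δ := by positivity
  have hδ1 : δ ≤ 1 := (div_le_one (by linarith)).2 hn1
  have e1 : (1 : ℝ) / (8 * n) = δ / 8 := by rw [hδ]; field_simp
  have e2 : (1 : ℝ) / (2 * n) = δ / 2 := by rw [hδ]; field_simp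
  rw [e1] at h1 h2
  rw [e2, div_pow]
  push_cast at h1 h2
  have hl2 : (0 : ℝ) < l ^ 2 := by positivity
  have hδ2 : δ ^ 2 ≤ δ := by nlinarith
  have hδ3 : δ ^ 3 ≤ δ := by
    calc δ ^ 3 = δ * δ ^ 2 := by ring
      _ ≤ 1 * δ ^ 2 := by gcongr
      _ ≤ δ := by linarith
  constructor
  · rw [div_mul_eq_mul_div, le_div_iff₀ hl2]
    have h3 := mul_le_mul_of_nonneg_left h1 (sq_nonneg (1 + δ / 2))
    have h4 : 1 ≤ (1 + δ / 2) ^ 2 * (1 - 2 * (δ / 8)) := by nlinarith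
    have h5 := mul_le_mul_of_nonneg_right h4 (by positivity : 0 ≤ N * (l : ℝ) ^ 2)
    linarith
  · rw [div_mul_eq_mul_div, div_le_iff₀ hl2]
    have h3 := mul_le_mul_of_nonneg_left h2 (sq_nonneg (1 + δ / 2))
    have h4 : (1 + δ / 2) ^ 2 * (1 + 2 * (δ / 8)) ≤ (1 + δ) ^ 2 := by nlinarith
    have h5 := mul_le_mul_of_nonneg_right h4 (by positivity : 0 ≤ N * (l : ℝ) ^ 2)
    linarith

/-! ### Verification of programs -/

namespace RealRAM

/-- `s.setN c v` is the memory `s` after the assignment of `v` to the natural cell `c`. -/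
def State.setN (s : State) (c v : ℕ) : State := ⟨Function.update s.nat c v, s.real⟩

/-- `s.setR a v` is the memory `s` after the assignment of `v` to the real cell `a`. -/
def State.setR (s : State) (a : ℕ) (v : ℝ) : State := ⟨s.nat, Function.update s.real a v⟩

@[simp] theorem State.setN_nat (s : State) (c v c' : ℕ) :
    (s.setN c v).nat c' = if c' = c then v else s.nat c' := by
  simp [setN, Function.update_apply]

@[simp] theorem State.setN_real (s : State) (c v : ℕ) : (s.setN c v).real = s.real := rfl

@[simp] theorem State.setR_nat (s : State) (a : ℕ) (v : ℝ) : (s.setR a v).nat = s.nat := rfl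

theorem State.setR_real (s : State) (a : ℕ) (v : ℝ) (a' : ℕ) :
    (s.setR a v).real a' = if a' = a then v else s.real a' := by
  simp [setR, Function.update_apply]

theorem State.setR_real_same (s : State) (a : ℕ) (v : ℝ) : (s.setR a v).real a = v := by
  simp [setR_real]

theorem State.setR_real_ne (s : State) {a a' : ℕ} (v : ℝ) (h : a' ≠ a) :
    (s.setR a v).real a' = s.real a' := by
  simp [setR_real, h]

/-- The program `p`, started in `s`, halts in a configuration and after a time that satisfy `Q`. -/
def Wp (p : Program) (s : State) (Q : State → ℕ → Prop) : Prop :=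
  ∃ s' t, Exec p s s' t ∧ Q s' t

theorem Wp.mono {p : Program} {s : State} {Q Q' : State → ℕ → Prop} (h : Wp p s Q)
    (hQ : ∀ s' t, Q s' t → Q' s' t) : Wp p s Q' := by
  obtain ⟨s', t, h1, h2⟩ := h
  exact ⟨s', t, h1, hQ _ _ h2⟩

theorem Wp.seq {p q : Program} {s : State} {Q : State → ℕ → Prop}
    (h : Wp p s fun s₁ t₁ => Wp q s₁ fun s₂ t₂ => Q s₂ (t₁ + t₂)) : Wp (.seq p q) s Q := by
  obtain ⟨s₁, t₁, h1, s₂, t₂, h2, h3⟩ := h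
  exact ⟨s₂, _, .seq h1 h2, h3⟩

theorem Wp.setNat {a v : NatExpr} {s : State} {Q : State → ℕ → Prop}
    (h : Q (s.setN (a.eval s) (v.eval s)) (a.cost + v.cost + 1)) : Wp (.setNat a v) s Q :=
  ⟨_, _, .setNat a v s, h⟩

theorem Wp.setReal {a : NatExpr} {v : RealExpr} {s : State} {Q : State → ℕ → Prop}
    (h : Q (s.setR (a.eval s) (v.eval s)) (a.cost + v.cost + 1)) : Wp (.setReal a v) s Q :=
  ⟨_, _, .setReal a v s, h⟩

theorem Wp.branch {b : Test} {p q : Program} {s : State} {Q : State → ℕ → Prop}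
    (h1 : b.Holds s → Wp p s fun s' t => Q s' (b.cost + t))
    (h2 : ¬ b.Holds s → Wp q s fun s' t => Q s' (b.cost + t)) : Wp (.branch b p q) s Q := by
  by_cases hb : b.Holds s
  · obtain ⟨s', t, h, hQ⟩ := h1 hb
    exact ⟨s', _, .branch_true hb h, hQ⟩
  · obtain ⟨s', t, h, hQ⟩ := h2 hb
    exact ⟨s', _, .branch_false hb h, hQ⟩

/-- A `while` loop that is executed exactly `n` times. -/
theorem Wp.loop {b : Test} {p : Program} {s : State} {Q : State → ℕ → Prop} (n T : ℕ)
    (I : ℕ → State → Prop) (h0 : I 0 s) (hb : ∀ i s, I i s → (b.Holds s ↔ i < n))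
    (hstep : ∀ i s, i < n → I i s → Wp p s fun s' t => t ≤ T ∧ I (i + 1) s')
    (hQ : ∀ s t, I n s → t ≤ n * (T + b.cost) + b.cost → Q s t) : Wp (.loop b p) s Q := by
  suffices h : ∀ j i s, i + j = n → I i s →
      ∃ s' t, Exec (.loop b p) s s' t ∧ I n s' ∧ t ≤ j * (T + b.cost) + b.cost by
    obtain ⟨s', t, h1, h2, h3⟩ := h n 0 s (zero_add n) h0
    exact ⟨s', t, h1, hQ _ _ h2 h3⟩
  intro j
  induction j with
  | zero =>
    intro i s hi hI
    obtain rfl : i = n := by simpa using hi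
    exact ⟨s, _, .loop_false fun h => lt_irrefl _ ((hb _ _ hI).1 h), hI, by simp⟩
  | succ j ih =>
    intro i s hi hI
    have hin : i < n := by omega
    obtain ⟨s₁, t₁, h1, h2, h3⟩ := hstep i s hin hI
    obtain ⟨s₂, t₂, h4, h5, h6⟩ := ih (i + 1) s₁ (by omega) h3
    refine ⟨s₂, _, .loop_true ((hb _ _ hI).2 hin) h1 h4, h5, ?_⟩
    rw [Nat.succ_mul]
    omega

/-- The value of the natural cell `c`. -/
def cell (c : ℕ) : NatExpr := .load (.const c)

@[simp] theorem cell_eval (c : ℕ) (s : State) : (cell c).eval s = s.nat c := rfl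

@[simp] theorem cell_cost (c : ℕ) : (cell c).cost = 2 := rfl

/-- The assignment of `v` to the natural cell `c`. -/
def assign (c : ℕ) (v : NatExpr) : Program := .setNat (.const c) v

theorem Wp.assign {c : ℕ} {v : NatExpr} {s : State} {Q : State → ℕ → Prop}
    (h : Q (s.setN c (v.eval s)) (v.cost + 2)) : Wp (assign c v) s Q :=
  Wp.setNat (by
    have e : (NatExpr.const c).cost + v.cost + 1 = v.cost + 2 := by
      simp only [NatExpr.cost]; omega
    rw [e]; exact h)

/-- Repeat `p`, with the counter in the cell `c` running from `0` to the value of the cell `b`. -/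
def forLoop (c b : ℕ) (p : Program) : Program :=
  .seq (assign c (.const 0))
    (.loop (.natLt (cell c) (cell b)) (.seq p (assign c (.add (cell c) (.const 1)))))

/-- Each round adds `11` to the cost of the body: `6` for the increment and `5` for the test. The
initialization and the last test cost `8`. -/
theorem Wp.forLoop {c b : ℕ} {p : Program} {s : State} {Q : State → ℕ → Prop} (n T : ℕ)
    (I : ℕ → State → Prop) (h0 : I 0 (s.setN c 0))
    (hI : ∀ i s, I i s → s.nat c = i ∧ s.nat b = n)
    (hstep : ∀ i s, i < n → I i s →
      Wp p s fun s' t => t ≤ T ∧ s'.nat c = i ∧ I (i + 1) (s'.setN c (i + 1)))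
    (hQ : ∀ s t, I n s → t ≤ n * (T + 11) + 8 → Q s t) : Wp (forLoop c b p) s Q := by
  refine .seq (.assign (.loop n (T + 6) I h0 (fun i s h => ?_) (fun i s hi h => ?_)
    fun s t h ht => ?_))
  · simp only [Test.Holds, cell_eval, (hI i s h).1, (hI i s h).2]
  · refine .seq ((hstep i s hi h).mono fun s' t h' => .assign ?_)
    obtain ⟨h1, h2, h3⟩ := h'
    simp only [NatExpr.eval, cell_eval, h2, NatExpr.cost, cell_cost]
    exact ⟨by omega, h3⟩
  · refine hQ s _ h ?_
    simp only [NatExpr.cost, Test.cost, cell_cost] at ht ⊢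
    have e : T + 6 + (2 + 2 + 1) = T + 11 := by omega
    rw [e] at ht
    omega

/-- The real cells from the address `b` on contain `f 0, …, f (n - 1)`. -/
def ArrayAt (b n : ℕ) (f : ℕ → ℝ) (s : State) : Prop := ∀ x < n, s.real (b + x) = f x

theorem ArrayAt.setN {b n : ℕ} {f : ℕ → ℝ} {s : State} (h : ArrayAt b n f s) (c v : ℕ) :
    ArrayAt b n f (s.setN c v) := h

theorem ArrayAt.setR {b n : ℕ} {f : ℕ → ℝ} {s : State} (h : ArrayAt b n f s) {a : ℕ} (v : ℝ)
    (ha : a < b ∨ b + n ≤ a) : ArrayAt b n f (s.setR a v) := fun x hx => by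
  rw [State.setR_real_ne _ _ (by omega), h x hx]

theorem ArrayAt.set {b n : ℕ} {f : ℕ → ℝ} {s : State} (h : ArrayAt b n f s) (x : ℕ) (v : ℝ) :
    ArrayAt b n (Function.update f x v) (s.setR (b + x) v) := fun y hy => by
  rcases eq_or_ne y x with rfl | hne
  · simp [State.setR_real_same]
  · rw [State.setR_real_ne _ _ (by omega), h y hy, Function.update_of_ne hne]

theorem ArrayAt.push {b n : ℕ} {f : ℕ → ℝ} {s : State} (h : ArrayAt b n f s) :
    ArrayAt b (n + 1) f (s.setR (b + n) (f n)) := fun y hy => by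
  rcases eq_or_ne y n with rfl | hne
  · simp [State.setR_real_same]
  · rw [State.setR_real_ne _ _ (by omega), h y (by omega)]

theorem ArrayAt.congr {b n : ℕ} {f g : ℕ → ℝ} {s : State} (h : ArrayAt b n f s)
    (hfg : ∀ x < n, f x = g x) : ArrayAt b n g s := fun x hx => by rw [h x hx, hfg x hx]

end RealRAM

namespace RealRAM

/-! ### The program

The natural cells `0, …, 8` hold `d`, `m`, `L`, `n`, `l`, `k`, `D`, `N`, `B`, where `m ≤ 2 ^ L`,
`1 ≤ n * ε`, `k = l ^ 2` is the number of rows, `D = m ^ 2 * d`, `N = 2 * m ^ 2` is the number of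
sums and differences of the vectors, and `B` is the first free address. The cells from `9` on are
counters and pointers. The real cells `B, …, B + 7` are for intermediate results; they are followed
by four arrays of length `N`, by the coordinates of the sums and differences of the vectors, and by
the output matrix. -/

def zBase : NatExpr := .add (cell 8) (.const 8)
def aBase : NatExpr := .add zBase (cell 7)
def sBase : NatExpr := .add aBase (cell 7)
def nBase : NatExpr := .add sBase (cell 7)
def uBase : NatExpr := .add nBase (cell 7)
def outBase : NatExpr := .add (.add uBase (cell 6)) (cell 6)

def scratch (c : ℕ) : NatExpr := .add (cell 8) (.const c)

/-- The entry of the array with the given base that belongs to the current vector. -/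
def entry (b : NatExpr) : NatExpr := .add b (cell 11)

def gammaExpr : RealExpr := .div (.const 1) (.mul (.const 8) (.ofNat (cell 3)))
def muExpr : RealExpr := .div gammaExpr (.mul (.const 8) (.ofNat (cell 5)))
def rowsLeftExpr : RealExpr := .sub (.sub (.ofNat (cell 5)) (.const 1)) (.ofNat (cell 9))
def coordExpr : RealExpr := .load (cell 13)
def innerExpr (q : ℚ) : RealExpr := .add (.load (entry aBase)) (.mul (.const q) coordExpr)
def restExpr : RealExpr := .sub (.load (entry sBase)) (.mul coordExpr coordExpr)

def barrierExpr (κ : RealExpr) (q : ℚ) : RealExpr :=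
  .add (.load (entry nBase)) (.mul muExpr (.add (.add (.load (entry zBase))
    (.mul (.add (.const 1) (.div (.mul κ restExpr) (.load (entry nBase))))
      (.mul (innerExpr q) (innerExpr q))))
    (.mul (.add (.const 1) κ) (.add restExpr (.mul rowsLeftExpr (.load (entry nBase)))))))

def startExpr (κ : RealExpr) : RealExpr :=
  .mul (.load (entry nBase))
    (.add (.const 1) (.mul (.mul muExpr (.ofNat (cell 5))) (.add (.const 1) κ)))

def negGammaExpr : RealExpr := .sub (.const 0) gammaExpr

def upperExpr (q : ℚ) : RealExpr := .div (barrierExpr gammaExpr q) (startExpr gammaExpr)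
def lowerExpr (q : ℚ) : RealExpr := .div (startExpr negGammaExpr) (barrierExpr negGammaExpr q)

/-- Multiply two cells by the two factors of the potential of the current vector. -/
def powerStep (q : ℚ) : Program :=
  .seq (.setReal (scratch 0) (.mul (.load (scratch 0)) (upperExpr q)))
    (.setReal (scratch 1) (.mul (.load (scratch 1)) (lowerExpr q)))

/-- Add the potential of the current vector, for the sign `q`, to the scratch cell `c`. -/
def addPotential (q : ℚ) (c : ℕ) : Program :=
  .seq (.setReal (scratch 0) (.const 1)) (.seq (.setReal (scratch 1) (.const 1))
    (.seq (forLoop 12 5 (powerStep q))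
      (.seq (.setReal (scratch c) (.add (.load (scratch c))
          (.add (.load (scratch 0)) (.load (scratch 1)))))
        (assign 13 (.add (cell 13) (cell 0))))))

/-- Compute the total potential for the sign `q` of the current entry. -/
def totalPotential (q : ℚ) (c : ℕ) : Program :=
  .seq (.setReal (scratch c) (.const 0)) (.seq (assign 13 (.add uBase (cell 10)))
    (forLoop 11 7 (addPotential q c)))

/-- The contents of the memory while the entries of the matrix are chosen. -/
structure Mem (d l k n N D B : ℕ) (U F Z a S : ℕ → ℝ) (s : State) : Prop where
  hd : s.nat 0 = d
  hn : s.nat 3 = n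
  hl : s.nat 4 = l
  hk : s.nat 5 = k
  hD : s.nat 6 = D
  hN : s.nat 7 = N
  hB : s.nat 8 = B
  hZ : ArrayAt (B + 8) N Z s
  ha : ArrayAt (B + 8 + N) N a s
  hS : ArrayAt (B + 8 + N + N) N S s
  hF : ArrayAt (B + 8 + N + N + N) N F s
  hU : ArrayAt (B + 8 + N + N + N + N) (D + D) U s

variable {d l k n N D B : ℕ} {U F Z a S : ℕ → ℝ} {s : State}

/-- Counters from cell `9` on and the real cells below `B + 8` are free workspace: changing them
does not disturb the tables. -/
theorem Mem.frame (h : Mem d l k n N D B U F Z a S s) {s' : State}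
    (hn : ∀ c < 9, s'.nat c = s.nat c) (hr : ∀ x, B + 8 ≤ x → s'.real x = s.real x) :
    Mem d l k n N D B U F Z a S s' where
  hd := by rw [hn _ (by norm_num), h.hd]
  hn := by rw [hn _ (by norm_num), h.hn]
  hl := by rw [hn _ (by norm_num), h.hl]
  hk := by rw [hn _ (by norm_num), h.hk]
  hD := by rw [hn _ (by norm_num), h.hD]
  hN := by rw [hn _ (by norm_num), h.hN]
  hB := by rw [hn _ (by norm_num), h.hB]
  hZ x hx := by rw [hr _ (by omega), h.hZ x hx]
  ha x hx := by rw [hr _ (by omega), h.ha x hx]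
  hS x hx := by rw [hr _ (by omega), h.hS x hx]
  hF x hx := by rw [hr _ (by omega), h.hF x hx]
  hU x hx := by rw [hr _ (by omega), h.hU x hx]

theorem Mem.zBase_eval (h : Mem d l k n N D B U F Z a S s) : zBase.eval s = B + 8 := by
  simp [zBase, NatExpr.eval, h.hB]

theorem Mem.aBase_eval (h : Mem d l k n N D B U F Z a S s) : aBase.eval s = B + 8 + N := by
  simp [aBase, NatExpr.eval, h.zBase_eval, h.hN]

theorem Mem.sBase_eval (h : Mem d l k n N D B U F Z a S s) : sBase.eval s = B + 8 + N + N := by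
  simp [sBase, NatExpr.eval, h.aBase_eval, h.hN]

theorem Mem.nBase_eval (h : Mem d l k n N D B U F Z a S s) :
    nBase.eval s = B + 8 + N + N + N := by
  simp [nBase, NatExpr.eval, h.sBase_eval, h.hN]

theorem Mem.uBase_eval (h : Mem d l k n N D B U F Z a S s) :
    uBase.eval s = B + 8 + N + N + N + N := by
  simp [uBase, NatExpr.eval, h.nBase_eval, h.hN]

theorem Mem.outBase_eval (h : Mem d l k n N D B U F Z a S s) :
    outBase.eval s = B + 8 + N + N + N + N + D + D := by
  simp [outBase, NatExpr.eval, h.uBase_eval, h.hD]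

theorem Mem.scratch_eval (h : Mem d l k n N D B U F Z a S s) (c : ℕ) :
    (scratch c).eval s = B + c := by
  simp [scratch, NatExpr.eval, h.hB]

theorem Mem.entry_eval (_ : Mem d l k n N D B U F Z a S s) {p : ℕ} (hp : s.nat 11 = p)
    (b : NatExpr) : (entry b).eval s = b.eval s + p := by
  simp [entry, NatExpr.eval, hp]

theorem Mem.gammaExpr_eval (h : Mem d l k n N D B U F Z a S s) :
    gammaExpr.eval s = 1 / (8 * n) := by
  simp [gammaExpr, RealExpr.eval, h.hn]

theorem Mem.negGammaExpr_eval (h : Mem d l k n N D B U F Z a S s) :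
    negGammaExpr.eval s = -(1 / (8 * n)) := by
  simp [negGammaExpr, RealExpr.eval, h.gammaExpr_eval]

theorem Mem.muExpr_eval (h : Mem d l k n N D B U F Z a S s) :
    muExpr.eval s = 1 / (8 * n) / (8 * k) := by
  simp [muExpr, RealExpr.eval, h.gammaExpr_eval, h.hk]

theorem Mem.rowsLeftExpr_eval (h : Mem d l k n N D B U F Z a S s) {r : ℕ} (hr : s.nat 9 = r) :
    rowsLeftExpr.eval s = k - 1 - r := by
  simp [rowsLeftExpr, RealExpr.eval, h.hk, hr]

theorem Mem.coordExpr_eval (h : Mem d l k n N D B U F Z a S s) {x : ℕ}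
    (hx : s.nat 13 = B + 8 + N + N + N + N + x) (hxD : x < D + D) :
    coordExpr.eval s = U x := by
  simp [coordExpr, RealExpr.eval, hx, h.hU x hxD]

section
variable {p r x : ℕ} (h : Mem d l k n N D B U F Z a S s) (hp : s.nat 11 = p) (hpN : p < N)
  (hr : s.nat 9 = r) (hx : s.nat 13 = B + 8 + N + N + N + N + x) (hxD : x < D + D)
include h hp hpN hx hxD

theorem Mem.innerExpr_eval (q : ℚ) : (innerExpr q).eval s = a p + q * U x := by
  simp [innerExpr, RealExpr.eval, h.entry_eval hp, h.coordExpr_eval hx hxD, h.aBase_eval,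
    h.ha p hpN]

theorem Mem.restExpr_eval : restExpr.eval s = S p - U x ^ 2 := by
  simp [restExpr, RealExpr.eval, h.entry_eval hp, h.coordExpr_eval hx hxD, h.sBase_eval,
    h.hS p hpN, sq]

include hr

theorem Mem.barrierExpr_eval {κ : RealExpr} {κ' : ℝ} (hκ : κ.eval s = κ') (q : ℚ) :
    (barrierExpr κ q).eval s = barrier κ' (1 / (8 * n) / (8 * k)) (F p) (Z p)
      (a p + q * U x) (S p - U x ^ 2) (k - 1 - r) := by
  simp only [barrierExpr, RealExpr.eval, h.entry_eval hp, h.innerExpr_eval hp hpN hx hxD,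
    h.restExpr_eval hp hpN hx hxD, h.nBase_eval, h.zBase_eval, h.hF p hpN, h.hZ p hpN, hκ,
    h.muExpr_eval, h.rowsLeftExpr_eval hr, barrier, Rat.cast_one, sq]

end

theorem Mem.startExpr_eval (h : Mem d l k n N D B U F Z a S s) {p : ℕ} (hp : s.nat 11 = p)
    (hpN : p < N) {κ : RealExpr} {κ' : ℝ} (hκ : κ.eval s = κ') :
    (startExpr κ).eval s = F p * (1 + 1 / (8 * n) / (8 * k) * k * (1 + κ')) := by
  simp only [startExpr, RealExpr.eval, h.entry_eval hp, h.nBase_eval, h.hF p hpN, hκ,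
    h.muExpr_eval, Rat.cast_one, cell_eval, h.hk]

/-- The potential of the vector `p` after the choice of the sign `q`. -/
noncomputable def signPotential (k n : ℕ) (F Z a S : ℕ → ℝ) (r : ℕ) (q : ℝ) (p : ℕ) (u : ℝ) : ℝ :=
  potential k (1 / (8 * n)) (1 / (8 * n) / (8 * k)) (F p) (Z p) (a p + q * u) (S p - u ^ 2)
    (k - 1 - r)

/-- The cells `B` and `B + 1` collect the two `k`-th powers by repeated multiplication. The pointer
in cell `13` advances by `d`, to the same coordinate of the next vector. The bound `989` for one
round is generous and gives `1000` with the loop overhead. -/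
theorem wp_addPotential {p r x c : ℕ} (h : Mem d l k n N D B U F Z a S s) (hp : s.nat 11 = p)
    (hpN : p < N) (hr : s.nat 9 = r) (hx : s.nat 13 = B + 8 + N + N + N + N + x)
    (hxD : x < D + D) (hc : 2 ≤ c) (hc8 : c < 8) (q : ℚ) :
    Wp (addPotential q c) s fun s' t => t ≤ k * 1000 + 100 ∧
      (∀ i, i ≠ 12 → i ≠ 13 → s'.nat i = s.nat i) ∧ s'.nat 13 = s.nat 13 + d ∧
      (∀ y, y ≠ B → y ≠ B + 1 → y ≠ B + c → s'.real y = s.real y) ∧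
      s'.real (B + c) = s.real (B + c) + signPotential k n F Z a S r q p (U x) := by
  set A := barrier (1 / (8 * n)) (1 / (8 * n) / (8 * k)) (F p) (Z p) (a p + q * U x)
      (S p - U x ^ 2) (k - 1 - r) / (F p * (1 + 1 / (8 * n) / (8 * k) * k * (1 + 1 / (8 * n))))
    with hA
  set A' := F p * (1 + 1 / (8 * n) / (8 * k) * k * (1 + -(1 / (8 * n)))) /
    barrier (-(1 / (8 * n))) (1 / (8 * n) / (8 * k)) (F p) (Z p) (a p + q * U x)
      (S p - U x ^ 2) (k - 1 - r) with hA'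
  have e0 : (scratch 0).eval s = B := by simp [h.scratch_eval]
  refine .seq (.setReal (.seq (.setReal (.seq (.forLoop k 989 (fun e s' =>
    (∀ i, i ≠ 12 → s'.nat i = s.nat i) ∧ s'.nat 12 = e ∧
    (∀ y, y ≠ B → y ≠ B + 1 → s'.real y = s.real y) ∧
    s'.real B = A ^ e ∧ s'.real (B + 1) = A' ^ e) ?_ ?_ ?_ ?_)))))
  · have e1 : (scratch 1).eval (s.setR ((scratch 0).eval s) ((RealExpr.const 1).eval s))
        = B + 1 := by simp [scratch, NatExpr.eval, h.hB]
    rw [e1, e0]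
    refine ⟨fun i hi => by simp [hi], by simp, fun y h1 h2 => ?_, ?_, ?_⟩
    · simp [State.setR_real, h1, h2]
    · simp [State.setR_real, RealExpr.eval]
    · simp [State.setR_real, RealExpr.eval]
  · intro i s' hI
    exact ⟨hI.2.1, by rw [hI.1 _ (by norm_num), h.hk]⟩
  · rintro e s' he ⟨h1, h2, h3, h4, h5⟩
    have hm : Mem d l k n N D B U F Z a S s' :=
      h.frame (fun i hi => h1 i (by omega)) fun y hy => h3 y (by omega) (by omega)
    refine .seq (.setReal ?_)
    set v := (RealExpr.mul (.load (scratch 0)) (upperExpr q)).eval s' with hv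
    have ev : v = A ^ (e + 1) := by
      rw [hv, RealExpr.eval, RealExpr.eval, hm.scratch_eval, add_zero, h4, upperExpr,
        RealExpr.eval, hm.barrierExpr_eval (by rw [h1 _ (by norm_num), hp]) hpN
          (by rw [h1 _ (by norm_num), hr]) (by rw [h1 _ (by norm_num), hx]) hxD hm.gammaExpr_eval,
        hm.startExpr_eval (by rw [h1 _ (by norm_num), hp]) hpN hm.gammaExpr_eval, pow_succ A]
    rw [hm.scratch_eval, add_zero, ev]
    have hm' : Mem d l k n N D B U F Z a S (s'.setR B (A ^ (e + 1))) :=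
      hm.frame (fun i hi => by simp) fun y hy => State.setR_real_ne _ _ (by omega)
    refine .setReal ?_
    set v' := (RealExpr.mul (.load (scratch 1)) (lowerExpr q)).eval (s'.setR B (A ^ (e + 1)))
      with hv'
    have ev' : v' = A' ^ (e + 1) := by
      rw [hv', RealExpr.eval, RealExpr.eval, hm'.scratch_eval, State.setR_real_ne _ _ (by omega),
        h5, lowerExpr, RealExpr.eval, hm'.barrierExpr_eval (r := r) (by simp [h1, hp]) hpN
          (by simp [h1, hr]) (by simp [h1, hx]) hxD hm'.negGammaExpr_eval,
        hm'.startExpr_eval (by simp [h1, hp]) hpN hm'.negGammaExpr_eval, pow_succ A']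
    rw [hm'.scratch_eval, ev']
    refine ⟨?_, by simp [h2], fun i hi => by simp [hi, h1], by simp, fun y hy1 hy2 => ?_, ?_, ?_⟩
    · simp [NatExpr.cost, RealExpr.cost, scratch, upperExpr, lowerExpr, barrierExpr, startExpr,
        gammaExpr, negGammaExpr, muExpr, rowsLeftExpr, coordExpr, innerExpr, restExpr, entry,
        zBase, aBase, sBase, nBase]
    · rw [State.setN_real, State.setR_real_ne _ _ hy2, State.setR_real_ne _ _ hy1, h3 y hy1 hy2]
    · rw [State.setN_real, State.setR_real_ne _ _ (by omega), State.setR_real_same]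
    · rw [State.setN_real, State.setR_real_same]
  · rintro s' t ⟨h1, h2, h3, h4, h5⟩ ht
    have hm : Mem d l k n N D B U F Z a S s' :=
      h.frame (fun i hi => h1 i (by omega)) fun y hy => h3 y (by omega) (by omega)
    refine .seq (.setReal (.assign ?_))
    simp only [RealExpr.eval, hm.scratch_eval, add_zero, h4, h5, NatExpr.eval, cell_eval]
    refine ⟨?_, fun i hi hi' => by simp [hi', h1 i hi], ?_, fun y hy1 hy2 hy3 => ?_, ?_⟩
    · simp only [NatExpr.cost, RealExpr.cost, scratch, cell_cost]
      omega
    · simp [h1, h.hd]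
    · rw [State.setN_real, State.setR_real_ne _ _ hy3, h3 y hy1 hy2]
    · rw [State.setN_real, State.setR_real_same, h3 _ (by omega) (by omega)]
      rfl

theorem wp_totalPotential {r j c : ℕ} (h : Mem d l k n N D B U F Z a S s) (hr : s.nat 9 = r)
    (hj : s.nat 10 = j) (hND : ∀ p < N, p * d + j < D + D) (hc : 2 ≤ c) (hc8 : c < 8) (q : ℚ) :
    Wp (totalPotential q c) s fun s' t => t ≤ N * (k * 1000 + 111) + 100 ∧
      (∀ i, i ≠ 11 → i ≠ 12 → i ≠ 13 → s'.nat i = s.nat i) ∧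
      (∀ y, y ≠ B → y ≠ B + 1 → y ≠ B + c → s'.real y = s.real y) ∧
      s'.real (B + c)
        = ∑ p ∈ Finset.range N, signPotential k n F Z a S r q p (U (p * d + j)) := by
  refine .seq (.setReal (.seq (.assign (.forLoop N (k * 1000 + 100) (fun p s' =>
    (∀ i, i ≠ 11 → i ≠ 12 → i ≠ 13 → s'.nat i = s.nat i) ∧ s'.nat 11 = p ∧
    s'.nat 13 = B + 8 + N + N + N + N + (p * d + j) ∧
    (∀ y, y ≠ B → y ≠ B + 1 → y ≠ B + c → s'.real y = s.real y) ∧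
    s'.real (B + c)
      = ∑ p ∈ Finset.range p, signPotential k n F Z a S r q p (U (p * d + j))) ?_ ?_ ?_ ?_))))
  · have hm : Mem d l k n N D B U F Z a S (s.setR (B + c) 0) :=
      h.frame (fun i hi => by simp) fun y hy => State.setR_real_ne _ _ (by omega)
    simp only [h.scratch_eval, RealExpr.eval, Rat.cast_zero, NatExpr.eval, hm.uBase_eval,
      cell_eval]
    refine ⟨fun i h1 h2 h3 => by simp [h1, h3], by simp, by simp [hj], fun y _ _ h3 => ?_, ?_⟩
    · simp [State.setR_real, h3]
    · simp [State.setR_real]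
  · intro i s' hI
    exact ⟨hI.2.1, by rw [hI.1 _ (by norm_num) (by norm_num) (by norm_num), h.hN]⟩
  · rintro p s' hp ⟨h1, h2, h3, h4, h5⟩
    have hm : Mem d l k n N D B U F Z a S s' :=
      h.frame (fun i hi => h1 i (by omega) (by omega) (by omega))
        fun y hy => h4 y (by omega) (by omega) (by omega)
    refine (wp_addPotential hm h2 hp (by rw [h1 _ (by norm_num) (by norm_num) (by norm_num), hr])
      h3 (hND p hp) hc hc8 q).mono ?_
    rintro s'' t ⟨g1, g2, g3, g4, g5⟩
    refine ⟨g1, by rw [g2 _ (by norm_num) (by norm_num), h2], fun i i1 i2 i3 => ?_, by simp, ?_,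
      fun y y1 y2 y3 => ?_, ?_⟩
    · simp [i1, g2 i i2 i3, h1 i i1 i2 i3]
    · simp only [State.setN_nat, g3, h3]
      norm_num
      ring
    · rw [State.setN_real, g4 y y1 y2 y3, h4 y y1 y2 y3]
    · rw [State.setN_real, g5, h5, Finset.sum_range_succ]
  · rintro s' t ⟨h1, h2, h3, h4, h5⟩ ht
    refine ⟨?_, h1, h4, h5⟩
    simp only [NatExpr.cost, RealExpr.cost, scratch, uBase, nBase, sBase, aBase, zBase, cell_cost]
    have e : N * (k * 1000 + 100 + 11) = N * (k * 1000 + 111) := by ring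
    omega

end RealRAM

/-! ### Choosing an entry and updating the tables -/

namespace RealRAM

def scaleExpr : RealExpr :=
  .div (.add (.const 1) (.div (.const 1) (.mul (.const 2) (.ofNat (cell 3))))) (.ofNat (cell 4))

/-- Update the partial inner products after the choice of an entry. -/
def updateVectors : Program :=
  .seq (assign 13 (.add uBase (cell 10))) (forLoop 11 7
    (.seq (.setReal (entry aBase)
        (.add (.load (entry aBase)) (.mul (.load (scratch 4)) coordExpr)))
      (.seq (.setReal (entry sBase) restExpr) (assign 13 (.add (cell 13) (cell 0))))))

/-- Choose the sign with the smaller potential. -/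
def chooseSign : Program :=
  .seq (totalPotential 1 2) (.seq (totalPotential (-1) 3)
    (.branch (.realLt (.load (scratch 2)) (.load (scratch 3)))
      (.setReal (scratch 4) (.const 1)) (.setReal (scratch 4) (.const (-1)))))

def chooseEntry : Program :=
  .seq chooseSign (.seq (.setReal (cell 16) (.mul (.load (scratch 4)) scaleExpr))
    (.seq (assign 16 (.add (cell 16) (.const 1))) updateVectors))

/-- Merge the inner products with a finished row. -/
def finishRow : Program :=
  forLoop 11 7
    (.seq (.setReal (entry zBase) (.add (.load (entry zBase))
        (.mul (.load (entry aBase)) (.load (entry aBase)))))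
      (.seq (.setReal (entry aBase) (.const 0))
        (.setReal (entry sBase) (.load (entry nBase)))))

def chooseMatrix : Program :=
  .seq (assign 16 outBase) (forLoop 9 5 (.seq (forLoop 10 0 chooseEntry) finishRow))

variable {d l k n N D B : ℕ} {U F Z a S : ℕ → ℝ} {s : State}

theorem Mem.set_Z (h : Mem d l k n N D B U F Z a S s) {x : ℕ} (hx : x < N) (v : ℝ) :
    Mem d l k n N D B U F (Function.update Z x v) a S (s.setR (B + 8 + x) v) where
  hd := h.hd
  hn := h.hn
  hl := h.hl
  hk := h.hk
  hD := h.hD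
  hN := h.hN
  hB := h.hB
  hZ := h.hZ.set x v
  ha := h.ha.setR v (by omega)
  hS := h.hS.setR v (by omega)
  hF := h.hF.setR v (by omega)
  hU := h.hU.setR v (by omega)

theorem Mem.set_a (h : Mem d l k n N D B U F Z a S s) {x : ℕ} (hx : x < N) (v : ℝ) :
    Mem d l k n N D B U F Z (Function.update a x v) S (s.setR (B + 8 + N + x) v) where
  hd := h.hd
  hn := h.hn
  hl := h.hl
  hk := h.hk
  hD := h.hD
  hN := h.hN
  hB := h.hB
  hZ := h.hZ.setR v (by omega)
  ha := h.ha.set x v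
  hS := h.hS.setR v (by omega)
  hF := h.hF.setR v (by omega)
  hU := h.hU.setR v (by omega)

theorem Mem.set_S (h : Mem d l k n N D B U F Z a S s) {x : ℕ} (hx : x < N) (v : ℝ) :
    Mem d l k n N D B U F Z a (Function.update S x v) (s.setR (B + 8 + N + N + x) v) where
  hd := h.hd
  hn := h.hn
  hl := h.hl
  hk := h.hk
  hD := h.hD
  hN := h.hN
  hB := h.hB
  hZ := h.hZ.setR v (by omega)
  ha := h.ha.setR v (by omega)
  hS := h.hS.set x v
  hF := h.hF.setR v (by omega)
  hU := h.hU.setR v (by omega)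

theorem Mem.congr (h : Mem d l k n N D B U F Z a S s) {Z' a' S' : ℕ → ℝ}
    (hZ : ∀ p < N, Z p = Z' p) (ha : ∀ p < N, a p = a' p) (hS : ∀ p < N, S p = S' p) :
    Mem d l k n N D B U F Z' a' S' s :=
  { h with hZ := h.hZ.congr hZ, ha := h.ha.congr ha, hS := h.hS.congr hS }

theorem Mem.setN (h : Mem d l k n N D B U F Z a S s) {c : ℕ} (hc : 9 ≤ c) (v : ℕ) :
    Mem d l k n N D B U F Z a S (s.setN c v) :=
  h.frame (fun i hi => by simp only [State.setN_nat]; rw [if_neg (by omega)]) fun _ _ => rfl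

/-- The function that agrees with `g` below `p`, and with `f` from `p` on. -/
def splice (g f : ℕ → ℝ) (p : ℕ) (i : ℕ) : ℝ := if i < p then g i else f i

theorem splice_zero (g f : ℕ → ℝ) : splice g f 0 = f := by
  ext i; simp [splice]

theorem splice_self (g f : ℕ → ℝ) (p : ℕ) : splice g f p p = f p := by
  simp [splice]

theorem update_splice (g f : ℕ → ℝ) (p : ℕ) :
    Function.update (splice g f p) p (g p) = splice g f (p + 1) := by
  ext i
  rcases lt_trichotomy i p with hi | rfl | hi
  · rw [Function.update_of_ne hi.ne, splice, splice, if_pos hi, if_pos (by omega)]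
  · simp [splice]
  · rw [Function.update_of_ne hi.ne', splice, splice, if_neg (by omega), if_neg (by omega)]

theorem splice_of_lt (g f : ℕ → ℝ) {p i : ℕ} (hi : i < p) : splice g f p i = g i := if_pos hi

/-- The update is in place, so the loop invariant says that the first `p` entries are new and the
others old; this is what `splice` expresses. -/
theorem wp_updateVectors {j : ℕ} {q : ℝ} (h : Mem d l k n N D B U F Z a S s)
    (hj : s.nat 10 = j) (hq : s.real (B + 4) = q) (hND : ∀ p < N, p * d + j < D + D) :
    Wp updateVectors s fun s' t => t ≤ N * 200 + 100 ∧
      (∀ i, i ≠ 11 → i ≠ 13 → s'.nat i = s.nat i) ∧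
      (∀ y, B + 8 + N + N + N ≤ y → s'.real y = s.real y) ∧
      Mem d l k n N D B U F Z (fun p => a p + q * U (p * d + j))
        (fun p => S p - U (p * d + j) ^ 2) s' := by
  refine .seq (.assign (.forLoop N 189 (fun p s' =>
    (∀ i, i ≠ 11 → i ≠ 13 → s'.nat i = s.nat i) ∧ s'.nat 11 = p ∧
    s'.nat 13 = B + 8 + N + N + N + N + (p * d + j) ∧ s'.real (B + 4) = q ∧
    (∀ y, B + 8 + N + N + N ≤ y → s'.real y = s.real y) ∧
    Mem d l k n N D B U F Z (splice (fun p => a p + q * U (p * d + j)) a p)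
      (splice (fun p => S p - U (p * d + j) ^ 2) S p) s') ?_ ?_ ?_ ?_))
  · refine ⟨fun i h1 h2 => by simp [h1, h2], by simp, ?_, hq, fun _ _ => rfl, ?_⟩
    · simp [NatExpr.eval, h.uBase_eval, hj]
    · rw [splice_zero, splice_zero]
      exact (h.setN (by norm_num) _).setN (by norm_num) _
  · intro i s' hI
    exact ⟨hI.2.1, hI.2.2.2.2.2.hN⟩
  · rintro p s' hp ⟨h1, h2, h3, h4, h5, h6⟩
    refine .seq (.setReal (.seq (.setReal (.assign ?_))))
    have ea : (entry aBase).eval s' = B + 8 + N + p := by rw [h6.entry_eval h2, h6.aBase_eval]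
    have ev : (RealExpr.add (.load (entry aBase)) (.mul (.load (scratch 4)) coordExpr)).eval s'
        = a p + q * U (p * d + j) := by
      simp only [RealExpr.eval, ea, h6.scratch_eval, h4, h6.coordExpr_eval h3 (hND p hp),
        h6.ha p hp, splice_self]
    rw [ea, ev]
    have h7 := h6.set_a hp (a p + q * U (p * d + j))
    rw [update_splice (fun p => a p + q * U (p * d + j)) a p] at h7
    set s₁ := s'.setR (B + 8 + N + p) (a p + q * U (p * d + j)) with hs₁
    have es : (entry sBase).eval s₁ = B + 8 + N + N + p := by
      rw [h7.entry_eval (p := p) (by simp [hs₁, h2]), h7.sBase_eval]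
    have ev' : restExpr.eval s₁ = S p - U (p * d + j) ^ 2 := by
      rw [h7.restExpr_eval (p := p) (by simp [hs₁, h2]) hp (by simp [hs₁, h3]) (hND p hp),
        splice_self]
    rw [es, ev']
    have h8 := h7.set_S hp (S p - U (p * d + j) ^ 2)
    rw [update_splice (fun p => S p - U (p * d + j) ^ 2) S p] at h8
    refine ⟨?_, by simp [hs₁, h2], fun i i1 i2 => by simp [hs₁, i1, i2, h1], by simp, ?_, ?_, ?_,
      (h8.setN (by norm_num) _).setN (by norm_num) _⟩
    · simp [NatExpr.cost, RealExpr.cost, scratch, coordExpr, restExpr, entry,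
        zBase, aBase, sBase]
    · simp only [State.setN_nat, State.setR_nat, NatExpr.eval, cell_eval, hs₁, h3, h6.hd]
      norm_num
      ring
    · rw [State.setN_real, State.setN_real, State.setR_real_ne _ _ (by omega), hs₁,
        State.setR_real_ne _ _ (by omega), h4]
    · intro y hy
      rw [State.setN_real, State.setN_real, State.setR_real_ne _ _ (by omega), hs₁,
        State.setR_real_ne _ _ (by omega), h5 y hy]
  · rintro s' t ⟨h1, h2, h3, h4, h5, h6⟩ ht
    refine ⟨?_, h1, h5, h6.congr (fun _ _ => rfl) (fun p hp => splice_of_lt _ _ hp)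
      fun p hp => splice_of_lt _ _ hp⟩
    simp only [NatExpr.cost, uBase, nBase, sBase, aBase, zBase, cell_cost]
    omega

theorem wp_finishRow (h : Mem d l k n N D B U F Z a S s) :
    Wp finishRow s fun s' t => t ≤ N * 200 + 8 ∧
      (∀ i, i ≠ 11 → s'.nat i = s.nat i) ∧
      (∀ y, B + 8 + N + N + N ≤ y → s'.real y = s.real y) ∧
      Mem d l k n N D B U F (fun p => Z p + a p ^ 2) (fun _ => 0) F s' := by
  refine .forLoop N 189 (fun p s' =>
    (∀ i, i ≠ 11 → s'.nat i = s.nat i) ∧ s'.nat 11 = p ∧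
    (∀ y, B + 8 + N + N + N ≤ y → s'.real y = s.real y) ∧
    Mem d l k n N D B U F (splice (fun p => Z p + a p ^ 2) Z p) (splice (fun _ => 0) a p)
      (splice F S p) s') ?_ ?_ ?_ ?_
  · refine ⟨fun i h1 => by simp [h1], by simp, fun _ _ => rfl, ?_⟩
    rw [splice_zero, splice_zero, splice_zero]
    exact h.setN (by norm_num) _
  · intro i s' hI
    exact ⟨hI.2.1, hI.2.2.2.hN⟩
  · rintro p s' hp ⟨h1, h2, h3, h4⟩
    refine .seq (.setReal (.seq (.setReal (.setReal ?_))))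
    have ez : (entry zBase).eval s' = B + 8 + p := by rw [h4.entry_eval h2, h4.zBase_eval]
    have ea : (entry aBase).eval s' = B + 8 + N + p := by rw [h4.entry_eval h2, h4.aBase_eval]
    have ev : (RealExpr.add (.load (entry zBase))
        (.mul (.load (entry aBase)) (.load (entry aBase)))).eval s' = Z p + a p ^ 2 := by
      simp only [RealExpr.eval, ea, ez, h4.hZ p hp, h4.ha p hp, splice_self, sq]
    rw [ez, ev]
    have h5 := h4.set_Z hp (Z p + a p ^ 2)
    rw [update_splice (fun p => Z p + a p ^ 2) Z p] at h5
    have ea' : (entry aBase).eval (s'.setR (B + 8 + p) (Z p + a p ^ 2)) = B + 8 + N + p := by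
      rw [h5.entry_eval (p := p) (by simp [h2]), h5.aBase_eval]
    have h6 := h5.set_a hp 0
    rw [update_splice (fun _ => 0) a p] at h6
    simp only [RealExpr.eval, ea', Rat.cast_zero, h6.hF p hp, h6.nBase_eval, h6.sBase_eval,
      h6.entry_eval (p := p) (by simp [h2])]
    have h7 := h6.set_S hp (F p)
    rw [update_splice F S p] at h7
    refine ⟨?_, by simp [h2], fun i i1 => by simp [i1, h1], by simp, ?_,
      h7.setN (by norm_num) _⟩
    · simp [NatExpr.cost, RealExpr.cost, entry, zBase, aBase, sBase, nBase]
    · intro y hy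
      rw [State.setN_real, State.setR_real_ne _ _ (by omega), State.setR_real_ne _ _ (by omega),
        State.setR_real_ne _ _ (by omega), h3 y hy]
  · rintro s' t ⟨h1, h2, h3, h4⟩ ht
    exact ⟨by omega, h1, h3, h4.congr (fun p hp => splice_of_lt _ _ hp)
      (fun p hp => splice_of_lt _ _ hp) fun p hp => splice_of_lt _ _ hp⟩

theorem wp_chooseSign {r j : ℕ} (h : Mem d l k n N D B U F Z a S s) (hr : s.nat 9 = r)
    (hj : s.nat 10 = j) (hND : ∀ p < N, p * d + j < D + D) :
    Wp chooseSign s fun s' t => t ≤ N * (k * 2000 + 222) + 250 ∧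
      (∀ i, i ≠ 11 → i ≠ 12 → i ≠ 13 → s'.nat i = s.nat i) ∧
      (∀ y, B + 8 ≤ y → s'.real y = s.real y) ∧
      ∃ q : ℝ, q ^ 2 = 1 ∧ s'.real (B + 4) = q ∧
        ∑ p ∈ Finset.range N, signPotential k n F Z a S r q p (U (p * d + j))
          ≤ ∑ p ∈ Finset.range N, signPotential k n F Z a S r (-q) p (U (p * d + j)) := by
  refine .seq ((wp_totalPotential h hr hj hND le_rfl (by norm_num) 1).mono ?_)
  rintro s₁ t₁ ⟨h1, h2, h3, h4⟩
  have hm₁ : Mem d l k n N D B U F Z a S s₁ :=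
    h.frame (fun i hi => h2 i (by omega) (by omega) (by omega))
      fun y hy => h3 y (by omega) (by omega) (by omega)
  refine .seq ((wp_totalPotential hm₁ (by rw [h2 _ (by norm_num) (by norm_num) (by norm_num), hr])
    (by rw [h2 _ (by norm_num) (by norm_num) (by norm_num), hj]) hND (c := 3) (by norm_num)
    (by norm_num) (-1)).mono ?_)
  rintro s₂ t₂ ⟨g1, g2, g3, g4⟩
  have hm₂ : Mem d l k n N D B U F Z a S s₂ :=
    hm₁.frame (fun i hi => g2 i (by omega) (by omega) (by omega))
      fun y hy => g3 y (by omega) (by omega) (by omega)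
  have e2 : s₂.real (B + 2) = s₁.real (B + 2) := g3 _ (by omega) (by omega) (by omega)
  rw [← e2] at h4
  simp only [Rat.cast_one, Rat.cast_neg] at h4 g4
  have hcost : (Test.realLt (.load (scratch 2)) (.load (scratch 3))).cost ≤ 20 := by
    simp [Test.cost, RealExpr.cost, scratch, NatExpr.cost]
  have hcost' : ∀ q, (scratch 4).cost + (RealExpr.const q).cost + 1 ≤ 20 := fun q => by
    simp [RealExpr.cost, scratch, NatExpr.cost]
  have hT : N * (k * 2000 + 222) = N * (k * 1000 + 111) + N * (k * 1000 + 111) := by ring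
  have frames : ∀ v : ℝ, (∀ i, i ≠ 11 → i ≠ 12 → i ≠ 13 → (s₂.setR (B + 4) v).nat i = s.nat i) ∧
      (∀ y, B + 8 ≤ y → (s₂.setR (B + 4) v).real y = s.real y) := fun v =>
    ⟨fun i i1 i2 i3 => by rw [State.setR_nat, g2 i i1 i2 i3, h2 i i1 i2 i3], fun y hy => by
      rw [State.setR_real_ne _ _ (by omega), g3 y (by omega) (by omega) (by omega),
        h3 y (by omega) (by omega) (by omega)]⟩
  refine .branch (fun hb => .setReal ?_) (fun hb => .setReal ?_) <;>
    simp only [Test.Holds, RealExpr.eval, hm₂.scratch_eval, h4, g4, not_lt] at hb ⊢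
  · have := hcost' 1
    refine ⟨by omega, (frames _).1, (frames _).2, 1, by norm_num, ?_, hb.le⟩
    rw [State.setR_real_same, Rat.cast_one]
  · have := hcost' (-1)
    refine ⟨by omega, (frames _).1, (frames _).2, -1, by norm_num, ?_, ?_⟩
    · rw [State.setR_real_same]; norm_num
    · rw [neg_neg]; exact hb

theorem wp_chooseEntry {r j P : ℕ} (h : Mem d l k n N D B U F Z a S s) (hr : s.nat 9 = r)
    (hj : s.nat 10 = j) (hND : ∀ p < N, p * d + j < D + D) (hP : s.nat 16 = P)
    (hPB : B + 8 + N + N + N + N + D + D ≤ P) :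
    Wp chooseEntry s fun s' t => t ≤ N * (k * 2000 + 500) + 500 ∧
      (∀ i, i ≠ 11 → i ≠ 12 → i ≠ 13 → i ≠ 16 → s'.nat i = s.nat i) ∧ s'.nat 16 = P + 1 ∧
      (∀ y, B + 8 + N + N + N ≤ y → y ≠ P → s'.real y = s.real y) ∧
      ∃ q : ℝ, q ^ 2 = 1 ∧ s'.real P = q * ((1 + 1 / (2 * n)) / l) ∧
        Mem d l k n N D B U F Z (fun p => a p + q * U (p * d + j))
          (fun p => S p - U (p * d + j) ^ 2) s' ∧
        ∑ p ∈ Finset.range N, signPotential k n F Z a S r q p (U (p * d + j))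
          ≤ ∑ p ∈ Finset.range N, signPotential k n F Z a S r (-q) p (U (p * d + j)) := by
  refine .seq ((wp_chooseSign h hr hj hND).mono ?_)
  rintro s₁ t₁ ⟨h1, h2, h3, q, hq, h4, h5⟩
  have hm₁ : Mem d l k n N D B U F Z a S s₁ :=
    h.frame (fun i hi => h2 i (by omega) (by omega) (by omega)) h3
  refine .seq (.setReal (.seq (.assign ?_)))
  have e16 : (cell 16).eval s₁ = P := by
    rw [cell_eval, h2 _ (by norm_num) (by norm_num) (by norm_num), hP]
  have ev : (RealExpr.mul (.load (scratch 4)) scaleExpr).eval s₁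
      = q * ((1 + 1 / (2 * n)) / l) := by
    simp [RealExpr.eval, scaleExpr, hm₁.scratch_eval, h4, hm₁.hn, hm₁.hl]
  rw [e16, ev]
  have hm₂ : Mem d l k n N D B U F Z a S
      ((s₁.setR P (q * ((1 + 1 / (2 * n)) / l))).setN 16
        (((cell 16).add (.const 1)).eval (s₁.setR P (q * ((1 + 1 / (2 * n)) / l))))) := by
    refine Mem.setN ?_ (by norm_num) _
    exact
      { hm₁ with
        hZ := hm₁.hZ.setR _ (by omega)
        ha := hm₁.ha.setR _ (by omega)
        hS := hm₁.hS.setR _ (by omega)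
        hF := hm₁.hF.setR _ (by omega)
        hU := hm₁.hU.setR _ (by omega) }
  refine (wp_updateVectors hm₂ (j := j) (q := q) ?_ ?_ hND).mono ?_
  · simp [h2, hj]
  · rw [State.setN_real, State.setR_real_ne _ _ (by omega), h4]
  · rintro s₂ t₂ ⟨g1, g2, g3, g4⟩
    refine ⟨?_, fun i i1 i2 i3 i4 => ?_, ?_, fun y hy hyP => ?_, q, hq, ?_, g4, h5⟩
    · have hc : (cell 16).cost + ((RealExpr.load (scratch 4)).mul scaleExpr).cost + 1
          + (((cell 16).add (.const 1)).cost + 2) ≤ 100 := by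
        simp [NatExpr.cost, RealExpr.cost, scaleExpr, scratch]
      have e : N * (k * 2000 + 500) = N * (k * 2000 + 222) + N * 200 + N * 78 := by ring
      omega
    · rw [g2 i i1 i3]; simp [i4, h2 i i1 i2 i3]
    · rw [g2 _ (by norm_num) (by norm_num)]
      simp [NatExpr.eval, h2, hP]
    · rw [g3 y hy, State.setN_real, State.setR_real_ne _ _ hyP, h3 y (by omega)]
    · rw [g3 _ (by omega), State.setN_real, State.setR_real_same]

end RealRAM

/-! ### The invariant of the derandomization -/

namespace RealRAM

/-- The inner product of the first `j` coordinates of the vector `p` with those of the row `r`. -/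
noncomputable def rowProd (d : ℕ) (U Y : ℕ → ℝ) (r p j : ℕ) : ℝ :=
  ∑ t ∈ Finset.range j, Y (r * d + t) * U (p * d + t)

/-- The squared length of the first `j` coordinates of the vector `p`. -/
noncomputable def sqSum (d : ℕ) (U : ℕ → ℝ) (p j : ℕ) : ℝ :=
  ∑ t ∈ Finset.range j, U (p * d + t) ^ 2

/-- The squared length of the image of the vector `p` under the first `r` rows. -/
noncomputable def rowsSq (d : ℕ) (U Y : ℕ → ℝ) (r p : ℕ) : ℝ :=
  ∑ i ∈ Finset.range r, rowProd d U Y i p d ^ 2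

theorem rowProd_congr {d : ℕ} {U Y Y' : ℕ → ℝ} {r p j : ℕ}
    (h : ∀ x < r * d + j, Y x = Y' x) : rowProd d U Y r p j = rowProd d U Y' r p j :=
  Finset.sum_congr rfl fun t ht => by
    rw [h _ (by have := Finset.mem_range.1 ht; omega)]

theorem rowsSq_congr {d : ℕ} {U Y Y' : ℕ → ℝ} {r p : ℕ}
    (h : ∀ x < r * d, Y x = Y' x) : rowsSq d U Y r p = rowsSq d U Y' r p :=
  Finset.sum_congr rfl fun i hi => by
    rw [rowProd_congr fun x hx => h x ?_]
    have h1 : i + 1 ≤ r := Finset.mem_range.1 hi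
    have h2 := Nat.mul_le_mul_right d h1
    rw [Nat.succ_mul] at h2
    omega

theorem sqSum_nonneg (d : ℕ) (U : ℕ → ℝ) (p j : ℕ) : 0 ≤ sqSum d U p j :=
  Finset.sum_nonneg fun _ _ => sq_nonneg _

theorem rowsSq_nonneg (d : ℕ) (U Y : ℕ → ℝ) (r p : ℕ) : 0 ≤ rowsSq d U Y r p :=
  Finset.sum_nonneg fun _ _ => sq_nonneg _

theorem sqSum_mono (d : ℕ) (U : ℕ → ℝ) (p : ℕ) {i j : ℕ} (h : i ≤ j) :
    sqSum d U p i ≤ sqSum d U p j :=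
  Finset.sum_le_sum_of_subset_of_nonneg (Finset.range_mono h) fun _ _ _ => sq_nonneg _

/-- The total potential after the choice of `r` rows and of `j` entries of the next one. -/
noncomputable def totalPot (d k n N : ℕ) (U Y : ℕ → ℝ) (r j : ℕ) : ℝ :=
  ∑ p ∈ Finset.range N, potential k (1 / (8 * n)) (1 / (8 * n) / (8 * k)) (sqSum d U p d)
    (rowsSq d U Y r p) (rowProd d U Y r p j) (sqSum d U p d - sqSum d U p j) (k - 1 - r)

/-- The state of the memory after the choice of `r` rows and of `j` entries of the next one. -/
def Chosen (d l k n N D B : ℕ) (U : ℕ → ℝ) (r j : ℕ) (s : State) : Prop :=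
  ∃ Y : ℕ → ℝ,
    Mem d l k n N D B U (fun p => sqSum d U p d) (rowsSq d U Y r) (fun p => rowProd d U Y r p j)
      (fun p => sqSum d U p d - sqSum d U p j) s ∧
    ArrayAt (B + 8 + N + N + N + N + D + D) (r * d + j)
      (fun x => Y x * ((1 + 1 / (2 * n)) / l)) s ∧
    s.nat 16 = B + 8 + N + N + N + N + D + D + (r * d + j) ∧ totalPot d k n N U Y r j ≤ 2 * N

variable {d l k n N D B : ℕ} {U : ℕ → ℝ} {s : State}

theorem Chosen.setN {r j : ℕ} (h : Chosen d l k n N D B U r j s) {c : ℕ} (hc : 9 ≤ c)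
    (hc' : c < 16) (v : ℕ) : Chosen d l k n N D B U r j (s.setN c v) := by
  obtain ⟨Y, h1, h2, h3, h4⟩ := h
  exact ⟨Y, h1.setN hc v, h2, by simp only [State.setN_nat]; rw [if_neg (by omega), h3], h4⟩

/-- `potential_step` with `u` replaced by `q * u`: the square of `q` is `1`, so the two values of
the sign are covered together. -/
theorem signPotential_step {n : ℕ} (hk : 0 < k) (hn : 0 < n) (Y : ℕ → ℝ) {r j : ℕ} (hr : r < k)
    (hj : j < d) (p : ℕ) {q : ℝ} (hq : q ^ 2 = 1) :
    signPotential k n (fun p => sqSum d U p d) (rowsSq d U Y r) (fun p => rowProd d U Y r p j)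
        (fun p => sqSum d U p d - sqSum d U p j) r q p (U (p * d + j)) +
      signPotential k n (fun p => sqSum d U p d) (rowsSq d U Y r) (fun p => rowProd d U Y r p j)
        (fun p => sqSum d U p d - sqSum d U p j) r (-q) p (U (p * d + j))
      ≤ 2 * potential k (1 / (8 * n)) (1 / (8 * n) / (8 * k)) (sqSum d U p d)
        (rowsSq d U Y r p) (rowProd d U Y r p j) (sqSum d U p d - sqSum d U p j) (k - 1 - r) := by
  have hn1 : (1 : ℝ) ≤ n := by exact_mod_cast hn
  have hu : (q * U (p * d + j)) ^ 2 = U (p * d + j) ^ 2 := by rw [mul_pow, hq, one_mul]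
  have hR : (0 : ℝ) ≤ k - 1 - r := by
    have : (r : ℝ) + 1 ≤ k := by exact_mod_cast hr
    linarith
  have hS : (q * U (p * d + j)) ^ 2 ≤ sqSum d U p d - sqSum d U p j := by
    have h1 := sqSum_mono d U p (i := j + 1) (j := d) hj
    rw [sqSum, Finset.sum_range_succ, ← sqSum] at h1
    rw [hu]
    linarith
  have := potential_step (u := q * U (p * d + j)) (a := rowProd d U Y r p j) hk
    (γ := 1 / (8 * n)) (by positivity) (by
      rw [div_le_div_iff₀ (by positivity) (by norm_num)]; linarith) rfl
    (sqSum_nonneg d U p d) (rowsSq_nonneg d U Y r p) hR hS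
    (by linarith [sqSum_nonneg d U p j])
  rw [hu] at this
  simpa only [signPotential, neg_mul, ← sub_eq_add_neg] using this

/-- The totals for the two signs add up to at most twice the old total, so the smaller one does not
exceed it. Only the entry `r * d + j` of `Y` changes, hence earlier sums keep their values. -/
theorem wp_chooseEntry_chosen {r j : ℕ} (hn : 0 < n) (hr : r < k) (hj : j < d)
    (hND : N * d = D + D) (h : Chosen d l k n N D B U r j s) (h9 : s.nat 9 = r)
    (h10 : s.nat 10 = j) :
    Wp chooseEntry s fun s' t => t ≤ N * (k * 2000 + 500) + 500 ∧ s'.nat 9 = r ∧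
      s'.nat 10 = j ∧ Chosen d l k n N D B U r (j + 1) s' := by
  obtain ⟨Y, hm, hout, h16, hpot⟩ := h
  have hk : 0 < k := by omega
  have hidx : ∀ p < N, p * d + j < D + D := fun p hp => by
    have h2 := Nat.mul_le_mul_right d (Nat.succ_le_of_lt hp)
    rw [Nat.succ_mul] at h2
    omega
  refine (wp_chooseEntry hm h9 h10 hidx h16 (by omega)).mono ?_
  rintro s' t ⟨h1, h2, h3, h4, q, hq, h5, h6, h7⟩
  refine ⟨h1, by rw [h2 _ (by norm_num) (by norm_num) (by norm_num) (by norm_num), h9],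
    by rw [h2 _ (by norm_num) (by norm_num) (by norm_num) (by norm_num), h10],
    Function.update Y (r * d + j) q, ?_⟩
  set Y' := Function.update Y (r * d + j) q with hY'
  have hY : ∀ x < r * d + j, Y x = Y' x := fun x hx => by
    rw [hY', Function.update_of_ne hx.ne]
  have hYq : Y' (r * d + j) = q := by simp [hY']
  have eZ : ∀ p, rowsSq d U Y r p = rowsSq d U Y' r p := fun p =>
    rowsSq_congr fun x hx => hY x (by omega)
  have ea : ∀ p, rowProd d U Y r p j + q * U (p * d + j) = rowProd d U Y' r p (j + 1) := fun p => by
    rw [rowProd_congr hY, rowProd, rowProd, Finset.sum_range_succ, hYq]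
  have eS : ∀ p, sqSum d U p d - sqSum d U p j - U (p * d + j) ^ 2
      = sqSum d U p d - sqSum d U p (j + 1) := fun p => by
    rw [sqSum.eq_def d U p (j + 1), Finset.sum_range_succ, ← sqSum]; ring
  refine ⟨h6.congr (fun p _ => eZ p) (fun p _ => ea p) fun p _ => eS p, ?_, ?_, ?_⟩
  · intro x hx
    rcases Nat.lt_or_ge x (r * d + j) with hx' | hx'
    · rw [h4 _ (by omega) (by omega), hout x hx']
      simp only [hY x hx']
    · obtain rfl : x = r * d + j := by omega
      rw [h5]
      simp only [hYq]
  · rw [h3]; omega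
  · refine le_trans ?_ hpot
    have hsum := Finset.sum_le_sum fun p (_ : p ∈ Finset.range N) =>
      signPotential_step (U := U) hk hn Y hr hj p hq
    rw [Finset.sum_add_distrib, ← Finset.mul_sum] at hsum
    have e : totalPot d k n N U Y' r (j + 1) = ∑ p ∈ Finset.range N,
        signPotential k n (fun p => sqSum d U p d) (rowsSq d U Y r) (fun p => rowProd d U Y r p j)
          (fun p => sqSum d U p d - sqSum d U p j) r q p (U (p * d + j)) := by
      unfold totalPot signPotential
      exact Finset.sum_congr rfl fun p _ => by rw [← eZ, ← ea, ← eS]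
    rw [e]
    unfold totalPot
    linarith

/-- The position `(r, d)` becomes `(r + 1, 0)`; by `potential_new_row` this is only bookkeeping for
the potential. -/
theorem wp_finishRow_chosen {r : ℕ} (h : Chosen d l k n N D B U r d s) :
    Wp finishRow s fun s' t => t ≤ N * 200 + 8 ∧ s'.nat 9 = s.nat 9 ∧
      Chosen d l k n N D B U (r + 1) 0 s' := by
  obtain ⟨Y, hm, hout, h16, hpot⟩ := h
  refine (wp_finishRow hm).mono ?_
  rintro s' t ⟨h1, h2, h3, h4⟩
  refine ⟨h1, h2 _ (by norm_num), Y, h4.congr (fun p _ => ?_) (fun p _ => ?_) (fun p _ => ?_),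
    fun x hx => ?_, ?_, ?_⟩
  · rw [rowsSq, rowsSq, Finset.sum_range_succ]
  · simp [rowProd]
  · simp [sqSum]
  · rw [h3 _ (by omega), hout x (by rw [Nat.succ_mul] at hx; omega)]
  · rw [h2 _ (by norm_num), h16]; ring
  · refine le_trans (le_of_eq ?_) hpot
    refine Finset.sum_congr rfl fun p _ => ?_
    rw [sub_self, ← potential_new_row]
    congr 1
    · rw [rowsSq, rowsSq, Finset.sum_range_succ]
    · simp [sqSum]
    · push_cast; ring

theorem wp_chooseMatrix (hn : 0 < n) (hND : N * d = D + D)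
    (h : Mem d l k n N D B U (fun p => sqSum d U p d) (fun _ => 0) (fun _ => 0)
      (fun p => sqSum d U p d) s) :
    Wp chooseMatrix s fun s' t =>
      t ≤ k * (d * (N * (k * 2000 + 500) + 511) + N * 200 + 50) + 50 ∧
      Chosen d l k n N D B U k 0 s' := by
  refine .seq (.assign (.forLoop k (d * (N * (k * 2000 + 500) + 511) + N * 200 + 16)
    (fun r s' => s'.nat 9 = r ∧ Chosen d l k n N D B U r 0 s') ?_ ?_ ?_ ?_))
  · refine ⟨by simp, Chosen.setN ?_ (by norm_num) (by norm_num) _⟩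
    refine ⟨fun _ => 0, ?_, ?_, ?_, ?_⟩
    · have : Mem d l k n N D B U (fun p => sqSum d U p d) (rowsSq d U (fun _ => 0) 0)
          (fun p => rowProd d U (fun _ => 0) 0 p 0)
          (fun p => sqSum d U p d - sqSum d U p 0) s :=
        h.congr (fun p _ => by simp [rowsSq]) (fun p _ => by simp [rowProd])
          (fun p _ => by simp [sqSum])
      exact this.setN (by norm_num) _
    · intro x hx; simp at hx
    · simp [h.outBase_eval]
    · have e : ∀ p, potential k (1 / (8 * n)) (1 / (8 * n) / (8 * k)) (sqSum d U p d)
          (rowsSq d U (fun _ => 0) 0 p) (rowProd d U (fun _ => 0) 0 p 0)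
          (sqSum d U p d - sqSum d U p 0) (k - 1 - (0 : ℕ)) ≤ 2 := fun p => by
        have h1 : rowsSq d U (fun _ => 0) 0 p = 0 := by simp [rowsSq]
        have h2 : rowProd d U (fun _ => 0) 0 p 0 = 0 := by simp [rowProd]
        have h3 : sqSum d U p 0 = 0 := by simp [sqSum]
        rw [h1, h2, h3, Nat.cast_zero, sub_zero, sub_zero]
        exact potential_start
      refine (Finset.sum_le_card_nsmul _ _ _ fun p _ => e p).trans_eq ?_
      simp [mul_comm]
  · rintro i s' ⟨h1, Y, h2, -⟩
    exact ⟨h1, h2.hk⟩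
  · rintro r s' hr ⟨h1, h2⟩
    refine .seq (.forLoop d (N * (k * 2000 + 500) + 500) (fun j s' => s'.nat 9 = r ∧
      s'.nat 10 = j ∧ Chosen d l k n N D B U r j s') ?_ ?_ ?_ ?_)
    · exact ⟨by simp [h1], by simp, h2.setN (by norm_num) (by norm_num) _⟩
    · rintro i s' ⟨-, h3, Y, h4, -⟩
      exact ⟨h3, h4.hd⟩
    · rintro j s' hj ⟨h3, h4, h5⟩
      refine (wp_chooseEntry_chosen hn hr hj hND h5 h3 h4).mono ?_
      rintro s'' t ⟨g1, g2, g3, g4⟩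
      exact ⟨g1, g3, by simp [g2], by simp, g4.setN (by norm_num) (by norm_num) _⟩
    · rintro s₁ t₁ ⟨h3, h4, h5⟩ ht
      refine (wp_finishRow_chosen h5).mono ?_
      rintro s₂ t₂ ⟨g1, g2, g3⟩
      refine ⟨?_, by rw [g2, h3], by simp, g3.setN (by norm_num) (by norm_num) _⟩
      have e : d * (N * (k * 2000 + 500) + 500 + 11) = d * (N * (k * 2000 + 500) + 511) := by ring
      omega
  · rintro s' t ⟨h1, h2⟩ ht
    refine ⟨?_, h2⟩
    have e : k * (d * (N * (k * 2000 + 500) + 511) + N * 200 + 16 + 11) + k * 23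
        = k * (d * (N * (k * 2000 + 500) + 511) + N * 200 + 50) := by ring
    have e2 : outBase.cost + 2 ≤ 40 := by
      simp [NatExpr.cost, outBase, uBase, nBase, sBase, aBase, zBase]
    omega

end RealRAM

/-! ### Preprocessing: sizes, sums and differences, and norms -/

namespace RealRAM

def computeLog : Program :=
  .seq (assign 16 (.const 1)) (.loop (.natLt (cell 16) (cell 1))
    (.seq (assign 16 (.add (cell 16) (cell 16))) (assign 2 (.add (cell 2) (.const 1)))))

/-- Counting up until `n * ε ≥ 1` yields `⌈1 / ε⌉` without rounding a real number. -/
def computeInv : Program :=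
  .loop (.realLt (.mul (.ofNat (cell 3)) (.load (.const 0))) (.const 1))
    (assign 3 (.add (cell 3) (.const 1)))

/-- Natural numbers cannot be multiplied in one step, so the square is maintained through `(l + 1)²
= l² + 2 l + 1`. -/
def computeRows : Program :=
  .loop (.realLt (.ofNat (cell 5)) (.mul (.const 5120) (.mul (.ofNat (cell 2))
      (.mul (.ofNat (cell 3)) (.ofNat (cell 3))))))
    (.seq (assign 5 (.add (.add (cell 5) (.add (cell 4) (cell 4))) (.const 1)))
      (assign 4 (.add (cell 4) (.const 1))))

/-- Add the product of the cells `a` and `b` to the cell `c`. -/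
def addMul (c a b : ℕ) : Program := forLoop 9 a (assign c (.add (cell c) (cell b)))

def computeSizes : Program :=
  .seq (addMul 8 1 0) (.seq (assign 8 (.add (cell 8) (.const 1))) (.seq (addMul 7 1 1)
    (.seq (addMul 6 7 0) (assign 7 (.add (cell 7) (cell 7))))))

/-- Compute the sums and the differences of the vectors. -/
def computePairs : Program :=
  .seq (assign 13 uBase) (.seq (assign 14 (.const 1)) (forLoop 9 1
    (.seq (assign 15 (.const 1)) (.seq (forLoop 10 1
      (.seq (forLoop 11 0
        (.seq (.setReal (cell 13) (.add (.load (.add (cell 14) (cell 11)))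
            (.load (.add (cell 15) (cell 11)))))
          (.seq (.setReal (.add (cell 13) (cell 6)) (.sub (.load (.add (cell 14) (cell 11)))
              (.load (.add (cell 15) (cell 11)))))
            (assign 13 (.add (cell 13) (.const 1))))))
        (assign 15 (.add (cell 15) (cell 0)))))
      (assign 14 (.add (cell 14) (cell 0)))))))

def computeNorms : Program :=
  .seq (assign 13 uBase) (forLoop 11 7
    (.seq (forLoop 10 0
      (.seq (.setReal (entry nBase) (.add (.load (entry nBase)) (.mul coordExpr coordExpr)))
        (assign 13 (.add (cell 13) (.const 1)))))
      (.setReal (entry sBase) (.load (entry nBase)))))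

theorem wp_computeLog {s : State} (h2 : s.nat 2 = 0) :
    Wp computeLog s fun s' t => t ≤ Nat.clog 2 (s.nat 1) * 30 + 30 ∧ s'.real = s.real ∧
      s'.nat 2 = Nat.clog 2 (s.nat 1) ∧ ∀ i, i ≠ 2 → i ≠ 16 → s'.nat i = s.nat i := by
  refine .seq (.assign (.loop (Nat.clog 2 (s.nat 1)) 20 (fun i s' => s'.real = s.real ∧
    s'.nat 2 = i ∧ s'.nat 16 = 2 ^ i ∧ ∀ i, i ≠ 2 → i ≠ 16 → s'.nat i = s.nat i) ?_ ?_ ?_ ?_))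
  · exact ⟨rfl, by simp [h2], by simp [NatExpr.eval], fun i _ h => by simp [h]⟩
  · rintro i s' ⟨-, -, h3, h4⟩
    simp only [Test.Holds, cell_eval, h3, h4 1 (by norm_num) (by norm_num)]
    exact (Nat.lt_clog_iff_pow_lt one_lt_two).symm
  · rintro i s' - ⟨h1, h3, h4, h5⟩
    refine .seq (.assign (.assign ?_))
    simp only [NatExpr.eval, cell_eval, NatExpr.cost, cell_cost]
    exact ⟨by norm_num, h1, by simp [h3], by simp [h4, pow_succ, mul_two],
      fun i i1 i2 => by simp [i1, i2, h5]⟩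
  · rintro s' t ⟨h1, h3, h4, h5⟩ ht
    refine ⟨?_, h1, h3, h5⟩
    simp only [NatExpr.cost, Test.cost, cell_cost] at ht ⊢
    omega

theorem wp_computeInv {s : State} {ε : ℝ} (hε : 0 < ε) (h0 : s.real 0 = ε) (h3 : s.nat 3 = 0) :
    Wp computeInv s fun s' t => t ≤ ⌈1 / ε⌉₊ * 30 + 30 ∧ s'.real = s.real ∧
      s'.nat 3 = ⌈1 / ε⌉₊ ∧ ∀ i, i ≠ 3 → s'.nat i = s.nat i := by
  refine .loop ⌈1 / ε⌉₊ 20 (fun i s' => s'.real = s.real ∧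
    s'.nat 3 = i ∧ ∀ i, i ≠ 3 → s'.nat i = s.nat i) ?_ ?_ ?_ ?_
  · exact ⟨rfl, h3, fun i _ => rfl⟩
  · rintro i s' ⟨h1, h2, -⟩
    simp only [Test.Holds, RealExpr.eval, NatExpr.eval, cell_eval, h1, h2, h0, Rat.cast_one]
    rw [Nat.lt_ceil, lt_div_iff₀ hε]
  · rintro i s' - ⟨h1, h2, h4⟩
    refine .assign ?_
    simp only [NatExpr.eval, cell_eval, NatExpr.cost, cell_cost]
    exact ⟨by norm_num, h1, by simp [h2], fun i i1 => by simp [i1, h4]⟩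
  · rintro s' t ⟨h1, h2, h4⟩ ht
    refine ⟨?_, h1, h2, h4⟩
    simp only [NatExpr.cost, RealExpr.cost, Test.cost, cell_cost] at ht ⊢
    omega

/-- The square root of the number of rows. -/
def rowsRoot (L n : ℕ) : ℕ := Nat.sqrt (5120 * (L * (n * n)) - 1) + 1

/-- `rowsRoot` is the least `l` with `l² ≥ 5120 L n²`; the shift by one inside the root rounds
upwards. -/
theorem lt_rowsRoot {L n : ℕ} (hL : 0 < L) (hn : 0 < n) (i : ℕ) :
    i < rowsRoot L n ↔ i * i < 5120 * (L * (n * n)) := by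
  have h : 0 < L * (n * n) := by positivity
  rw [rowsRoot, Nat.lt_succ_iff, Nat.le_sqrt]
  omega

theorem wp_computeRows {s : State} {L n : ℕ} (hL : 0 < L) (hn : 0 < n) (h2 : s.nat 2 = L)
    (h3 : s.nat 3 = n) (h4 : s.nat 4 = 0) (h5 : s.nat 5 = 0) :
    Wp computeRows s fun s' t => t ≤ rowsRoot L n * 50 + 30 ∧ s'.real = s.real ∧
      s'.nat 4 = rowsRoot L n ∧ s'.nat 5 = rowsRoot L n * rowsRoot L n ∧
      ∀ i, i ≠ 4 → i ≠ 5 → s'.nat i = s.nat i := by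
  refine .loop (rowsRoot L n) 30 (fun i s' => s'.real = s.real ∧
    s'.nat 4 = i ∧ s'.nat 5 = i * i ∧ ∀ i, i ≠ 4 → i ≠ 5 → s'.nat i = s.nat i) ?_ ?_ ?_ ?_
  · exact ⟨rfl, h4, by simp [h5], fun i _ _ => rfl⟩
  · rintro i s' ⟨-, h6, h7, h8⟩
    simp only [Test.Holds, RealExpr.eval, cell_eval, h7, h8 2 (by norm_num) (by norm_num),
      h8 3 (by norm_num) (by norm_num), h2, h3]
    rw [lt_rowsRoot hL hn, ← Nat.cast_lt (α := ℝ)]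
    push_cast
    rfl
  · rintro i s' - ⟨h1, h6, h7, h8⟩
    refine .seq (.assign (.assign ?_))
    simp only [NatExpr.eval, cell_eval, NatExpr.cost, cell_cost]
    refine ⟨by norm_num, h1, by simp [h6], ?_, fun i i1 i2 => by simp [i1, i2, h8]⟩
    simp [h6, h7]
    ring
  · rintro s' t ⟨h1, h6, h7, h8⟩ ht
    refine ⟨?_, h1, h6, h7, h8⟩
    simp only [RealExpr.cost, Test.cost, cell_cost] at ht ⊢
    omega

theorem wp_addMul {s : State} {c a b : ℕ} (hc : c ≠ 9) (ha : a ≠ 9) (hb : b ≠ 9) (hca : c ≠ a)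
    (hcb : c ≠ b) :
    Wp (addMul c a b) s fun s' t => t ≤ s.nat a * 30 + 30 ∧ s'.real = s.real ∧
      s'.nat c = s.nat c + s.nat a * s.nat b ∧ ∀ i, i ≠ c → i ≠ 9 → s'.nat i = s.nat i := by
  refine .forLoop (s.nat a) 10 (fun i s' => s'.real = s.real ∧ s'.nat 9 = i ∧
    s'.nat c = s.nat c + i * s.nat b ∧ ∀ i, i ≠ c → i ≠ 9 → s'.nat i = s.nat i) ?_ ?_ ?_ ?_
  · exact ⟨rfl, by simp, by simp [hc], fun i _ h => by simp [h]⟩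
  · rintro i s' ⟨-, h1, -, h2⟩
    exact ⟨h1, h2 a hca.symm ha⟩
  · rintro i s' - ⟨h1, h2, h3, h4⟩
    refine .assign ?_
    simp only [NatExpr.eval, cell_eval, NatExpr.cost, cell_cost]
    refine ⟨by norm_num, by simp [hc.symm, h2], h1, by simp, ?_, fun i i1 i2 => by simp [i1, i2, h4]⟩
    simp [hc, h3, h4 b hcb.symm hb]
    ring
  · rintro s' t ⟨h1, h2, h3, h4⟩ ht
    exact ⟨by omega, h1, h3, h4⟩

theorem wp_computeSizes {s : State} {d m : ℕ} (h0 : s.nat 0 = d) (h1 : s.nat 1 = m)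
    (h6 : s.nat 6 = 0) (h7 : s.nat 7 = 0) (h8 : s.nat 8 = 0) :
    Wp computeSizes s fun s' t => t ≤ m * 60 + m * m * 30 + 120 ∧ s'.real = s.real ∧
      s'.nat 6 = m * m * d ∧ s'.nat 7 = m * m + m * m ∧ s'.nat 8 = m * d + 1 ∧
      ∀ i, i < 6 → s'.nat i = s.nat i := by
  refine .seq ((wp_addMul (by norm_num) (by norm_num) (by norm_num) (by norm_num)
    (by norm_num)).mono ?_)
  rintro s₁ t₁ ⟨a1, a2, a3, a4⟩
  rw [h0, h1, h8, zero_add] at a3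
  refine .seq (.assign (.seq ((wp_addMul (by norm_num) (by norm_num) (by norm_num) (by norm_num)
    (by norm_num)).mono ?_)))
  rintro s₂ t₂ ⟨b1, b2, b3, b4⟩
  simp [a3, a4, h7, h1, NatExpr.eval] at b1 b3 b4
  refine .seq ((wp_addMul (by norm_num) (by norm_num) (by norm_num) (by norm_num)
    (by norm_num)).mono ?_)
  rintro s₃ t₃ ⟨c1, c2, c3, c4⟩
  simp [a4, b3, b4, h6, h0] at c1 c3
  refine .assign ⟨?_, ?_, ?_, ?_, ?_, ?_⟩
  · rw [h1] at a1
    simp only [NatExpr.cost, cell_cost]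
    omega
  · rw [State.setN_real, c2, b2, State.setN_real, a2]
  · simp [c3]
  · simp [NatExpr.eval, c4, b3]
  · simp [c4, b4]
  · intro i hi
    simp only [State.setN_nat]
    rw [if_neg (by omega), c4 i (by omega) (by omega), b4 i (by omega) (by omega),
      if_neg (by omega), a4 i (by omega) (by omega)]

/-- The coordinates of all sums and differences of the vectors with the coordinates `V`. -/
noncomputable def pairCoord (m d : ℕ) (V : ℕ → ℝ) (x : ℕ) : ℝ :=
  if x < m * m * d then V (x / d / m * d + x % d) + V (x / d % m * d + x % d)
  else V ((x - m * m * d) / d / m * d + (x - m * m * d) % d) -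
    V ((x - m * m * d) / d % m * d + (x - m * m * d) % d)

theorem pair_index_lt {m d i j t : ℕ} (hi : i < m) (hj : j < m) (ht : t < d) :
    (i * m + j) * d + t < m * m * d := by
  have h1 : i * m + j + 1 ≤ m * m := by
    have := Nat.mul_le_mul_right m (Nat.succ_le_of_lt hi)
    rw [Nat.succ_mul] at this
    omega
  have h2 := Nat.mul_le_mul_right d h1
  rw [Nat.succ_mul] at h2
  omega

theorem pair_index_decode {m d i j t : ℕ} (hj : j < m) (ht : t < d) :
    ((i * m + j) * d + t) / d / m = i ∧ ((i * m + j) * d + t) / d % m = j ∧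
      ((i * m + j) * d + t) % d = t := by
  have h1 : ((i * m + j) * d + t) / d = i * m + j := by
    rw [Nat.add_comm, Nat.add_mul_div_right _ _ (by omega), Nat.div_eq_of_lt ht, zero_add]
  refine ⟨?_, ?_, ?_⟩
  · rw [h1, Nat.add_comm, Nat.add_mul_div_right _ _ (by omega), Nat.div_eq_of_lt hj, zero_add]
  · rw [h1, Nat.add_comm, Nat.add_mul_mod_self_right, Nat.mod_eq_of_lt hj]
  · rw [Nat.add_comm, Nat.add_mul_mod_self_right, Nat.mod_eq_of_lt ht]

theorem pairCoord_add {m d i j t : ℕ} (V : ℕ → ℝ) (hi : i < m) (hj : j < m) (ht : t < d) :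
    pairCoord m d V ((i * m + j) * d + t) = V (i * d + t) + V (j * d + t) := by
  obtain ⟨h1, h2, h3⟩ := pair_index_decode (i := i) hj ht
  rw [pairCoord, if_pos (pair_index_lt hi hj ht), h1, h2, h3]

theorem pairCoord_sub {m d i j t : ℕ} (V : ℕ → ℝ) (hj : j < m) (ht : t < d) :
    pairCoord m d V (m * m * d + ((i * m + j) * d + t)) = V (i * d + t) - V (j * d + t) := by
  obtain ⟨h1, h2, h3⟩ := pair_index_decode (i := i) hj ht
  rw [pairCoord, if_neg (by omega), Nat.add_sub_cancel_left, h1, h2, h3]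

/-- The memory after `x` steps of the computation of the sums and differences. -/
structure Pairs (m d b : ℕ) (V : ℕ → ℝ) (s : State) (x : ℕ) (s' : State) : Prop where
  nat : ∀ c < 9, s'.nat c = s.nat c
  ptr : s'.nat 13 = b + x
  real : ∀ y < b, s'.real y = s.real y
  sum : ArrayAt b x (pairCoord m d V) s'
  diff : ArrayAt (b + m * m * d) x (fun y => pairCoord m d V (m * m * d + y)) s'

theorem Pairs.setN {m d b x : ℕ} {V : ℕ → ℝ} {s s' : State} (h : Pairs m d b V s x s') {c : ℕ}
    (hc : 9 ≤ c) (hc' : c ≠ 13) (v : ℕ) : Pairs m d b V s x (s'.setN c v) where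
  nat i hi := by simp only [State.setN_nat]; rw [if_neg (by omega), h.nat i hi]
  ptr := by simp only [State.setN_nat]; rw [if_neg (by omega), h.ptr]
  real := h.real
  sum := h.sum
  diff := h.diff

/-- Cells `14` and `15` point to the two input vectors and cell `13` to the next sum; the matching
difference lies `m * m * d` cells further on. All writes are at or above `b`, so the input below
stays intact. -/
theorem wp_computePairs {s : State} {m d : ℕ} {V : ℕ → ℝ} (h0 : s.nat 0 = d) (h1 : s.nat 1 = m)
    (h6 : s.nat 6 = m * m * d) (hV : ArrayAt 1 (m * d) V s) (hb : m * d + 1 ≤ uBase.eval s) :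
    Wp computePairs s fun s' t => t ≤ m * (m * (d * 100 + 100) + 100) + 100 ∧
      (∀ c < 9, s'.nat c = s.nat c) ∧ (∀ y < uBase.eval s, s'.real y = s.real y) ∧
      ArrayAt (uBase.eval s) (m * m * d + m * m * d) (pairCoord m d V) s' := by
  set b := uBase.eval s with hbdef
  refine .seq (.assign (.seq (.assign (.forLoop m (m * (d * 100 + 50) + 50) (fun i s' =>
    Pairs m d b V s (i * m * d) s' ∧ s'.nat 14 = 1 + i * d ∧ s'.nat 9 = i) ?_ ?_ ?_ ?_))))
  · refine ⟨?_, by simp [NatExpr.eval], by simp⟩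
    refine ((?_ : Pairs m d b V s (0 * m * d) (s.setN 13 b)).setN (by norm_num) (by norm_num)
      _).setN (by norm_num) (by norm_num) _
    refine ⟨fun c hc => ?_, by simp, fun _ _ => rfl, fun x hx => ?_, fun x hx => ?_⟩
    · simp only [State.setN_nat]; rw [if_neg (by omega)]
    · simp at hx
    · simp at hx
  · rintro i s' ⟨h2, -, h3⟩
    exact ⟨h3, by rw [h2.nat 1 (by norm_num), h1]⟩
  · rintro i s₁ hi ⟨hp₁, h14, h9⟩
    refine .seq (.assign (.seq (.forLoop m (d * 100 + 30) (fun j s' =>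
      Pairs m d b V s ((i * m + j) * d) s' ∧ s'.nat 14 = 1 + i * d ∧ s'.nat 9 = i ∧
        s'.nat 15 = 1 + j * d ∧ s'.nat 10 = j) ?_ ?_ ?_ ?_)))
    · exact ⟨(hp₁.setN (by norm_num) (by norm_num) _).setN (by norm_num) (by norm_num) _,
        by simp [h14], by simp [h9], by simp [NatExpr.eval], by simp⟩
    · rintro j s' ⟨h2, -, -, -, h3⟩
      exact ⟨h3, by rw [h2.nat 1 (by norm_num), h1]⟩
    · rintro j s₂ hj ⟨hp₂, g14, g9, g15, g10⟩
      refine .seq (.forLoop d 50 (fun t s' =>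
        Pairs m d b V s ((i * m + j) * d + t) s' ∧ s'.nat 14 = 1 + i * d ∧ s'.nat 9 = i ∧
          s'.nat 15 = 1 + j * d ∧ s'.nat 10 = j ∧ s'.nat 11 = t) ?_ ?_ ?_ ?_)
      · exact ⟨hp₂.setN (by norm_num) (by norm_num) _, by simp [g14], by simp [g9],
          by simp [g15], by simp [g10], by simp⟩
      · rintro t s' ⟨h2, -, -, -, -, h3⟩
        exact ⟨h3, by rw [h2.nat 0 (by norm_num), h0]⟩
      · rintro t s₃ ht ⟨hp, f14, f9, f15, f10, f11⟩
        set x := (i * m + j) * d + t with hx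
        have hxD : x < m * m * d := pair_index_lt hi hj ht
        have hread : ∀ i < m, ∀ y, (y = 1 + i * d + t) → y < b ∧ s.real y = V (i * d + t) := by
          rintro i hi y rfl
          have h2 := Nat.mul_le_mul_right d (Nat.succ_le_of_lt hi)
          rw [Nat.succ_mul] at h2
          exact ⟨by omega, by rw [add_assoc]; exact hV _ (by omega)⟩
        obtain ⟨ri, ri'⟩ := hread i hi _ rfl
        obtain ⟨rj, rj'⟩ := hread j hj _ rfl
        refine .seq (.setReal (.seq (.setReal (.assign ?_))))
        simp only [RealExpr.eval, NatExpr.eval, cell_eval, State.setR_nat, f14, f15, f11, hp.ptr,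
          hp.nat 6 (by norm_num), h6]
        rw [State.setR_real_ne _ _ (by omega), State.setR_real_ne _ _ (by omega),
          hp.real _ ri, hp.real _ rj, ri', rj', ← pairCoord_add V hi hj ht,
          ← pairCoord_sub V hj ht, ← hx]
        refine ⟨?_, by simp [f11], ⟨fun c hc => ?_, ?_, fun y hy => ?_, ?_, ?_⟩,
          by simp [f14], by simp [f9], by simp [f15], by simp [f10], by simp⟩
        · simp [NatExpr.cost, RealExpr.cost]
        · simp only [State.setN_nat, State.setR_nat]
          rw [if_neg (by omega), if_neg (by omega), hp.nat c hc]
        · simp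
          omega
        · rw [State.setN_real, State.setN_real, State.setR_real_ne _ _ (by omega),
            State.setR_real_ne _ _ (by omega), hp.real y hy]
        · have := (hp.sum.push).setR (a := b + x + m * m * d)
            (pairCoord m d V (m * m * d + x)) (by omega)
          exact this
        · have := (hp.diff.setR (a := b + x) (pairCoord m d V x) (by omega)).push
          rw [add_right_comm b] at this
          exact this
      · rintro s₃ t ⟨hp, f14, f9, f15, f10, f11⟩ ht
        refine .assign ?_
        simp only [NatExpr.eval, cell_eval, NatExpr.cost, cell_cost]
        refine ⟨by omega, by simp [f10], ?_, by simp [f14], by simp [f9], ?_, by simp⟩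
        · have := (hp.setN (c := 15) (by norm_num) (by norm_num) (s₃.nat 15 + s₃.nat 0)).setN
            (c := 10) (by norm_num) (by norm_num) (j + 1)
          convert this using 1
          ring
        · simp [f15, hp.nat 0, h0]
          ring
    · rintro s₂ t ⟨hp, f14, f9, f15, f10⟩ ht
      refine .assign ?_
      simp only [NatExpr.eval, cell_eval, NatExpr.cost, cell_cost]
      have e : m * (d * 100 + 50) = m * (d * 100 + 30 + 11) + m * 9 := by ring
      refine ⟨by omega, by simp [f9], ?_, ?_, by simp⟩
      · have := (hp.setN (c := 14) (by norm_num) (by norm_num) (s₂.nat 14 + s₂.nat 0)).setN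
          (c := 9) (by norm_num) (by norm_num) (i + 1)
        convert this using 1
        ring
      · simp [f14, hp.nat 0, h0]
        ring
  · rintro s' t ⟨hp, -, -⟩ ht
    refine ⟨?_, hp.nat, hp.real, fun x hx => ?_⟩
    · simp only [NatExpr.cost, uBase, nBase, sBase, aBase, zBase, cell_cost]
      have e : m * (m * (d * 100 + 100) + 100)
          = m * (m * (d * 100 + 50) + 50 + 11) + m * (m * 50 + 39) := by ring
      omega
    · rcases Nat.lt_or_ge x (m * m * d) with h | h
      · exact hp.sum x h
      · obtain ⟨y, rfl⟩ := Nat.exists_eq_add_of_le h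
        rw [← add_assoc]
        exact hp.diff y (by omega)

variable {d l k n N D B : ℕ} {U F Z a S : ℕ → ℝ} {s : State}

theorem Mem.set_F (h : Mem d l k n N D B U F Z a S s) {x : ℕ} (hx : x < N) (v : ℝ) :
    Mem d l k n N D B U (Function.update F x v) Z a S (s.setR (B + 8 + N + N + N + x) v) where
  hd := h.hd
  hn := h.hn
  hl := h.hl
  hk := h.hk
  hD := h.hD
  hN := h.hN
  hB := h.hB
  hZ := h.hZ.setR v (by omega)
  ha := h.ha.setR v (by omega)
  hS := h.hS.setR v (by omega)
  hF := h.hF.set x v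
  hU := h.hU.setR v (by omega)

theorem wp_computeNorms (hND : N * d = D + D)
    (h : Mem d l k n N D B U (fun _ => 0) Z a S s) :
    Wp computeNorms s fun s' t => t ≤ N * (d * 100 + 100) + 100 ∧
      Mem d l k n N D B U (fun p => sqSum d U p d) Z a (fun p => sqSum d U p d) s' := by
  refine .seq (.assign (.forLoop N (d * 100 + 50) (fun p s' => s'.nat 11 = p ∧
    s'.nat 13 = B + 8 + N + N + N + N + p * d ∧
    Mem d l k n N D B U (splice (fun p => sqSum d U p d) (fun _ => 0) p) Z a
      (splice (fun p => sqSum d U p d) S p) s') ?_ ?_ ?_ ?_))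
  · refine ⟨by simp, by simp [h.uBase_eval], ?_⟩
    rw [splice_zero, splice_zero]
    exact (h.setN (by norm_num) _).setN (by norm_num) _
  · rintro p s' ⟨h1, -, h2⟩
    exact ⟨h1, h2.hN⟩
  · rintro p s₁ hp ⟨h11, h13, hm⟩
    refine .seq (.forLoop d 50 (fun t s' => s'.nat 11 = p ∧ s'.nat 10 = t ∧
      s'.nat 13 = B + 8 + N + N + N + N + (p * d + t) ∧
      Mem d l k n N D B U (Function.update (splice (fun p => sqSum d U p d) (fun _ => 0) p) p
        (sqSum d U p t)) Z a (splice (fun p => sqSum d U p d) S p) s') ?_ ?_ ?_ ?_)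
    · refine ⟨by simp [h11], by simp, by simp [h13], ?_⟩
      have e : Function.update (splice (fun p => sqSum d U p d) (fun _ => 0) p) p (sqSum d U p 0)
          = splice (fun p => sqSum d U p d) (fun _ => 0) p := by
        rw [Function.update_eq_self_iff, splice_self, sqSum, Finset.sum_range_zero]
      rw [e]
      exact hm.setN (by norm_num) _
    · rintro t s' ⟨-, h1, -, h2⟩
      exact ⟨h1, h2.hd⟩
    · rintro t s₂ ht ⟨g11, g10, g13, hm₂⟩
      have hidx : p * d + t < D + D := by
        have h2 := Nat.mul_le_mul_right d (Nat.succ_le_of_lt hp)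
        rw [Nat.succ_mul] at h2
        omega
      refine .seq (.setReal (.assign ?_))
      have en : (entry nBase).eval s₂ = B + 8 + N + N + N + p := by
        rw [hm₂.entry_eval g11, hm₂.nBase_eval]
      have ev : (RealExpr.add (.load (entry nBase)) (.mul coordExpr coordExpr)).eval s₂
          = sqSum d U p (t + 1) := by
        simp only [RealExpr.eval, en, hm₂.hF p hp, Function.update_self,
          hm₂.coordExpr_eval g13 hidx]
        rw [sqSum, sqSum, Finset.sum_range_succ, sq (U _)]
      rw [en, ev]
      have h3 := hm₂.set_F hp (sqSum d U p (t + 1))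
      rw [Function.update_idem] at h3
      refine ⟨?_, by simp [g10], by simp [g11], by simp, ?_,
        (h3.setN (by norm_num) _).setN (by norm_num) _⟩
      · simp [NatExpr.cost, RealExpr.cost, entry, nBase, sBase, aBase, zBase, coordExpr]
      · simp [NatExpr.eval, g13]
        ring
    · rintro s₂ t ⟨g11, g10, g13, hm₂⟩ ht
      refine .setReal ?_
      rw [update_splice (fun p => sqSum d U p d) (fun _ => 0) p] at hm₂
      have e1 : (entry sBase).eval s₂ = B + 8 + N + N + p := by
        rw [hm₂.entry_eval g11, hm₂.sBase_eval]
      have e2 : (RealExpr.load (entry nBase)).eval s₂ = sqSum d U p d := by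
        rw [RealExpr.eval, hm₂.entry_eval g11, hm₂.nBase_eval, hm₂.hF p hp,
          splice_of_lt _ _ p.lt_succ_self]
      rw [e1, e2]
      have h3 := hm₂.set_S hp (sqSum d U p d)
      rw [update_splice (fun p => sqSum d U p d) S p] at h3
      refine ⟨?_, by simp [g11], by simp, ?_, h3.setN (by norm_num) _⟩
      · simp only [NatExpr.cost, RealExpr.cost, entry, nBase, sBase, aBase, zBase, cell_cost]
        omega
      · simp [g13]
        ring
  · rintro s' t ⟨-, -, hm⟩ ht
    refine ⟨?_, ?_⟩
    · simp only [NatExpr.cost, uBase, nBase, sBase, aBase, zBase, cell_cost]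
      have e : N * (d * 100 + 100) = N * (d * 100 + 50 + 11) + N * 39 := by ring
      omega
    · exact
      { hm with
        hS := hm.hS.congr fun p hp => splice_of_lt _ _ hp
        hF := hm.hF.congr fun p hp => splice_of_lt _ _ hp }

end RealRAM

/-! ### The complete algorithm -/

namespace RealRAM

/-- The whole algorithm. -/
def reduceDimension : Program :=
  .seq computeLog (.seq computeInv (.seq computeRows (.seq computeSizes (.seq computePairs
    (.seq computeNorms (.seq chooseMatrix (.seq (assign 1 outBase) (assign 0 (cell 5)))))))))

/-- The choice of the matrix dominates; as `L`, `n` and `l` are at most `k`, the other stages are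
absorbed. -/
theorem time_bound {d m k L n l : ℕ} (hd : 1 ≤ d) (hm : 1 ≤ m) (hk : 1 ≤ k) (hL : L ≤ k)
    (hn : n ≤ k) (hl : l ≤ k) :
    L * 30 + 30 + (n * 30 + 30) + (l * 50 + 30) + (m * 60 + m * m * 30 + 120) +
      (m * (m * (d * 100 + 100) + 100) + 100) + ((m * m + m * m) * (d * 100 + 100) + 100) +
      (k * (d * ((m * m + m * m) * (k * 2000 + 500) + 511) + (m * m + m * m) * 200 + 50) + 50) +
      100 ≤ 20000 * (d * (m * m) * (k * k)) := by
  have h1 : m ≤ m * m := Nat.le_mul_self m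
  obtain ⟨M, hM⟩ : ∃ M, M = m * m := ⟨_, rfl⟩
  have hM1 : 1 ≤ M := by omega
  have h2 : M ≤ d * M := Nat.le_mul_of_pos_left M hd
  have h3 : d ≤ d * M := Nat.le_mul_of_pos_right d hM1
  have h4 : k ≤ k * k := Nat.le_mul_self k
  have h5 : d * M ≤ d * M * (k * k) := Nat.le_mul_of_pos_right _ (by omega)
  have h6 : k * k ≤ d * M * (k * k) := Nat.le_mul_of_pos_left _ (by omega)
  have h7 : d * M * k ≤ d * M * (k * k) := Nat.mul_le_mul_left _ h4
  have h8 : d * k ≤ d * M * k := Nat.mul_le_mul_right _ h3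
  have h9 : M * k ≤ d * M * k := Nat.mul_le_mul_right _ h2
  have e : m * (m * (d * 100 + 100) + 100) = M * (d * 100 + 100) + m * 100 := by rw [hM]; ring
  rw [e]
  rw [← hM] at h1 ⊢
  linarith

theorem wp_reduceDimension {d m : ℕ} (hd : 1 ≤ d) (hm : 2 ≤ m) {ε : ℝ} (hε : 0 < ε)
    (v : Fin m → Fin d → ℝ) {L n l k : ℕ} (hL : L = Nat.clog 2 m) (hn : n = ⌈1 / ε⌉₊)
    (hl : l = rowsRoot L n) (hk : k = l * l) :
    Wp reduceDimension (input ε v) fun s t => t ≤ 20000 * (d * (m * m) * (k * k)) ∧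
      s.nat 0 = k ∧ ∃ Y : ℕ → ℝ,
        ArrayAt (s.nat 1) (k * d) (fun x => Y x * ((1 + 1 / (2 * n)) / l)) s ∧
        totalPot d k n (m * m + m * m) (pairCoord m d fun x => (input ε v).real (1 + x)) Y k 0
          ≤ 2 * ((m * m + m * m : ℕ) : ℝ) := by
  have hL0 : 0 < L := by rw [hL]; exact Nat.clog_pos one_lt_two hm
  have hn0 : 0 < n := by rw [hn]; exact Nat.ceil_pos.2 (by positivity)
  set V : ℕ → ℝ := fun x => (input ε v).real (1 + x) with hV
  -- Memory beyond the input is zero, so the tables and the accumulators for the norms need no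
  -- initialization.
  have hz : ∀ y, m * d < y → (input ε v).real y = 0 := by
    intro y hy
    obtain ⟨x, rfl⟩ : ∃ x, y = x + 1 := ⟨y - 1, by omega⟩
    simp only [input]
    rw [dif_neg (by omega)]
  refine .seq ((wp_computeLog (s := input ε v) rfl).mono ?_)
  rintro s₁ t₁ ⟨b1, r1, c1, f1⟩
  have hm1 : (input ε v).nat 1 = m := rfl
  rw [hm1, ← hL] at b1 c1
  refine .seq ((wp_computeInv hε (by rw [r1]; rfl) (by rw [f1 _ (by norm_num) (by norm_num)]; rfl)
    ).mono ?_)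
  rintro s₂ t₂ ⟨b2, r2, c2, f2⟩
  rw [← hn] at b2 c2
  refine .seq ((wp_computeRows hL0 hn0 (by rw [f2 _ (by norm_num), c1]) c2
    (by rw [f2 _ (by norm_num), f1 _ (by norm_num) (by norm_num)]; rfl)
    (by rw [f2 _ (by norm_num), f1 _ (by norm_num) (by norm_num)]; rfl)).mono ?_)
  rintro s₃ t₃ ⟨b3, r3, c3, c3', f3⟩
  rw [← hl] at b3 c3 c3'
  rw [← hk] at c3'
  have F3 : ∀ i, i ≠ 2 → i ≠ 16 → i ≠ 3 → i ≠ 4 → i ≠ 5 → s₃.nat i = (input ε v).nat i :=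
    fun i i1 i2 i3 i4 i5 => by rw [f3 i i4 i5, f2 i i3, f1 i i1 i2]
  refine .seq ((wp_computeSizes (d := d) (m := m)
    (by rw [F3 _ (by norm_num) (by norm_num) (by norm_num) (by norm_num) (by norm_num)]; rfl)
    (by rw [F3 _ (by norm_num) (by norm_num) (by norm_num) (by norm_num) (by norm_num)]; rfl)
    (by rw [F3 _ (by norm_num) (by norm_num) (by norm_num) (by norm_num) (by norm_num)]; rfl)
    (by rw [F3 _ (by norm_num) (by norm_num) (by norm_num) (by norm_num) (by norm_num)]; rfl)
    (by rw [F3 _ (by norm_num) (by norm_num) (by norm_num) (by norm_num) (by norm_num)]; rfl)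
    ).mono ?_)
  rintro s₄ t₄ ⟨b4, r4, c4, c4', c4'', f4⟩
  have R4 : s₄.real = (input ε v).real := by rw [r4, r3, r2, r1]
  have n0 : s₄.nat 0 = d := by
    rw [f4 _ (by norm_num), F3 _ (by norm_num) (by norm_num) (by norm_num) (by norm_num)
      (by norm_num)]; rfl
  have n1 : s₄.nat 1 = m := by
    rw [f4 _ (by norm_num), F3 _ (by norm_num) (by norm_num) (by norm_num) (by norm_num)
      (by norm_num)]; rfl
  have hub : uBase.eval s₄ = m * d + 1 + 8 + (m * m + m * m) + (m * m + m * m) +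
      (m * m + m * m) + (m * m + m * m) := by
    simp [uBase, nBase, sBase, aBase, zBase, NatExpr.eval, c4', c4'']
  refine .seq ((wp_computePairs (V := V) n0 n1 c4 (fun x _ => by rw [R4])
    (by rw [hub]; omega)).mono ?_)
  rintro s₅ t₅ ⟨b5, f5, r5, a5⟩
  rw [hub] at r5 a5
  have hm5 : Mem d l k n (m * m + m * m) (m * m * d) (m * d + 1) (pairCoord m d V) (fun _ => 0)
      (fun _ => 0) (fun _ => 0) (fun _ => 0) s₅ := by
    refine ⟨?_, ?_, ?_, ?_, ?_, ?_, ?_, fun x hx => ?_, fun x hx => ?_, fun x hx => ?_,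
      fun x hx => ?_, a5⟩
    · rw [f5 _ (by norm_num), n0]
    · rw [f5 _ (by norm_num), f4 _ (by norm_num), f3 _ (by norm_num) (by norm_num), c2]
    · rw [f5 _ (by norm_num), f4 _ (by norm_num), c3]
    · rw [f5 _ (by norm_num), f4 _ (by norm_num), c3']
    · rw [f5 _ (by norm_num), c4]
    · rw [f5 _ (by norm_num), c4']
    · rw [f5 _ (by norm_num), c4'']
    all_goals rw [r5 _ (by omega), R4, hz _ (by omega)]
  have hND : (m * m + m * m) * d = m * m * d + m * m * d := by ring
  refine .seq ((wp_computeNorms hND hm5).mono ?_)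
  rintro s₆ t₆ ⟨b6, hm6⟩
  refine .seq ((wp_chooseMatrix hn0 hND hm6).mono ?_)
  rintro s₇ t₇ ⟨b7, Y, hm7, out, -, pot⟩
  refine .seq (.assign (.assign ?_))
  rw [hm7.outBase_eval]
  refine ⟨?_, by simp [hm7.hk], Y, ?_, pot⟩
  · have hk0 : 1 ≤ l := by rw [hl, rowsRoot]; omega
    have hk1 : 1 ≤ k := by rw [hk]; exact Nat.mul_pos hk0 hk0
    have hkX : 5120 * (L * (n * n)) ≤ k := by
      rw [hk, ← not_lt, ← lt_rowsRoot hL0 hn0, ← hl]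
      exact lt_irrefl _
    have hLX : L ≤ L * (n * n) := Nat.le_mul_of_pos_right _ (by positivity)
    have hnX : n ≤ L * (n * n) := (Nat.le_mul_self n).trans (Nat.le_mul_of_pos_left _ hL0)
    have hlk : l ≤ k := by rw [hk]; exact Nat.le_mul_self l
    have := time_bound (L := L) (n := n) (l := l) hd (by omega : 1 ≤ m) hk1 (by omega) (by omega)
      hlk
    simp only [NatExpr.cost, outBase, uBase, nBase, sBase, aBase, zBase, cell_cost]
    omega
  · intro x hx
    simpa using out x hx

end RealRAM

/-! ### From the final potential to the theorem -/

open RealRAM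

/-- The matrix with the entries `Y`, chosen so that the final potential is small, nearly preserves
the lengths of the vectors after scaling. -/
theorem scaled_rowsSq_bounds {d n N L l : ℕ} {U Y : ℕ → ℝ} (hn : 0 < n) (hl : 0 < l)
    (hk : 5120 * (L * (n * n)) ≤ l * l) (hN : 2 * N ≤ 2 ^ (5 * L))
    (hpot : totalPot d (l * l) n N U Y (l * l) 0 ≤ 2 * N) {p : ℕ} (hp : p < N) :
    sqSum d U p d ≤ ((1 + 1 / (2 * n)) / l : ℝ) ^ 2 * rowsSq d U Y (l * l) p ∧
      ((1 + 1 / (2 * n)) / l : ℝ) ^ 2 * rowsSq d U Y (l * l) p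
        ≤ (1 + 1 / n) ^ 2 * sqSum d U p d := by
  have hn1 : (1 : ℝ) ≤ n := by exact_mod_cast hn
  rcases (sqSum_nonneg d U p d).eq_or_lt with h0 | h0
  -- The potential says nothing about a zero vector, but its image is zero.
  · have hU : ∀ t ∈ Finset.range d, U (p * d + t) ^ 2 = 0 :=
      (Finset.sum_eq_zero_iff_of_nonneg fun _ _ => sq_nonneg _).1 h0.symm
    have hz : rowsSq d U Y (l * l) p = 0 := by
      refine Finset.sum_eq_zero fun i _ => ?_
      rw [rowProd, Finset.sum_eq_zero fun t ht => ?_, zero_pow two_ne_zero]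
      rw [pow_eq_zero_iff two_ne_zero |>.1 (hU t ht), mul_zero]
    rw [hz, ← h0]; simp
  · have hγ1 : (1 : ℝ) / (8 * n) ≤ 1 / 8 := by
      rw [div_le_div_iff₀ (by positivity) (by norm_num)]; linarith
    have hterm : ∀ p, 0 ≤ potential (l * l) (1 / (8 * n)) (1 / (8 * n) / (8 * (l * l : ℕ)))
        (sqSum d U p d) (rowsSq d U Y (l * l) p) 0 (sqSum d U p d) (-1) := fun p =>
      potential_nonneg (by positivity) (by linarith) (by positivity) (sqSum_nonneg d U p d)
        (rowsSq_nonneg d U Y _ p) (sqSum_nonneg d U p d) le_rfl (by linarith)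
    have hsum : ∑ p ∈ Finset.range N, potential (l * l) (1 / (8 * n))
        (1 / (8 * n) / (8 * (l * l : ℕ))) (sqSum d U p d) (rowsSq d U Y (l * l) p) 0
        (sqSum d U p d) (-1) ≤ 2 * N := by
      refine le_trans (le_of_eq (Finset.sum_congr rfl fun p _ => ?_)) hpot
      congr 1
      · simp [sqSum]
      · ring
    have hle := (Finset.single_le_sum (fun p _ => hterm p) (Finset.mem_range.2 hp)).trans hsum
    have hN' : (2 * N : ℝ) ≤ 2 ^ (5 * L) := by exact_mod_cast hN
    -- The choice `j = 1024 n²` gives `j γ² = 16` exactly, and `j b = 5120 L n²` is at most the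
    -- number of rows.
    obtain ⟨h1, h2⟩ := bounds_of_potential_le (j := 1024 * (n * n)) (b := 5 * L)
      (Nat.mul_pos hl hl) (by positivity) (by positivity) hγ1 rfl (by
        push_cast; field_simp; norm_num) (by nlinarith) h0 (rowsSq_nonneg d U Y _ p)
      (hle.trans hN')
    exact scaled_bounds hn hl h0.le h1 h2

/-- Rounding up to a square costs at most a factor `4`; with `n ≤ 2 / ε` and `L ≤ 4 log m` the
constant is `4 * 5120 * 4 * 4`. -/
theorem rowsRoot_sq_le {m : ℕ} (hm : 2 ≤ m) {ε : ℝ} (hε : 0 < ε) (hε1 : ε ≤ 1) :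
    ((rowsRoot (Nat.clog 2 m) ⌈1 / ε⌉₊ * rowsRoot (Nat.clog 2 m) ⌈1 / ε⌉₊ : ℕ) : ℝ)
      ≤ 327680 * (Real.log m / ε ^ 2) := by
  set L := Nat.clog 2 m with hL
  set n := ⌈1 / ε⌉₊ with hn
  have hL0 : 0 < L := Nat.clog_pos one_lt_two hm
  have hn0 : 0 < n := Nat.ceil_pos.2 (by positivity)
  have hm2 : (2 : ℝ) ≤ m := by exact_mod_cast hm
  have hX : 0 < L * (n * n) := by positivity
  have hl : rowsRoot L n * rowsRoot L n ≤ 4 * (5120 * (L * (n * n))) := by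
    rw [rowsRoot]
    have h1 : 1 ≤ Nat.sqrt (5120 * (L * (n * n)) - 1) := by rw [Nat.le_sqrt]; omega
    have h2 := Nat.sqrt_le (5120 * (L * (n * n)) - 1)
    generalize Nat.sqrt (5120 * (L * (n * n)) - 1) = x at *
    have h3 : x * x ≤ 5120 * (L * (n * n)) := by omega
    nlinarith
  have hnε : (n : ℝ) ≤ 2 / ε := by
    have h1 := (Nat.ceil_lt_add_one (by positivity : 0 ≤ 1 / ε)).le
    have h2 : 1 ≤ 1 / ε := by rw [le_div_iff₀ hε]; linarith
    have h3 : 2 / ε = 1 / ε + 1 / ε := by ring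
    rw [← hn] at h1
    linarith
  have hLm : (L : ℝ) ≤ 4 * Real.log m := by
    have h1 : 2 ^ (L - 1) < m := Nat.pow_pred_clog_lt_self one_lt_two hm
    have h2 : ((2 : ℝ) ^ (L - 1)) ≤ m := by exact_mod_cast h1.le
    have h3 := Real.log_le_log (by positivity) h2
    rw [Real.log_pow, Nat.cast_sub hL0, Nat.cast_one] at h3
    have h4 := Real.log_le_log (by norm_num) hm2
    have h5 := Real.log_two_gt_d9
    have hL1 : (1 : ℝ) ≤ L := by exact_mod_cast hL0
    nlinarith
  have hlog : 0 ≤ Real.log m := Real.log_nonneg (by linarith)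
  calc ((rowsRoot L n * rowsRoot L n : ℕ) : ℝ) ≤ ((4 * (5120 * (L * (n * n))) : ℕ) : ℝ) := by
        exact_mod_cast hl
    _ = 20480 * (L * (n * n)) := by push_cast; ring
    _ ≤ 20480 * ((4 * Real.log m) * (2 / ε * (2 / ε))) := by gcongr
    _ = _ := by field_simp; ring

theorem dotProduct_mulVec_outMatrix {d k : ℕ} {s : State} {Y U : ℕ → ℝ} {c : ℝ}
    (hk : s.nat 0 = k) (h : ArrayAt (s.nat 1) (k * d) (fun x => Y x * c) s) {p : ℕ}
    {u : Fin d → ℝ} (hu : ∀ t : Fin d, u t = U (p * d + t)) :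
    (s.outMatrix d).mulVec u ⬝ᵥ (s.outMatrix d).mulVec u = c ^ 2 * rowsSq d U Y k p := by
  have hentry : ∀ r : Fin s.outDim, (s.outMatrix d).mulVec u r = c * rowProd d U Y r p d := by
    intro r
    have hr : (r : ℕ) < k := hk ▸ r.isLt
    rw [rowProd, Finset.sum_range, Finset.mul_sum, Matrix.mulVec, dotProduct]
    refine Finset.sum_congr rfl fun t _ => ?_
    have hlt : (r : ℕ) * d + t < k * d := by
      have := Nat.mul_le_mul_right d (Nat.succ_le_of_lt hr)
      rw [Nat.succ_mul] at this
      have := t.isLt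
      omega
    have := h _ hlt
    change s.real (s.nat 1 + d * r + t) * u t = _
    rw [mul_comm d, add_assoc, this, hu]
    ring
  have hdim : s.outDim = k := hk
  rw [rowsSq, ← hdim, Finset.sum_range, Finset.mul_sum]
  refine Finset.sum_congr rfl fun r _ => ?_
  rw [hentry]
  ring

/-- The total potential is at most `4 m² ≤ 2 ^ (2 + 2 L)`, and `2 + 2 L ≤ 5 L` because `L ≥ 1`. -/
theorem two_mul_pairs_le (m : ℕ) (hm : 2 ≤ m) :
    2 * (m * m + m * m) ≤ 2 ^ (5 * Nat.clog 2 m) := by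
  have h := Nat.le_pow_clog one_lt_two m
  have hL : 0 < Nat.clog 2 m := Nat.clog_pos one_lt_two hm
  calc 2 * (m * m + m * m) = 2 ^ 2 * (m * m) := by ring
    _ ≤ 2 ^ 2 * (2 ^ Nat.clog 2 m * 2 ^ Nat.clog 2 m) :=
        Nat.mul_le_mul_left _ (Nat.mul_le_mul h h)
    _ = 2 ^ (2 + 2 * Nat.clog 2 m) := by rw [pow_add, two_mul, pow_add]
    _ ≤ _ := Nat.pow_le_pow_right two_pos (by omega)

theorem lemma3p3 :
    ∃ (P : RealRAM.Program) (C K : ℝ) (c : ℕ),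
      ∀ (d m : ℕ) (ε : ℝ) (v : Fin m → Fin d → ℝ),
        1 ≤ d → 2 ≤ m → 0 < ε → ε ≤ 1 →
        ∃ (s : RealRAM.State) (t : ℕ),
          RealRAM.Exec P (RealRAM.input ε v) s t ∧
          (t : ℝ) ≤ C * (d * (m : ℝ) ^ 2 * (Real.log m + 1 / ε) ^ c) ∧
          (s.outDim : ℝ) ≤ K * (Real.log m / ε ^ 2) ∧
          expSup v ≤ expSup (fun i => (s.outMatrix d).mulVec (v i)) ∧
          expSup (fun i => (s.outMatrix d).mulVec (v i)) ≤ (1 + ε) * expSup v := by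
  -- The time is at most `20000 d m² k²` with `k ≤ 327680 (log m + 1 / ε) ^ 3`, whence the square of
  -- the constant and the exponent `6`.
  refine ⟨reduceDimension, 20000 * 327680 ^ 2, 327680, 6, fun d m ε v hd hm hε hε1 => ?_⟩
  obtain ⟨s, t, hex, ht, h0, Y, hout, hpot⟩ :=
    wp_reduceDimension hd hm hε v rfl rfl rfl rfl
  have hkb := rowsRoot_sq_le hm hε hε1
  have hL0 : 0 < Nat.clog 2 m := Nat.clog_pos one_lt_two hm
  have hn0 : 0 < ⌈1 / ε⌉₊ := Nat.ceil_pos.2 (by positivity)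
  have hlX : 5120 * (Nat.clog 2 m * (⌈1 / ε⌉₊ * ⌈1 / ε⌉₊))
      ≤ rowsRoot (Nat.clog 2 m) ⌈1 / ε⌉₊ * rowsRoot (Nat.clog 2 m) ⌈1 / ε⌉₊ := by
    rw [← not_lt, ← lt_rowsRoot hL0 hn0]
    exact lt_irrefl _
  have hl0 : 0 < rowsRoot (Nat.clog 2 m) ⌈1 / ε⌉₊ := Nat.succ_pos _
  have hnε : 1 / (⌈1 / ε⌉₊ : ℝ) ≤ ε := by
    have := Nat.le_ceil (1 / ε)
    rw [div_le_iff₀ hε] at this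
    rw [div_le_iff₀ (by exact_mod_cast hn0)]
    linarith
  generalize ⌈1 / ε⌉₊ = n at *
  generalize rowsRoot (Nat.clog 2 m) n = l at *
  refine ⟨s, t, hex, ?_, ?_, ?_⟩
  · have hlog : 0 ≤ Real.log m := Real.log_nonneg (by exact_mod_cast (by omega : 1 ≤ m))
    have hkΛ : ((l * l : ℕ) : ℝ) ≤ 327680 * (Real.log m + 1 / ε) ^ 3 := by
      refine hkb.trans ?_
      have h1 : 0 ≤ 1 / ε := by positivity
      calc 327680 * (Real.log m / ε ^ 2) = 327680 * (Real.log m * (1 / ε) ^ 2) := by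
            rw [one_div, inv_pow, div_eq_mul_inv]
        _ ≤ 327680 * ((Real.log m + 1 / ε) * (Real.log m + 1 / ε) ^ 2) := by
            gcongr <;> linarith
        _ = _ := by ring
    calc (t : ℝ) ≤ ((20000 * (d * (m * m) * (l * l * (l * l))) : ℕ) : ℝ) := by exact_mod_cast ht
      _ = 20000 * (d * (m : ℝ) ^ 2 * (((l * l : ℕ) : ℝ) * ((l * l : ℕ) : ℝ))) := by
          push_cast; ring
      _ ≤ 20000 * (d * (m : ℝ) ^ 2 * ((327680 * (Real.log m + 1 / ε) ^ 3) *
            (327680 * (Real.log m + 1 / ε) ^ 3))) := by gcongr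
      _ = _ := by ring
  · rw [State.outDim, h0]
    exact hkb
  · have hb := expSup_mulVec_bounds (by omega : 0 < m) (by positivity : (0 : ℝ) ≤ 1 / n) v
      (s.outMatrix d) ?_
    · refine ⟨hb.1, hb.2.trans ?_⟩
      exact mul_le_mul_of_nonneg_right (by linarith) (expSup_nonneg v)
    · have hV : ∀ (i : Fin m) (t : Fin d), (input ε v).real (1 + (i * d + t)) = v i t := by
        intro i t
        rw [← input_real ε v i t]
        congr 1
        ring
      have main : ∀ u : Fin d → ℝ, (∃ p < m * m + m * m, ∀ t : Fin d,
          u t = pairCoord m d (fun x => (input ε v).real (1 + x)) (p * d + t)) →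
          u ⬝ᵥ u ≤ (s.outMatrix d).mulVec u ⬝ᵥ (s.outMatrix d).mulVec u ∧
            (s.outMatrix d).mulVec u ⬝ᵥ (s.outMatrix d).mulVec u
              ≤ (1 + 1 / n) ^ 2 * (u ⬝ᵥ u) := by
        rintro u ⟨p, hp, hu⟩
        have hsq : u ⬝ᵥ u
            = sqSum d (pairCoord m d fun x => (input ε v).real (1 + x)) p d := by
          rw [sqSum, Finset.sum_range]
          exact Finset.sum_congr rfl fun t _ => by rw [hu, sq]
        rw [dotProduct_mulVec_outMatrix h0 hout hu, hsq]
        exact scaled_rowsSq_bounds hn0 hl0 hlX (two_mul_pairs_le m hm) hpot hp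
      rintro u ⟨i, j, rfl | rfl⟩
      · refine main _ ⟨i * m + j, ?_, fun t => ?_⟩
        -- With `d = 1` and offset `0` this says `i * m + j < m * m`.
        · have := pair_index_lt (d := 1) i.isLt j.isLt zero_lt_one
          omega
        · rw [pairCoord_add _ i.isLt j.isLt t.isLt, hV, hV, Pi.add_apply]
      · refine main _ ⟨m * m + (i * m + j), ?_, fun t => ?_⟩
        · have := pair_index_lt (d := 1) i.isLt j.isLt zero_lt_one
          omega
        · rw [add_mul, add_assoc, pairCoord_sub _ j.isLt t.isLt, hV, hV, Pi.sub_apply]
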